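/- **Definitions.** $\Diamond$ is Jensen's principle: there are sets $A_\alpha\subseteq\alpha$ ($\alpha<\omega_1$) such that for every $B\subseteq\omega_1$ the set $\{\alpha<\omega_1: B\cap\alpha=A_\alpha\}$ is stationary. For a Banach space $X$ and $\tau\ge 0$, an *uncountable $\tau$-biorthogonal system* of $X$ is a sequence $(y_\alpha,y_\alpha^*)_{\alpha<\omega_1}$ in $X\times X^*$ with $y^*_\alpha(y_\alpha)=1$ for all $\alpha$ and $|y^*_\alpha(y_\beta)|\le\tau$ for all $\alpha\ne\beta$; for $\tau=0$ it is called an uncountable *biorthogonal system*. For $A,B\subset\omega_1$ write $A<B$ if $a<b$ for all $a\in A$, $b\in B$. Sequences $(m_k,n_k,r_k)_{k<\omega}$ of natural numbers form a *type* if $m_0=1$, for every $r<\omega$ there are infinitely many $k$ with $r_k=r$, and for every $k>0$: $r_k<m_{k-1}$, $n_k>k$ and $m_k=n_k(m_{k-1}-r_k)+r_k$. A *construction scheme* of this type is a family $\mathcal F$ of finite subsets of $\omega_1$, partitioned as $\mathcal F=\bigcup_k\mathcal F_k$ with $\mathcal F_0$ the set of all singletons, together with an initial segment $R(F)$ of each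 $F\in\mathcal F$, such that: every finite subset of $\omega_1$ is contained in some $F\in\mathcal F$; $|F|=m_k$ and $|R(F)|=r_k$ for $F\in\mathcal F_k$; $E\cap F$ is an initial segment of $E$ and of $F$ for $E,F\in\mathcal F_k$; and for $k>0$ each $F\in\mathcal F_k$ is the union of a unique finite family of members of $\mathcal F_{k-1}$, which is $F_0,\dots,F_{n_k-1}$ (the canonical decomposition) with $F_i\cap F_j=R(F)$ for $i\neq j$ and $R(F)<F_0\setminus R(F)<\dots<F_{n_k-1}\setminus R(F)$. Let $\varphi_i:F_0\to F_i$ be the increasing bijection, and for a function $f$ on $F_0$ let $\varphi_i(f)=f\circ\varphi_i^{-1}$. A $\Delta$-system with root $R$ is a sequence $(D_\alpha)_{\alpha<\omega_1}$ of finite subsets of $\omega_1$ with $D_\alpha\cap D_\beta=R$ and $R<D_\alpha\setminus R<D_\beta\setminus R$ for $\alpha<\beta$. The scheme is *capturing* if for every $N<\omega$ and every such $\Delta$-system there are $k>0$ with $N\le n_k$, $F\in\mathcal F_k$ and $\alpha_0<\dots<\alpha_{N-1}$ with $R\subseteq R(F)$, and $D_{\alpha_i}\subseteq F_i$ and $\varphi_i(D_{\alpha_0})=D_{\alpha_i}$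 for all $i<N$. Given a scheme $\mathcal F$ and $\varepsilon$, define functions $h^F_\alpha:F\to\mathbb R$ ($F\in\mathcal F$, $\alpha\in F$) by recursion on the rank $k$ of $F$ (that is, $F\in\mathcal F_k$). For $F=\{\alpha\}$ let $h^F_\alpha(\alpha)=1$. For $k>0$, with canonical decomposition $(F_i)_{i<n_k}$, $R=R(F)$, and functions on subsets of $F$ extended by zero: 1. for $\alpha\in R$: $h^F_\alpha=h^{F_0}_\alpha+\sum_{0<i<n_k}\varphi_i(h^{F_0}_\alpha)\restriction(F_i\setminus F_0)$; 2. for $\alpha\in F_0\setminus R$: $h^F_\alpha=h^{F_0}_\alpha+\varepsilon\sum_{2\le i<n_k}(-1)^i\varphi_i(h^{F_0}_\alpha)\restriction(F_i\setminus F_0)$; 3. for $\delta=\varphi_1(\alpha)\in F_1\setminus R$ with $\alpha\in F_0\setminus R$: $h^F_\delta=\varphi_1(h^{F_0}_\alpha)+\varepsilon\sum_{2\le i<n_k}(-1)^{i+1}\varphi_i(h^{F_0}_\alpha)\restriction(F_i\setminus F_0)$; 4. for $\alpha\in F_j\setminus R$ with $2\le j<n_k$: $h^F_\alpha=h^{F_j}_\alpha$.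 Let $c_{00}(\omega_1)$ be the space of finitely supported functions $\omega_1\to\mathbb R$. **Theorem.** Assume $\Diamond$. Then for every rational $\varepsilon\in(0,1)$ there are a type and a capturing construction scheme $\mathcal F$ of this type such that $$\|x\|_\varepsilon=\max\Bigl\{\Bigl|\sum_{\xi\in F}h^F_\alpha(\xi)\,x(\xi)\Bigr| : F\in\mathcal F,\ \operatorname{supp}x\subseteq F,\ \alpha\in F\Bigr\}$$ (the maximum being attained) defines a norm on $c_{00}(\omega_1)$, and the completion $X_\varepsilon$ of $(c_{00}(\omega_1),\|\cdot\|_\varepsilon)$ is a Banach space that has an uncountable $\varepsilon$-biorthogonal system but has no uncountable $\tau$-biorthogonal system for any real $0\le\tau<\frac{\varepsilon}{1+\varepsilon}$. In particular $X_\varepsilon$ has no uncountable biorthogonal system. -/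

import Mathlib

noncomputable section

/-- The set `ω₁` of countable ordinals, with its well-order. -/
abbrev Omega1 : Type := (Ordinal.omega 1 : Ordinal.{0}).ToType

/-- Jensen's principle `◇`: there are sets `A α ⊆ α` (`α < ω₁`) such that for every `B ⊆ ω₁`
there are stationarily many `α` with `B ∩ α = A α`. -/
def Diamond : Prop :=
  ∃ A : Omega1 → Set Omega1, (∀ α, A α ⊆ Set.Iio α) ∧
    ∀ B : Set Omega1, IsStationary {α : Omega1 | B ∩ Set.Iio α = A α}

/-! ### Biorthogonal systems -/

/-- `(y α, f α)` for `α < ω₁` is a `τ`-biorthogonal system of `X`. -/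
def IsBiorthogonalSystem {X : Type*} [NormedAddCommGroup X] [NormedSpace ℝ X] (τ : ℝ)
    (y : Omega1 → X) (f : Omega1 → StrongDual ℝ X) : Prop :=
  (∀ α, f α (y α) = 1) ∧ ∀ α β, α ≠ β → |f α (y β)| ≤ τ

/-- `X` has an uncountable `τ`-biorthogonal system. -/
def HasUncountableBiorthogonalSystem (X : Type*) [NormedAddCommGroup X] [NormedSpace ℝ X]
    (τ : ℝ) : Prop :=
  ∃ (y : Omega1 → X) (f : Omega1 → StrongDual ℝ X), IsBiorthogonalSystem τ y f

/-! ### Finite sets of countable ordinals -/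

/-- `A` is an initial segment of `F`. -/
def IsInitialSegment (A F : Finset Omega1) : Prop :=
  A ⊆ F ∧ ∀ a ∈ A, ∀ b ∈ F, b < a → b ∈ A

/-- `A < B`: every element of `A` is below every element of `B`. -/
def SetLT (A B : Finset Omega1) : Prop := ∀ a ∈ A, ∀ b ∈ B, a < b

/-- The increasing bijection from `A` onto `B`, for finite sets of the same cardinality, as a map on
`ω₁` (the identity outside `A`, or if the cardinalities differ). -/
def incMap (A B : Finset Omega1) (x : Omega1) : Omega1 :=
  if h : B.card = A.card ∧ x ∈ A then
    (B.orderIsoOfFin h.1 ((A.orderIsoOfFin rfl).symm ⟨x, h.2⟩) : Omega1)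
  else x

/-- The copy on `B` of a function `f` on `A`: the function `f ∘ φ⁻¹`, where `φ : A → B` is the
increasing bijection, extended by zero outside `B`. -/
def pushFwd (A B : Finset Omega1) (f : Omega1 → ℝ) (ξ : Omega1) : ℝ :=
  if ξ ∈ B then f (incMap B A ξ) else 0

/-- The restriction of `f` to the finite set `A`, extended by zero. -/
def restr (A : Finset Omega1) (f : Omega1 → ℝ) (ξ : Omega1) : ℝ :=
  if ξ ∈ A then f ξ else 0

/-- `(D α)` for `α < ω₁` is a `Δ`-system with root `R`. -/
def IsDeltaSystem (D : Omega1 → Finset Omega1) (R : Finset Omega1) : Prop :=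
  ∀ α β, α < β → D α ∩ D β = R ∧ SetLT R (D α \ R) ∧ SetLT (D α \ R) (D β \ R)

/-! ### Capturing construction schemes -/

/-- The three sequences `(m k, n k, r k)` form a type. -/
structure IsSchemeType (m n r : ℕ → ℕ) : Prop where
  m_zero : m 0 = 1
  r_lt : ∀ k, r (k + 1) < m k
  lt_n : ∀ k, 0 < k → k < n k
  r_infinite : ∀ j, {k | r k = j}.Infinite
  m_succ : ∀ k, m (k + 1) = n (k + 1) * (m k - r (k + 1)) + r (k + 1)

/-- A construction scheme of type `(m k, n k, r k)`: a family of finite subsets of `ω₁`, partitioned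
into levels `level k`, together with the roots `root F` and the canonical decompositions
`F = piece F 0 ∪ ⋯ ∪ piece F (n k - 1)` for `F ∈ level k`, `k > 0` (the values `piece F i` for other
`i` play no role). -/
structure ConstructionScheme (m n r : ℕ → ℕ) where
  level : ℕ → Set (Finset Omega1)
  root : Finset Omega1 → Finset Omega1
  piece : Finset Omega1 → ℕ → Finset Omega1
  level_disjoint : ∀ k l, k ≠ l → Disjoint (level k) (level l)
  level_zero : ∀ F, F ∈ level 0 ↔ ∃ α, F = {α}
  root_initial : ∀ k, ∀ F ∈ level k, IsInitialSegment (root F) F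
  cofinal : ∀ A : Finset Omega1, ∃ k, ∃ F ∈ level k, A ⊆ F
  card_eq : ∀ k, ∀ F ∈ level k, F.card = m k
  card_root : ∀ k, ∀ F ∈ level k, (root F).card = r k
  inter_initial : ∀ k, ∀ F ∈ level k, ∀ E ∈ level k,
    IsInitialSegment (E ∩ F) F ∧ IsInitialSegment (E ∩ F) E
  piece_mem : ∀ k, ∀ F ∈ level (k + 1), ∀ i < n (k + 1), piece F i ∈ level k
  union_piece : ∀ k, ∀ F ∈ level (k + 1), F = (Finset.range (n (k + 1))).biUnion (piece F)
  piece_unique : ∀ k, ∀ F ∈ level (k + 1), ∀ P : Finset (Finset Omega1),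
    (∀ G ∈ P, G ∈ level k) → F = P.biUnion id → P = (Finset.range (n (k + 1))).image (piece F)
  piece_inter : ∀ k, ∀ F ∈ level (k + 1), ∀ i j, i < j → j < n (k + 1) →
    piece F i ∩ piece F j = root F
  root_lt : ∀ k, ∀ F ∈ level (k + 1), ∀ i < n (k + 1), SetLT (root F) (piece F i \ root F)
  piece_lt : ∀ k, ∀ F ∈ level (k + 1), ∀ i j, i < j → j < n (k + 1) →
    SetLT (piece F i \ root F) (piece F j \ root F)

namespace ConstructionScheme

variable {m n r : ℕ → ℕ} (S : ConstructionScheme m n r)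

/-- The scheme is capturing: for every `N`, every uncountable `Δ`-system `D` with root `R` has
members `D (a 0), …, D (a (N - 1))`, `a 0 < ⋯ < a (N - 1)`, captured by some set of the scheme. -/
def IsCapturing : Prop :=
  ∀ (N : ℕ) (D : Omega1 → Finset Omega1) (R : Finset Omega1), IsDeltaSystem D R →
    ∃ k, ∃ F ∈ S.level (k + 1), ∃ a : ℕ → Omega1,
      N ≤ n (k + 1) ∧ (∀ i j, i < j → j < N → a i < a j) ∧ R ⊆ S.root F ∧
      ∀ i < N, D (a i) ⊆ S.piece F i ∧
        (D (a 0)).image (incMap (S.piece F 0) (S.piece F i)) = D (a i)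

/-- One step of the amalgamation. Here `F` is a set of the scheme of positive rank, with `N` pieces
`F_i` in its canonical decomposition and root `R`, and `g F_i α` is the function already constructed
on `F_i` for `α ∈ F_i`. The value is the function on `F` for `α ∈ F` (zero outside `F`). In the last
case `α` lies in exactly one `F_j` with `2 ≤ j < N`, and the sum is the function on that `F_j`. -/
def amalgamate (ε : ℝ) (N : ℕ) (F : Finset Omega1) (g : Finset Omega1 → Omega1 → Omega1 → ℝ)
    (α : Omega1) : Omega1 → ℝ :=
  if α ∈ S.root F then
    g (S.piece F 0) α + ∑ i ∈ Finset.Ico 1 N,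
      restr (S.piece F i \ S.piece F 0)
        (pushFwd (S.piece F 0) (S.piece F i) (g (S.piece F 0) α))
  else if α ∈ S.piece F 0 then
    g (S.piece F 0) α + ε • ∑ i ∈ Finset.Ico 2 N, (-1 : ℝ) ^ i •
      restr (S.piece F i \ S.piece F 0)
        (pushFwd (S.piece F 0) (S.piece F i) (g (S.piece F 0) α))
  else if α ∈ S.piece F 1 then
    pushFwd (S.piece F 0) (S.piece F 1)
        (g (S.piece F 0) (incMap (S.piece F 1) (S.piece F 0) α)) +
      ε • ∑ i ∈ Finset.Ico 2 N, (-1 : ℝ) ^ (i + 1) •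
        restr (S.piece F i \ S.piece F 0)
          (pushFwd (S.piece F 0) (S.piece F i)
            (g (S.piece F 0) (incMap (S.piece F 1) (S.piece F 0) α)))
  else
    ∑ j ∈ Finset.Ico 2 N, if α ∈ S.piece F j then g (S.piece F j) α else 0

/-- The function `h_α^F` for `F` of rank `k` and `α ∈ F`, extended by zero outside `F`. -/
def normFun (ε : ℝ) : ℕ → Finset Omega1 → Omega1 → Omega1 → ℝ
  | 0, F, α => if α ∈ F then Pi.single α 1 else 0
  | k + 1, F, α => S.amalgamate ε (n (k + 1)) F (normFun ε k) α

/-- The set of numbers whose maximum is the norm of `x ∈ c₀₀(ω₁)`: all `|⟨h_α^F, x⟩|` with `F` in the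
scheme, `supp x ⊆ F` and `α ∈ F`. Since the `h_α^F` extend each other to functions `h_α` on `ω₁`,
these are the values `|⟨h_α, x⟩|`. -/
def normValues (ε : ℝ) (x : Omega1 →₀ ℝ) : Set ℝ :=
  {t | ∃ k, ∃ F ∈ S.level k, x.support ⊆ F ∧ ∃ α ∈ F,
    t = |x.sum fun ξ c => S.normFun ε k F α ξ * c|}

/-- The Banach space `X`, with the embedding `ι`, is the completion of `c₀₀(ω₁)` under the norm
`‖x‖ = max |⟨h, x⟩|`, `h` ranging over the norming functions. -/
structure IsNormCompletion (ε : ℝ) (X : Type*) [NormedAddCommGroup X] [NormedSpace ℝ X]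
    (ι : (Omega1 →₀ ℝ) →ₗ[ℝ] X) : Prop where
  complete : CompleteSpace X
  injective : Function.Injective ι
  dense : DenseRange ι
  norm_eq : ∀ x, IsGreatest (S.normValues ε x) ‖ι x‖

end ConstructionScheme

end

/-! Everything takes place on finite sets of ordinals described by positions. The canonical pieces
`pc m r k F i` and the root `rt r k F` of a set `F` are determined by the positions of their elements
in `F`, so that a construction scheme is just a sequence of levels `L k` of finite sets which are
coherent (`Coh`) and closed under canonical pieces.

*The scheme.* It is built on `ω₁` consecutive blocks of type `ω`, one block at a time. A scheme on
the blocks before `b` is extended to the block `b` by a chain of sets `c k`, each a canonical piece of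
the next (`IsNewChain`). At rank `k`, the first point of the new block imitates an old point `α k`:
the part of `c k` before `b` is the part below `α k` of the old sets of rank `k` (`newSet`). One may
switch at rank `k` to any other old point with the same trace, and by such switches countably many
requirements can be met infinitely often (`exists_seq_of_tasks`, `exists_isStageExt`).

*Capturing.* Let `◇` guess families `𝒟 μ` of finite sets of the blocks before `μ`. For each `μ` the
new chains are asked to contain sets `G` of rank `k + 1` with a piece `F` such that the root of `G` is
the part of `F` before `μ`, a prescribed set `E ⊆ F` is given by positions in `F`, the same positions
select members of `𝒟 μ` in all pieces before `F`, and the number of these pieces is as large as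
possible (`Treated`, `Promise`). Given an uncountable family `D`, take `μ` where `D` is guessed
correctly and which reflects the existence of the sets in question, and `E ∈ D` not contained in the
blocks before `μ`. If `F` were not the last piece of `G`, then `G` would have a reflection before `μ`
with one more piece selecting a member of `𝒟 μ`, against maximality. So all pieces of `G` select
members of `D` (`exists_capturing_scheme`); for the members of a `Δ`-system this is capturing.

*The space.* The value of `h_α^F` at `ξ` depends only on the positions of `α` and `ξ` in `F` and on
the rank of `F` (`normFun_eq`, with the explicit recursion `posFun`). It is `1` for `ξ = α`, at most
`ε` in modulus for `ξ ≠ α`, and `0` for `ξ < α`; restricted to a smaller set of the scheme, `h_α^F` is a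
multiple of a norming function of that set by a factor of modulus at most one (`exists_restrict`).
Hence the maximum in the definition of the norm is attained on any set containing the support, and
the unit vectors with the functionals `h_α` form an `ε`-biorthogonal system.

*No better systems.* Given an uncountable `τ`-biorthogonal system, approximate its vectors by
rational ones, with the same coefficients in the same order for uncountably many indices. Capture
`x_0, …, x_{2M+1}` among these. The recursion gives
`‖x_0 - x_1 - (2Mε)⁻¹ ∑_{2 ≤ i < 2M+2} (-1)^i x_i‖ ≤ (2Mε)⁻¹ max ‖x_i‖` (`schemeNorm_captured`),
while the functional dual to the first vector takes on this combination a value close to at least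
`1 - τ - τ/ε`, which is positive for `τ < ε/(1+ε)`. For large `M` this is a contradiction. -/

noncomputable section

open Finset

namespace SchemeConstruction

section

/-! ### Positions of elements in finite sets of a linear order -/

section Positions

variable {T : Type*} [LinearOrder T]

/-- The part of `F` strictly below `x`. -/
def below (F : Finset T) (x : T) : Finset T := F.filter (· < x)

/-- The position of `x` in `F`: the number of elements of `F` below `x`. -/
def pos (F : Finset T) (x : T) : ℕ := (below F x).card

/-- The elements of `F` whose positions lie in `s`. -/
def sel (F : Finset T) (s : Finset ℕ) : Finset T := F.filter fun x => pos F x ∈ s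

/-- `F` and `G` agree below each of their common points; equivalently, `F ∩ G` is an initial segment
of both. -/
def Coh (F G : Finset T) : Prop := ∀ x ∈ F, x ∈ G → ∀ y < x, (y ∈ F ↔ y ∈ G)

@[simp] lemma mem_below {F : Finset T} {x y : T} : y ∈ below F x ↔ y ∈ F ∧ y < x := by
  simp [below]

@[simp] lemma mem_sel {F : Finset T} {s : Finset ℕ} {x : T} :
    x ∈ sel F s ↔ x ∈ F ∧ pos F x ∈ s := by
  simp [sel]

lemma below_below {F : Finset T} {x y : T} (h : x ≤ y) : below (below F y) x = below F x := by
  ext z; simp only [mem_below]; constructor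
  · rintro ⟨⟨a, _⟩, c⟩; exact ⟨a, c⟩
  · rintro ⟨a, c⟩; exact ⟨⟨a, c.trans_le h⟩, c⟩

lemma pos_lt_card {F : Finset T} {x : T} (hx : x ∈ F) : pos F x < F.card := by
  refine card_lt_card ⟨filter_subset _ _, fun h => ?_⟩
  have := mem_below.1 (h hx)
  exact lt_irrefl _ this.2

lemma pos_mono (F : Finset T) {x y : T} (h : x ≤ y) : pos F x ≤ pos F y :=
  card_le_card fun z hz => by
    rw [mem_below] at hz ⊢; exact ⟨hz.1, hz.2.trans_le h⟩

lemma pos_lt_pos {F : Finset T} {x y : T} (hx : x ∈ F) (h : x < y) : pos F x < pos F y := by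
  refine card_lt_card ⟨fun z hz => ?_, fun h' => ?_⟩
  · rw [mem_below] at hz ⊢; exact ⟨hz.1, hz.2.trans h⟩
  · have := mem_below.1 (h' (mem_below.2 ⟨hx, h⟩)); exact lt_irrefl _ this.2

lemma lt_of_pos_lt {F : Finset T} {x y : T} (h : pos F x < pos F y) : x < y := by
  by_contra hc
  exact absurd (pos_mono F (not_lt.1 hc)) (not_le.2 h)

lemma pos_inj {F : Finset T} {x y : T} (hx : x ∈ F) (hy : y ∈ F) (h : pos F x = pos F y) :
    x = y := by
  rcases lt_trichotomy x y with h' | h' | h'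
  · exact absurd h (pos_lt_pos hx h').ne
  · exact h'
  · exact absurd h (pos_lt_pos hy h').ne'

lemma pos_below {F : Finset T} {x y : T} (h : x ≤ y) : pos (below F y) x = pos F x := by
  rw [pos, below_below h, pos]

lemma injOn_pos (F : Finset T) : Set.InjOn (pos F) F := fun _ hx _ hy h => pos_inj hx hy h

lemma image_pos (F : Finset T) : F.image (pos F) = range F.card := by
  refine eq_of_subset_of_card_le (fun i hi => ?_) ?_
  · obtain ⟨x, hx, rfl⟩ := mem_image.1 hi
    exact mem_range.2 (pos_lt_card hx)
  · rw [card_image_of_injOn (injOn_pos F), card_range]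

lemma exists_pos_eq {F : Finset T} {i : ℕ} (hi : i < F.card) : ∃ x ∈ F, pos F x = i := by
  have : i ∈ F.image (pos F) := by rw [image_pos]; exact mem_range.2 hi
  simpa using this

lemma image_pos_below (F : Finset T) (x : T) : (below F x).image (pos F) = range (pos F x) := by
  refine eq_of_subset_of_card_le (fun i hi => ?_) ?_
  · obtain ⟨y, hy, rfl⟩ := mem_image.1 hi
    rw [mem_below] at hy
    exact mem_range.2 (pos_lt_pos hy.1 hy.2)
  · rw [card_image_of_injOn, card_range, pos]
    exact (injOn_pos F).mono (fun y hy => (mem_below.1 hy).1)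

lemma card_filter_pos (F : Finset T) (P : ℕ → Prop) [DecidablePred P] :
    (F.filter fun x => P (pos F x)).card = ((range F.card).filter P).card := by
  rw [← image_pos, filter_image, card_image_of_injOn]
  exact (injOn_pos F).mono (filter_subset _ _)

lemma pos_filter_pos (F : Finset T) (P : ℕ → Prop) [DecidablePred P] (x : T) :
    pos (F.filter fun x => P (pos F x)) x = ((range (pos F x)).filter P).card := by
  rw [← image_pos_below, filter_image, card_image_of_injOn]
  · rw [pos]; congr 1; ext y; simp only [mem_below, mem_filter]; tauto
  · exact (injOn_pos F).mono (fun y hy => (mem_below.1 (mem_filter.1 hy).1).1)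

lemma sel_image_pos {F E : Finset T} (h : E ⊆ F) : sel F (E.image (pos F)) = E := by
  ext x; simp only [mem_sel, mem_image]; constructor
  · rintro ⟨hx, y, hy, he⟩
    rwa [← pos_inj (h hy) hx he]
  · intro hx; exact ⟨h hx, x, hx, rfl⟩

lemma Coh.symm {F G : Finset T} (h : Coh F G) : Coh G F := fun x hx hx' y hy =>
  (h x hx' hx y hy).symm

lemma Coh.refl (F : Finset T) : Coh F F := fun _ _ _ _ _ => Iff.rfl

lemma Coh.below_eq {F G : Finset T} (h : Coh F G) {x : T} (hx : x ∈ F) (hx' : x ∈ G) :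
    below F x = below G x := by
  ext y; simp only [mem_below]; constructor
  · rintro ⟨a, b⟩; exact ⟨(h x hx hx' y b).1 a, b⟩
  · rintro ⟨a, b⟩; exact ⟨(h x hx hx' y b).2 a, b⟩

lemma Coh.pos_eq {F G : Finset T} (h : Coh F G) {x : T} (hx : x ∈ F) (hx' : x ∈ G) :
    pos F x = pos G x := by
  rw [pos, pos, h.below_eq hx hx']

lemma Coh.subset_of_max {F G : Finset T} (h : Coh F G) {x : T} (hx : x ∈ F) (hx' : x ∈ G)
    (hm : ∀ y ∈ F, y ≤ x) : F ⊆ G := by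
  intro y hy
  rcases (hm y hy).lt_or_eq with h' | rfl
  · exact (h x hx hx' y h').1 hy
  · exact hx'

/-- The maximum of `F` decides inclusion among coherent sets. -/
lemma Coh.eq_of_max {F G : Finset T} (h : Coh F G) (hc : F.card = G.card) {x : T} (hx : x ∈ F)
    (hx' : x ∈ G) (hm : ∀ y ∈ F, y ≤ x) : F = G :=
  eq_of_subset_of_card_le (h.subset_of_max hx hx' hm) hc.ge

end Positions

/-! ### Canonical pieces -/

section Pieces

variable (m r : ℕ → ℕ)

/-- The positions, inside a set of rank `k + 1`, of its `i`-th canonical piece. -/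
def InPiece (k i p : ℕ) : Prop :=
  p < r (k + 1) ∨
    (r (k + 1) + i * (m k - r (k + 1)) ≤ p ∧ p < r (k + 1) + (i + 1) * (m k - r (k + 1)))

instance (k i : ℕ) : DecidablePred (InPiece m r k i) := fun _ => by
  unfold InPiece; infer_instance

/-- The increasing map from the positions in the `i`-th canonical piece to the positions in the
whole set. -/
def pieceEmb (k i q : ℕ) : ℕ := if q < r (k + 1) then q else q + i * (m k - r (k + 1))

variable {T : Type*} [LinearOrder T]

/-- The `i`-th canonical piece of a set `F` of rank `k + 1`. -/
def pc (k : ℕ) (F : Finset T) (i : ℕ) : Finset T := F.filter fun x => InPiece m r k i (pos F x)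

/-- The first `r k` elements of `F`: the root of a set of rank `k`. -/
def rt (k : ℕ) (F : Finset T) : Finset T := F.filter fun x => pos F x < r k

variable {m r}

lemma mem_pc {k i : ℕ} {F : Finset T} {x : T} :
    x ∈ pc m r k F i ↔ x ∈ F ∧ InPiece m r k i (pos F x) := by simp [pc]

lemma mem_rt {k : ℕ} {F : Finset T} {x : T} : x ∈ rt r k F ↔ x ∈ F ∧ pos F x < r k := by simp [rt]

lemma pc_subset {k i : ℕ} {F : Finset T} : pc m r k F i ⊆ F := filter_subset _ _

lemma rt_subset_pc {k i : ℕ} {F : Finset T} : rt r (k + 1) F ⊆ pc m r k F i := fun x hx => by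
  rw [mem_rt] at hx; exact mem_pc.2 ⟨hx.1, Or.inl hx.2⟩

lemma card_range_inPiece_low {k i p : ℕ} (hp : p ≤ r (k + 1)) :
    ((range p).filter (InPiece m r k i)).card = p := by
  rw [filter_true_of_mem, card_range]
  intro x hx; exact Or.inl ((mem_range.1 hx).trans_le hp)

lemma card_range_inPiece_mid {k i p : ℕ} (hp : r (k + 1) + i * (m k - r (k + 1)) ≤ p)
    (hp' : p ≤ r (k + 1) + (i + 1) * (m k - r (k + 1))) :
    ((range p).filter (InPiece m r k i)).card + i * (m k - r (k + 1)) = p := by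
  have : (range p).filter (InPiece m r k i) =
      range (r (k + 1)) ∪ Ico (r (k + 1) + i * (m k - r (k + 1))) p := by
    ext x
    simp only [mem_filter, mem_union, mem_range, mem_Ico, InPiece]
    generalize i * (m k - r (k + 1)) = a at *
    generalize (i + 1) * (m k - r (k + 1)) = b at *
    omega
  rw [this, card_union_of_disjoint, card_range, Nat.card_Ico]
  · omega
  · rw [disjoint_left]; intro x hx hx'
    rw [mem_range] at hx; rw [mem_Ico] at hx'; omega

lemma pos_eq_pieceEmb {k i : ℕ} {F : Finset T} {x : T} (hx : x ∈ pc m r k F i) :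
    pos F x = pieceEmb m r k i (pos (pc m r k F i) x) := by
  have h : pos (pc m r k F i) x = ((range (pos F x)).filter (InPiece m r k i)).card :=
    pos_filter_pos F _ x
  rw [mem_pc] at hx
  rcases lt_or_ge (pos F x) (r (k + 1)) with hp | hp
  · rw [card_range_inPiece_low hp.le] at h
    rw [h, pieceEmb, if_pos hp]
  · have h2 := hx.2.resolve_left (not_lt.2 hp)
    have h3 := card_range_inPiece_mid h2.1 h2.2.le
    rw [← h] at h3
    rw [pieceEmb, if_neg]
    · exact h3.symm
    · omega

lemma pos_pc_of_lt {k i : ℕ} {F : Finset T} {x : T} (hp : pos F x ≤ r (k + 1)) :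
    pos (pc m r k F i) x = pos F x :=
  (pos_filter_pos F _ x).trans (card_range_inPiece_low hp)

/-- Pieces depend, below a point, only on the set below that point. -/
lemma below_pc_congr {k i : ℕ} {F F' : Finset T} {a a' : T} (h : below F a = below F' a') :
    below (pc m r k F i) a = below (pc m r k F' i) a' := by
  have key : ∀ {F F' : Finset T} {a a' : T}, below F a = below F' a' →
      below (pc m r k F i) a ⊆ below (pc m r k F' i) a' := by
    intro F F' a a' h x hx
    rw [mem_below, mem_pc] at hx ⊢
    have hx' : x ∈ below F' a' := h ▸ mem_below.2 ⟨hx.1.1, hx.2⟩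
    rw [mem_below] at hx'
    refine ⟨⟨hx'.1, ?_⟩, hx'.2⟩
    have : pos F' x = pos F x := by
      rw [← pos_below hx'.2.le, ← h, pos_below hx.2.le]
    rw [this]; exact hx.1.2
  exact (key h).antisymm (key h.symm)

/-- Canonical pieces of coherent sets are coherent, even pieces with different indices: a common point
has the same position in both sets, and if the indices differ, this position is in the root. -/
lemma coh_pc {k i j : ℕ} {F G : Finset T} (h : Coh F G) :
    Coh (pc m r k F i) (pc m r k G j) := by
  intro x hx hx' y hy
  have hx1 := mem_pc.1 hx
  have hx1' := mem_pc.1 hx'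
  have hpx := h.pos_eq hx1.1 hx1'.1
  rw [mem_pc, mem_pc]
  have hyFG := h x hx1.1 hx1'.1 y hy
  by_cases hyF : y ∈ F
  · have hyG := hyFG.1 hyF
    have hpy := h.pos_eq hyF hyG
    have hlt := pos_lt_pos hyF hy
    simp only [hyF, hyG, true_and, ← hpy]
    have e1 := hx1.2
    have e2 := hx1'.2
    rw [← hpx] at e2
    unfold InPiece at e1 e2 ⊢
    rcases lt_trichotomy i j with hij | rfl | hij
    · have := Nat.mul_le_mul_right (m k - r (k + 1)) (Nat.succ_le_of_lt hij)
      rw [Nat.succ_eq_add_one] at this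
      omega
    · exact Iff.rfl
    · have := Nat.mul_le_mul_right (m k - r (k + 1)) (Nat.succ_le_of_lt hij)
      rw [Nat.succ_eq_add_one] at this
      omega
  · have hyG : y ∉ G := fun h' => hyF (hyFG.2 h')
    simp [hyF, hyG]

lemma inPiece_unique {k i j p : ℕ} (hp : r (k + 1) ≤ p) (hi : InPiece m r k i p)
    (hj : InPiece m r k j p) : i = j := by
  have h1 := hi.resolve_left (not_lt.2 hp)
  have h2 := hj.resolve_left (not_lt.2 hp)
  rcases lt_trichotomy i j with hij | h | hij
  · have := Nat.mul_le_mul_right (m k - r (k + 1)) (Nat.succ_le_of_lt hij)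
    rw [Nat.succ_eq_add_one] at this
    omega
  · exact h
  · have := Nat.mul_le_mul_right (m k - r (k + 1)) (Nat.succ_le_of_lt hij)
    rw [Nat.succ_eq_add_one] at this
    omega

variable {n : ℕ → ℕ}

section
variable (hT : IsSchemeType m n r)
include hT

lemma n_pos (k : ℕ) : 1 < n (k + 1) := lt_of_le_of_lt (by omega) (hT.lt_n (k + 1) (Nat.succ_pos k))

lemma m_lt_succ (k : ℕ) : m k < m (k + 1) := by
  have h1 := hT.m_succ k
  have h2 := hT.r_lt k
  have h3 := n_pos hT k
  have := Nat.mul_le_mul_right (m k - r (k + 1)) (show 2 ≤ n (k + 1) from h3)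
  omega

lemma m_strictMono : StrictMono m := strictMono_nat_of_lt_succ (m_lt_succ hT)

lemma m_pos (k : ℕ) : 0 < m k := (Nat.zero_le _).trans_lt (hT.r_lt k)

lemma card_pc {k i : ℕ} (hi : i < n (k + 1)) {F : Finset T} (hF : F.card = m (k + 1)) :
    (pc m r k F i).card = m k := by
  have h : (pc m r k F i).card = ((range F.card).filter (InPiece m r k i)).card :=
    card_filter_pos F _
  have hle : r (k + 1) + (i + 1) * (m k - r (k + 1)) ≤ m (k + 1) := by
    rw [hT.m_succ k]
    have := Nat.mul_le_mul_right (m k - r (k + 1)) (Nat.succ_le_of_lt hi)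
    rw [Nat.succ_eq_add_one] at this
    omega
  have h2 : (range F.card).filter (InPiece m r k i) =
      (range (r (k + 1) + (i + 1) * (m k - r (k + 1)))).filter (InPiece m r k i) := by
    rw [hF]
    ext x
    simp only [mem_filter, mem_range, InPiece]
    omega
  have h3 := card_range_inPiece_mid (m := m) (r := r) (k := k) (i := i)
    (p := r (k + 1) + (i + 1) * (m k - r (k + 1)))
    (by rw [add_one_mul]; omega) le_rfl
  have h4 := hT.r_lt k
  rw [h, h2]
  rw [add_one_mul] at h3 ⊢
  omega

lemma exists_inPiece {k p : ℕ} (hp : p < m (k + 1)) : ∃ i < n (k + 1), InPiece m r k i p := by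
  have h4 := hT.r_lt k
  have h3 := n_pos hT k
  rcases lt_or_ge p (r (k + 1)) with h | h
  · exact ⟨0, by omega, Or.inl h⟩
  · have hw : 0 < m k - r (k + 1) := by omega
    refine ⟨(p - r (k + 1)) / (m k - r (k + 1)), ?_, Or.inr ⟨?_, ?_⟩⟩
    · rw [Nat.div_lt_iff_lt_mul hw]
      have := hT.m_succ k
      omega
    · have := Nat.div_mul_le_self (p - r (k + 1)) (m k - r (k + 1))
      omega
    · have := Nat.lt_mul_div_succ (p - r (k + 1)) hw
      rw [mul_comm] at this
      omega

lemma exists_mem_pc {k : ℕ} {F : Finset T} (hF : F.card = m (k + 1)) {x : T} (hx : x ∈ F) :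
    ∃ i < n (k + 1), x ∈ pc m r k F i := by
  obtain ⟨i, hi, h⟩ := exists_inPiece hT (hF ▸ pos_lt_card hx)
  exact ⟨i, hi, mem_pc.2 ⟨hx, h⟩⟩

lemma card_rt {k : ℕ} {F : Finset T} (hF : F.card = m (k + 1)) : (rt r (k + 1) F).card = r (k + 1) := by
  have : (rt r (k + 1) F).card = ((range F.card).filter (· < r (k + 1))).card :=
    card_filter_pos F (· < r (k + 1))
  rw [this]
  have h2 : (range F.card).filter (· < r (k + 1)) = range (r (k + 1)) := by
    ext x; simp only [mem_filter, mem_range]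
    have := hT.r_lt k
    have := m_lt_succ hT k
    omega
  rw [h2, card_range]

end

lemma pc_inter {k i j : ℕ} (hij : i ≠ j) (F : Finset T) :
    pc m r k F i ∩ pc m r k F j = rt r (k + 1) F := by
  ext x
  rw [mem_inter]
  constructor
  · rintro ⟨h1, h2⟩
    rw [mem_pc] at h1 h2
    refine mem_rt.2 ⟨h1.1, ?_⟩
    by_contra h
    exact hij (inPiece_unique (not_lt.1 h) h1.2 h2.2)
  · intro h; exact ⟨rt_subset_pc h, rt_subset_pc h⟩

lemma le_pos_of_mem_pc_sdiff {k i : ℕ} {F : Finset T} {x : T} (hx : x ∈ pc m r k F i)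
    (h : x ∉ rt r (k + 1) F) : r (k + 1) ≤ pos F x := by
  by_contra hc
  exact h (mem_rt.2 ⟨pc_subset hx, not_le.1 hc⟩)

lemma pc_lt_pc {k i j : ℕ} (hij : i < j) {F : Finset T} {x y : T} (hx : x ∈ pc m r k F i)
    (hy : y ∈ pc m r k F j) (hy' : r (k + 1) ≤ pos F y) : x < y := by
  rw [mem_pc] at hx hy
  refine lt_of_pos_lt (F := F) ?_
  have h2 := hy.2.resolve_left (not_lt.2 hy')
  have := Nat.mul_le_mul_right (m k - r (k + 1)) (Nat.succ_le_of_lt hij)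
  rw [Nat.succ_eq_add_one] at this
  have h1 := hx.2
  unfold InPiece at h1
  omega

end Pieces

end

section

/-! ### Countable ordinals -/

lemma mk_Omega1 : Cardinal.mk Omega1 = Cardinal.aleph 1 := by simp

instance : Uncountable Omega1 := by
  rw [← Cardinal.aleph0_lt_mk_iff, mk_Omega1]; exact Cardinal.aleph0_lt_aleph_one

lemma countable_Iio_omega1 (b : Omega1) : (Set.Iio b).Countable := by
  rw [← Cardinal.le_aleph0_iff_set_countable, ← Cardinal.lt_aleph_one_iff, ← mk_Omega1]
  exact Cardinal.mk_Iio_lt b (by rw [mk_Omega1, Ordinal.type_toType, Cardinal.ord_aleph])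

lemma countable_Iic_omega1 (b : Omega1) : (Set.Iic b).Countable := by
  rw [← Set.Iio_insert]; exact (countable_Iio_omega1 b).insert b

instance (b : Omega1) : Countable (Set.Iic b) := (countable_Iic_omega1 b).to_subtype

/-- Countable sets of countable ordinals are bounded. -/
lemma exists_forall_lt_omega1 {s : Set Omega1} (hs : s.Countable) : ∃ b, ∀ a ∈ s, a < b := by
  by_contra! h
  refine not_countable (α := Omega1) (Set.countable_univ_iff.1 ?_)
  refine (hs.biUnion fun a _ => countable_Iic_omega1 a).mono fun b _ => ?_
  obtain ⟨a, ha, hb⟩ := h b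
  exact Set.mem_biUnion ha hb

/-! ### Partial schemes on blocks, and end-extension by one block -/

/-- The index set of the construction: `ω₁` consecutive blocks of order type `ω`. It is isomorphic
to `ω₁`, see `blocksIso`. -/
abbrev Blocks : Type := Omega1 ×ₗ ℕ

/-- The block of an element. -/
def blk (x : Blocks) : Omega1 := (ofLex x).1

/-- The place of an element inside its block. -/
def idx (x : Blocks) : ℕ := (ofLex x).2

/-- The `t`-th element of the block `b`. -/
def elt (b : Omega1) (t : ℕ) : Blocks := toLex (b, t)

@[simp] lemma blk_elt (b : Omega1) (t : ℕ) : blk (elt b t) = b := rfl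

@[simp] lemma idx_elt (b : Omega1) (t : ℕ) : idx (elt b t) = t := rfl

@[simp] lemma elt_blk_idx (x : Blocks) : elt (blk x) (idx x) = x := rfl

lemma eq_elt {x : Blocks} {b : Omega1} (h : blk x = b) : x = elt b (idx x) := by subst h; rfl

lemma blocks_lt_iff {x y : Blocks} : x < y ↔ blk x < blk y ∨ blk x = blk y ∧ idx x < idx y :=
  Prod.Lex.lt_iff

lemma blk_mono {x y : Blocks} (h : x ≤ y) : blk x ≤ blk y := by
  rcases h.lt_or_eq with h | rfl
  · rcases blocks_lt_iff.1 h with h | h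
    · exact h.le
    · exact h.1.le
  · exact le_rfl

lemma lt_elt_zero {x : Blocks} {b : Omega1} : x < elt b 0 ↔ blk x < b := by
  simp [blocks_lt_iff]

lemma lt_of_blk_lt {x y : Blocks} (h : blk x < blk y) : x < y := blocks_lt_iff.2 (Or.inl h)

lemma elt_lt_elt {b : Omega1} {s t : ℕ} : elt b s < elt b t ↔ s < t := by simp [blocks_lt_iff]

lemma elt_injective (b : Omega1) : Function.Injective (elt b) := fun s t h => by
  simpa using congrArg idx h

/-- The elements of the blocks before `b`. -/
def blocksLT (b : Omega1) : Set Blocks := {x | blk x < b}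

/-- The elements of the blocks up to `b`. -/
def blocksLE (b : Omega1) : Set Blocks := {x | blk x ≤ b}

variable {m n r : ℕ → ℕ}

section PieceOf

variable {T : Type*} [LinearOrder T]

variable (m n r) in
/-- `PieceOf G j k F`: the set `F` of rank `k` is an iterated canonical piece of the set `G` of
rank `j`. -/
inductive PieceOf (G : Finset T) (j : ℕ) : ℕ → Finset T → Prop
  | refl : PieceOf G j j G
  | step (k : ℕ) (F : Finset T) (i : ℕ) : PieceOf G j (k + 1) F → i < n (k + 1) →
      PieceOf G j k (pc m r k F i)

lemma PieceOf.le {G F : Finset T} {j k : ℕ} (h : PieceOf m n r G j k F) : k ≤ j := by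
  induction h with
  | refl => exact le_rfl
  | step k F i _ _ ih => omega

lemma PieceOf.eq {G F : Finset T} {j k : ℕ} (h : PieceOf m n r G j k F) (hk : k = j) :
    F = G := by
  cases h with
  | refl => rfl
  | step _ F i h' _ => have := h'.le; omega

lemma PieceOf.subset {G F : Finset T} {j k : ℕ} (h : PieceOf m n r G j k F) : F ⊆ G := by
  induction h with
  | refl => exact Subset.rfl
  | step k F i _ _ ih => exact pc_subset.trans ih

lemma PieceOf.trans {G F H : Finset T} {j k l : ℕ} (h : PieceOf m n r G j k F)
    (h' : PieceOf m n r F k l H) : PieceOf m n r G j l H := by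
  induction h' with
  | refl => exact h
  | step l F i _ hi ih => exact .step _ _ _ ih hi

lemma PieceOf.coh {G F E : Finset T} {j k : ℕ} (h : PieceOf m n r G j k F)
    (h' : PieceOf m n r G j k E) : Coh F E := by
  induction h generalizing E with
  | refl => rw [h'.eq rfl]; exact Coh.refl _
  | step k F i hF hi ih =>
    cases h' with
    | refl => exact absurd hF.le (by omega)
    | step _ E i' hE hi' => exact coh_pc (ih hE)

lemma exists_pieceOf_below_eq {G F G' : Finset T} {j k : ℕ} (h : PieceOf m n r G j k F) {a a' : T}
    (ha : below G a = below G' a') :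
    ∃ F', PieceOf m n r G' j k F' ∧ below F a = below F' a' := by
  induction h with
  | refl => exact ⟨G', .refl, ha⟩
  | step k F i _ hi ih =>
    obtain ⟨F', h1, h2⟩ := ih
    exact ⟨_, .step _ _ _ h1 hi, below_pc_congr h2⟩

lemma PieceOf.mem {L : ℕ → Set (Finset T)}
    (hL : ∀ k, ∀ F ∈ L (k + 1), ∀ i < n (k + 1), pc m r k F i ∈ L k) {G F : Finset T}
    {j k : ℕ} (hG : G ∈ L j) (h : PieceOf m n r G j k F) : F ∈ L k := by
  induction h with
  | refl => exact hG
  | step k F i _ hi ih => exact hL _ _ ih _ hi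

lemma exists_pieceOf (hT : IsSchemeType m n r) {G : Finset T} {j k : ℕ} (hG : G.card = m j)
    (hk : k ≤ j) {x : T} (hx : x ∈ G) :
    ∃ F, PieceOf m n r G j k F ∧ x ∈ F ∧ F.card = m k := by
  induction hk using Nat.decreasingInduction with
  | self => exact ⟨G, .refl, hx, hG⟩
  | of_succ k hk ih =>
    obtain ⟨F, h1, h2, h3⟩ := ih
    obtain ⟨i, hi, h⟩ := exists_mem_pc hT h3 h2
    exact ⟨_, .step _ _ _ h1 hi, h, card_pc hT hi h3⟩

end PieceOf

variable (m n r) in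
/-- A construction scheme on an initial part `U` of the blocks, given by its levels; the canonical
decomposition of a set is given by positions. The field `rich` strengthens cofinality: any finite set
lies in the initial piece of a set of the scheme whose root ends exactly below a prescribed point.
The field `interval` says that a point `α` belongs to sets of the scheme of all large ranks which,
from `α` on, consist of consecutive points of a single block. -/
structure IsPartialScheme (U : Set Blocks) (L : ℕ → Set (Finset Blocks)) : Prop where
  sub : ∀ k, ∀ F ∈ L k, ∀ x ∈ F, x ∈ U
  card : ∀ k, ∀ F ∈ L k, F.card = m k
  single : ∀ x ∈ U, {x} ∈ L 0
  coh : ∀ k, ∀ F ∈ L k, ∀ G ∈ L k, Coh F G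
  pc_mem : ∀ k, ∀ F ∈ L (k + 1), ∀ i < n (k + 1), pc m r k F i ∈ L k
  rich : ∀ A : Finset Blocks, (∀ x ∈ A, x ∈ U) → ∀ α ∈ U, ∀ k₀, ∃ k ≥ k₀, ∃ X ∈ L (k + 1),
    A ⊆ pc m r k X 0 ∧ α ∈ pc m r k X 0 ∧ pos X α = r (k + 1)
  interval : ∀ α ∈ U, ∃ k₀, ∀ k ≥ k₀, ∃ G ∈ L k, α ∈ G ∧ (∀ x ∈ G, α ≤ x → blk x = blk α) ∧
    ∀ x ∈ G, ∀ y, α ≤ y → y ≤ x → y ∈ G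

lemma IsPartialScheme.exists_mem (hT : IsSchemeType m n r) {U : Set Blocks}
    {L : ℕ → Set (Finset Blocks)} (hL : IsPartialScheme m n r U L) {α : Blocks} (hα : α ∈ U)
    (k : ℕ) : ∃ X ∈ L k, α ∈ X := by
  obtain ⟨k', hk', X, hX, -, h, -⟩ := hL.rich ∅ (by simp) α hα k
  obtain ⟨F, h1, h2, -⟩ := exists_pieceOf hT (hL.card _ _ hX) (by omega : k ≤ k' + 1)
    (pc_subset h)
  exact ⟨F, h1.mem hL.pc_mem hX, h2⟩

/-! #### The sets of a new block -/

variable (m) in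
/-- The set of rank `k` consisting of `d`, which lies before the block `b`, and of the first elements
of the block `b`. -/
def endExt (b : Omega1) (d : Finset Blocks) (k : ℕ) : Finset Blocks :=
  d ∪ (range (m k - d.card)).image (elt b)

section endExt

variable {b : Omega1} {d : Finset Blocks} {k : ℕ}

lemma mem_endExt {x : Blocks} :
    x ∈ endExt m b d k ↔ x ∈ d ∨ blk x = b ∧ idx x < m k - d.card := by
  simp only [endExt, mem_union, mem_image, mem_range]
  refine or_congr Iff.rfl ⟨?_, fun ⟨h1, h2⟩ => ⟨idx x, h2, (eq_elt h1).symm⟩⟩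
  rintro ⟨t, ht, rfl⟩; exact ⟨rfl, ht⟩

lemma below_endExt_of_le {x : Blocks} (hx0 : x ≤ elt b 0) :
    below (endExt m b d k) x = below d x := by
  ext y
  simp only [mem_below, mem_endExt]
  constructor
  · rintro ⟨h | h, h'⟩
    · exact ⟨h, h'⟩
    · have := lt_elt_zero.1 (h'.trans_le hx0)
      exact absurd h.1 this.ne
  · rintro ⟨h, h'⟩; exact ⟨Or.inl h, h'⟩

lemma pos_endExt_of_blk_lt {x : Blocks} (hx : blk x < b) : pos (endExt m b d k) x = pos d x := by
  rw [pos, below_endExt_of_le (lt_elt_zero.2 hx).le, pos]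

variable (hd : ∀ x ∈ d, blk x < b)
include hd

lemma card_endExt (hk : d.card ≤ m k) : (endExt m b d k).card = m k := by
  rw [endExt, card_union_of_disjoint, card_image_of_injective _ (elt_injective b), card_range]
  · omega
  · rw [disjoint_left]; intro x hx hx'
    obtain ⟨t, _, rfl⟩ := mem_image.1 hx'
    exact lt_irrefl _ (hd _ hx)

lemma below_endExt_zero : below (endExt m b d k) (elt b 0) = d := by
  rw [below_endExt_of_le le_rfl]
  ext y; simp only [mem_below, lt_elt_zero]
  exact ⟨fun h => h.1, fun h => ⟨h, hd _ h⟩⟩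

lemma pos_endExt_elt {t : ℕ} (ht : t ≤ m k - d.card) :
    pos (endExt m b d k) (elt b t) = d.card + t := by
  have : below (endExt m b d k) (elt b t) = d ∪ (range t).image (elt b) := by
    ext y
    simp only [mem_below, mem_endExt, mem_union, mem_image, mem_range]
    constructor
    · rintro ⟨h | h, h'⟩
      · exact Or.inl h
      · right
        rw [eq_elt h.1, elt_lt_elt] at h'
        exact ⟨_, h', (eq_elt h.1).symm⟩
    · rintro (h | ⟨s, hs, rfl⟩)
      · exact ⟨Or.inl h, lt_of_blk_lt (hd _ h)⟩
      · exact ⟨Or.inr ⟨rfl, by simp only [idx_elt]; omega⟩, elt_lt_elt.2 hs⟩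
  rw [pos, this, card_union_of_disjoint, card_image_of_injective _ (elt_injective b), card_range]
  rw [disjoint_left]; intro x hx hx'
  obtain ⟨s, _, rfl⟩ := mem_image.1 hx'
  exact lt_irrefl _ (hd _ hx)

end endExt

/-- If `b` imitates the point `α` at the ranks `k` and `k + 1`, then the new set of rank `k` is a
canonical piece of the new set of rank `k + 1`. -/
lemma endExt_eq_pc (hT : IsSchemeType m n r) {b : Omega1} {k i : ℕ} {Y : Finset Blocks}
    (hi : i < n (k + 1)) (hY : Y.card = m (k + 1)) {α : Blocks} (hα : α ∈ pc m r k Y i)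
    (hb : ∀ x ∈ Y, x < α → blk x < b) (h0 : pos Y α < r (k + 1) → i = 0) :
    endExt m b (below (pc m r k Y i) α) k = pc m r k (endExt m b (below Y α) (k + 1)) i := by
  have hd : ∀ x ∈ below Y α, blk x < b := fun x hx => by
    rw [mem_below] at hx; exact hb x hx.1 hx.2
  have hd' : ∀ x ∈ below (pc m r k Y i) α, blk x < b := fun x hx => by
    rw [mem_below] at hx; exact hb x (pc_subset hx.1) hx.2
  ext x
  rw [mem_pc, mem_endExt, mem_endExt]
  rcases lt_trichotomy (blk x) b with hx | hx | hx
  · have h1 : ¬ blk x = b := hx.ne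
    rw [pos_endExt_of_blk_lt hx]
    simp only [h1, false_and, or_false, mem_below, mem_pc]
    constructor
    · rintro ⟨⟨h2, h3⟩, h4⟩
      rw [pos_below h4.le]; exact ⟨⟨h2, h4⟩, h3⟩
    · rintro ⟨⟨h2, h4⟩, h3⟩
      rw [pos_below h4.le] at h3; exact ⟨⟨h2, h3⟩, h4⟩
  · have h1 : x ∉ below Y α := fun h => (hd x h).ne hx
    have h1' : x ∉ below (pc m r k Y i) α := fun h => (hd' x h).ne hx
    simp only [h1, h1', hx, true_and, false_or]
    have e1 := pos_eq_pieceEmb hα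
    have e2 := pos_lt_card hα
    have e3 := pos_lt_card (pc_subset hα)
    rw [card_pc hT hi hY] at e2
    rw [hY] at e3
    have e4 := (mem_pc.1 hα).2
    change idx x < m k - pos (pc m r k Y i) α ↔ idx x < m (k + 1) - pos Y α ∧ _
    by_cases ht : idx x < m (k + 1) - pos Y α
    · have : pos (endExt m b (below Y α) (k + 1)) x = pos Y α + idx x := by
        conv_lhs => rw [eq_elt hx]
        exact pos_endExt_elt hd ht.le
      rw [this]
      simp only [ht, true_and]
      have hr := hT.r_lt k
      unfold pieceEmb at e1
      unfold InPiece at e4 ⊢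
      rw [add_one_mul] at e4 ⊢
      by_cases hp : pos Y α < r (k + 1)
      · have := h0 hp; subst this
        simp only [zero_mul] at *
        split_ifs at e1 <;> omega
      · generalize i * (m k - r (k + 1)) = a at *
        split_ifs at e1 <;> omega
    · have hr := hT.r_lt k
      have hm := hT.m_succ k
      have hle := Nat.mul_le_mul_right (m k - r (k + 1)) (Nat.succ_le_of_lt hi)
      rw [Nat.succ_eq_add_one, add_one_mul] at hle
      unfold pieceEmb at e1
      unfold InPiece at e4
      rw [add_one_mul] at e4
      simp only [ht, false_and, iff_false]
      by_cases hp : pos Y α < r (k + 1)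
      · have := h0 hp; subst this
        simp only [zero_mul] at *
        split_ifs at e1 <;> omega
      · generalize i * (m k - r (k + 1)) = a at *
        split_ifs at e1 <;> omega
  · have h1 : x ∉ below Y α := fun h => (hd x h).not_gt hx
    have h1' : x ∉ below (pc m r k Y i) α := fun h => (hd' x h).not_gt hx
    simp [h1, h1', hx.ne']

/-! #### Adjoining a chain of sets -/

variable (m n r) in
/-- The levels `L` together with all iterated pieces of the sets `c j`. -/
def adjoin (L : ℕ → Set (Finset Blocks)) (c : ℕ → Finset Blocks) (k : ℕ) : Set (Finset Blocks) :=
  {F | F ∈ L k ∨ ∃ j, PieceOf m n r (c j) j k F}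

variable (m n r) in
/-- A chain of sets `c k` of rank `k`, each a canonical piece of the next one, by which a scheme on
the blocks before `b` can be extended to the block `b`. -/
structure IsNewChain (b : Omega1) (L : ℕ → Set (Finset Blocks)) (c : ℕ → Finset Blocks) : Prop where
  blk_le : ∀ k, ∀ x ∈ c k, blk x ≤ b
  card : ∀ k, (c k).card = m k
  eq_pc : ∀ k, ∃ i < n (k + 1), c k = pc m r k (c (k + 1)) i
  trace : ∀ k, (∃ X ∈ L k, ∃ α, below (c k) (elt b 0) = below X α) ∨ below (c k) (elt b 0) = ∅
  rich : ∀ β, blk β ≤ b → ∀ k₀, ∃ k ≥ k₀, β ∈ c k ∧ c k = pc m r k (c (k + 1)) 0 ∧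
    pos (c (k + 1)) β = r (k + 1)
  interval : ∀ k t, elt b t ∈ c k → ∀ s < t, elt b s ∈ c k

namespace IsNewChain

variable {b : Omega1} {L : ℕ → Set (Finset Blocks)} {c : ℕ → Finset Blocks}
  (hc : IsNewChain m n r b L c)
include hc

lemma pieceOf {j j' : ℕ} (h : j ≤ j') : PieceOf m n r (c j') j' j (c j) := by
  induction j', h using Nat.le_induction with
  | base => exact .refl
  | succ j' _ ih =>
    obtain ⟨i, hi, h⟩ := hc.eq_pc j'
    refine PieceOf.trans ?_ ih
    have := PieceOf.step j' (c (j' + 1)) i (m := m) (r := r) .refl hi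
    rwa [← h] at this

lemma mono {j j' : ℕ} (h : j ≤ j') : c j ⊆ c j' := (hc.pieceOf h).subset

lemma exists_subset (A : Finset Blocks) (hA : ∀ x ∈ A, blk x ≤ b) : ∃ k, A ⊆ c k := by
  induction A using Finset.induction_on with
  | empty => exact ⟨0, by simp⟩
  | insert a A _ ih =>
    obtain ⟨k, hk⟩ := ih fun x hx => hA x (mem_insert_of_mem hx)
    obtain ⟨k', -, h, -⟩ := hc.rich a (hA a (mem_insert_self _ _)) 0
    refine ⟨max k k', insert_subset (hc.mono (le_max_right _ _) h)
      (hk.trans (hc.mono (le_max_left _ _)))⟩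

lemma card_pieceOf (hT : IsSchemeType m n r) {j k : ℕ} {F : Finset Blocks}
    (h : PieceOf m n r (c j) j k F) : F.card = m k := by
  induction h with
  | refl => exact hc.card j
  | step k F i _ hi ih => exact card_pc hT hi ih

lemma trace_pieceOf (hL : IsPartialScheme m n r (blocksLT b) L) {j k : ℕ} {F : Finset Blocks}
    (h : PieceOf m n r (c j) j k F) :
    (∃ X ∈ L k, ∃ α, below F (elt b 0) = below X α) ∨ below F (elt b 0) = ∅ := by
  rcases hc.trace j with ⟨X, hX, α, h'⟩ | h'
  · obtain ⟨F', h1, h2⟩ := exists_pieceOf_below_eq h h'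
    exact Or.inl ⟨F', h1.mem hL.pc_mem hX, α, h2⟩
  · right
    rw [eq_empty_iff_forall_notMem] at h' ⊢
    intro x hx
    rw [mem_below] at hx
    exact h' x (mem_below.2 ⟨h.subset hx.1, hx.2⟩)

lemma mem_of_blk_lt (hT : IsSchemeType m n r) (hL : IsPartialScheme m n r (blocksLT b) L) {k : ℕ}
    {F : Finset Blocks} (hF : F ∈ adjoin m n r L c k) (h : ∀ x ∈ F, blk x < b) : F ∈ L k := by
  rcases hF with hF | ⟨j, hF⟩
  · exact hF
  · have hbF : below F (elt b 0) = F := by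
      ext x; simp only [mem_below, lt_elt_zero]; exact ⟨fun h => h.1, fun hx => ⟨hx, h x hx⟩⟩
    have hcard := hc.card_pieceOf hT hF
    rcases hc.trace_pieceOf hL hF with ⟨X, hX, α, h'⟩ | h'
    · rw [hbF] at h'
      have : F = X := eq_of_subset_of_card_le (h' ▸ filter_subset _ _)
        (by rw [hcard, hL.card k X hX])
      exact this ▸ hX
    · rw [hbF] at h'
      rw [h', card_empty] at hcard
      exact absurd hcard (m_pos hT k).ne

lemma coh_pieceOf (hL : IsPartialScheme m n r (blocksLT b) L) {j k : ℕ} {F E : Finset Blocks}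
    (hF : PieceOf m n r (c j) j k F) (hE : E ∈ L k) : Coh F E := by
  intro x hx hx' y hy
  have hxb : x < elt b 0 := lt_elt_zero.2 (hL.sub k E hE x hx')
  have hyF : y ∈ F ↔ y ∈ below F (elt b 0) := by
    rw [mem_below]; exact ⟨fun h => ⟨h, hy.trans hxb⟩, fun h => h.1⟩
  have hxF : x ∈ below F (elt b 0) := mem_below.2 ⟨hx, hxb⟩
  rcases hc.trace_pieceOf hL hF with ⟨X, hX, α, h'⟩ | h'
  · rw [h', mem_below] at hxF
    rw [hyF, h', mem_below, ← hL.coh k X hX E hE x hxF.1 hx' y hy]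
    exact ⟨fun h => h.1, fun h => ⟨h, hy.trans hxF.2⟩⟩
  · rw [h'] at hxF; exact absurd hxF (by simp)

/-- Adjoining a new chain extends a scheme by one block. -/
theorem isPartialScheme (hT : IsSchemeType m n r) (hL : IsPartialScheme m n r (blocksLT b) L) :
    IsPartialScheme m n r (blocksLE b) (adjoin m n r L c) where
  sub := by
    rintro k F (hF | ⟨j, hF⟩) x hx
    · exact le_of_lt (show blk x < b from hL.sub k F hF x hx)
    · exact hc.blk_le j x (hF.subset hx)
  card := by
    rintro k F (hF | ⟨j, hF⟩)
    · exact hL.card k F hF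
    · exact hc.card_pieceOf hT hF
  single := by
    intro x hx
    obtain ⟨k, -, h, -⟩ := hc.rich x hx 0
    obtain ⟨F, h1, h2, h3⟩ := exists_pieceOf hT (hc.card k) (Nat.zero_le k) h
    rw [hT.m_zero, card_eq_one] at h3
    obtain ⟨y, rfl⟩ := h3
    rw [mem_singleton] at h2; subst h2
    exact Or.inr ⟨k, h1⟩
  coh := by
    rintro k F (hF | ⟨j, hF⟩) G (hG | ⟨j', hG⟩)
    · exact hL.coh k F hF G hG
    · exact (hc.coh_pieceOf hL hG hF).symm
    · exact hc.coh_pieceOf hL hF hG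
    · exact ((hc.pieceOf (le_max_left j j')).trans hF).coh
        ((hc.pieceOf (le_max_right j j')).trans hG)
  pc_mem := by
    rintro k F (hF | ⟨j, hF⟩) i hi
    · exact Or.inl (hL.pc_mem k F hF i hi)
    · exact Or.inr ⟨j, .step _ _ _ hF hi⟩
  rich := by
    intro A hA α hα k₀
    obtain ⟨k₁, h1⟩ := hc.exists_subset A hA
    obtain ⟨k, hk, h2, h3, h4⟩ := hc.rich α hα (max k₀ k₁)
    refine ⟨k, (le_max_left _ _).trans hk, c (k + 1), Or.inr ⟨k + 1, .refl⟩, ?_, ?_, h4⟩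
    · rw [← h3]; exact h1.trans (hc.mono ((le_max_right _ _).trans hk))
    · rw [← h3]; exact h2
  interval := by
    intro α hα
    rcases (show blk α ≤ b from hα).lt_or_eq with h | h
    · obtain ⟨k₀, h0⟩ := hL.interval α h
      refine ⟨k₀, fun k hk => ?_⟩
      obtain ⟨G, hG, h1⟩ := h0 k hk
      exact ⟨G, Or.inl hG, h1⟩
    · obtain ⟨k₀, -, h0, -⟩ := hc.rich α hα 0
      have hx : ∀ k, ∀ x ∈ c k, α ≤ x → blk x = b := fun k x hx hαx =>
        le_antisymm (hc.blk_le k x hx) (h ▸ blk_mono hαx)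
      refine ⟨k₀, fun k hk => ⟨c k, Or.inr ⟨k, .refl⟩, hc.mono hk h0, ?_, ?_⟩⟩
      · rw [h]; exact hx k
      · intro x hxc y hαy hyx
        have hxb := hx k x hxc (hαy.trans hyx)
        have hyb : blk y = b := le_antisymm (hxb ▸ blk_mono hyx) (h ▸ blk_mono hαy)
        rcases hyx.lt_or_eq with h' | rfl
        · rw [eq_elt hyb]
          rw [eq_elt hyb, eq_elt hxb, elt_lt_elt] at h'
          exact hc.interval k _ (eq_elt hxb ▸ hxc) _ h'
        · exact hxc

end IsNewChain

end

section

/-! ### Extending a scheme by one block with prescribed promises -/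

/-- A sequence that satisfies each of countably many requirements infinitely often, when every
requirement can be met, arbitrarily late, after a change that is not visible in `tr`. -/
lemma exists_seq_of_tasks {A β ι : Type*} [Nonempty A] [Countable ι] (tr : ℕ → A → β)
    (Q : ι → ℕ → A → Prop) (hQ : ∀ t k₀ x, ∃ k ≥ k₀, ∃ x', tr k x' = tr k x ∧ Q t k x') :
    ∃ f : ℕ → A, (∀ k, tr (k + 1) (f (k + 1)) = tr (k + 1) (f k)) ∧
      ∀ t k₀, ∃ k ≥ k₀, Q t k (f k) := by
  classical
  rcases isEmpty_or_nonempty ι with hι | hι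
  · exact ⟨fun _ => Classical.arbitrary A, fun _ => rfl, fun t => hι.elim t⟩
  obtain ⟨e, he⟩ := exists_surjective_nat (ι × ℕ)
  have hstep : ∀ (i : ℕ) (s : ℕ × A), ∃ s' : ℕ × A, s.1 < s'.1 ∧ tr s'.1 s'.2 = tr s'.1 s.2 ∧
      Q (e i).1 s'.1 s'.2 ∧ (e i).2 ≤ s'.1 := by
    intro i s
    obtain ⟨k, hk, x', h1, h2⟩ := hQ (e i).1 (max (s.1 + 1) (e i).2) s.2
    exact ⟨(k, x'), by simp only; omega, h1, h2, by simp only; omega⟩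
  choose next h1 h2 h3 h4 using hstep
  let s : ℕ → ℕ × A := fun i => Nat.rec (0, Classical.arbitrary A) next i
  have hs : ∀ i, s (i + 1) = next i (s i) := fun i => rfl
  have hmono : StrictMono fun i => (s i).1 := strictMono_nat_of_lt_succ fun i => by
    rw [hs]; exact h1 i (s i)
  -- the index of the last change up to time `j`
  let g : ℕ → ℕ := fun j => Nat.findGreatest (fun i => (s i).1 ≤ j) j
  have hg : ∀ j, (s (g j)).1 ≤ j := fun j =>
    Nat.findGreatest_spec (P := fun i => (s i).1 ≤ j) (Nat.zero_le j) (Nat.zero_le j)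
  have hg' : ∀ j i, (s i).1 ≤ j → i ≤ g j := fun j i h =>
    Nat.le_findGreatest ((hmono.le_apply (x := i)).trans h) h
  have hgs : ∀ i, g (s i).1 = i := fun i =>
    le_antisymm (hmono.le_iff_le.1 (hg (s i).1)) (hg' _ _ le_rfl)
  refine ⟨fun j => (s (g j)).2, fun j => ?_, fun t k₀ => ?_⟩
  · have hle : g j ≤ g (j + 1) := hg' _ _ ((hg j).trans (Nat.le_succ j))
    rcases hle.eq_or_lt with h | h
    · simp only [h]
    · have hlt : ∀ i, g j < i → j < (s i).1 := fun i hi => by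
        by_contra hc; exact absurd (hg' j i (not_lt.1 hc)) (by omega)
      have ha := hlt (g j + 1) (Nat.lt_succ_self (g j))
      have hb := hg (j + 1)
      have hc : g (j + 1) = g j + 1 := by
        by_contra hne
        have hd : (s (g j + 1)).1 < (s (g (j + 1))).1 := hmono (show g j + 1 < g (j + 1) by omega)
        omega
      rw [hc] at hb
      have hd : (s (g j + 1)).1 = j + 1 := by omega
      have := h2 (g j) (s (g j))
      rw [← hs, hd] at this
      simpa only [hc] using this
  · obtain ⟨i, hi⟩ := he (t, k₀)
    refine ⟨(s (i + 1)).1, ?_, ?_⟩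
    · have := h4 i (s i); rw [hi] at this; exact this
    · have := h3 i (s i); rw [hi] at this; simp only [hgs]; exact this

variable {m n r : ℕ → ℕ}

variable (m n r) in
/-- The set `F` of rank `k` is a canonical piece of the set `G` of rank `k + 1`, the root of `G` is
the part of `F` before the block `μ`, and the number of the pieces of `G` before `F` is as large as
possible subject to the condition that the positions in `ε` select a member of `D` in each of these
pieces; `L` is the scheme from which the pieces are taken. -/
def Treated (D : Set (Finset Blocks)) (μ : Omega1) (L : ℕ → Set (Finset Blocks)) (k : ℕ)
    (F G : Finset Blocks) (ε : Finset ℕ) : Prop :=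
  elt μ 0 ∈ F ∧ pos F (elt μ 0) = r (k + 1) ∧ ∃ M < n (k + 1), pc m r k G M = F ∧
    (∀ v < M, sel (pc m r k G v) ε ∈ D) ∧
    (M + 1 < n (k + 1) → ∀ H ∈ L (k + 1), (∀ x ∈ H, blk x < μ) →
      rt r (k + 1) H = below F (elt μ 0) → ∃ v ≤ M, sel (pc m r k H v) ε ∉ D)

variable (m n r) in
/-- Arbitrarily large sets of the scheme are treated for `D` and `μ`. -/
def Promise (D : Set (Finset Blocks)) (μ : Omega1) (U : Set Blocks) (L : ℕ → Set (Finset Blocks)) :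
    Prop :=
  ∀ A : Finset Blocks, (∀ x ∈ A, x ∈ U) → ∀ E ⊆ A, ∀ k₀, ∃ k ≥ k₀, ∃ F ∈ L k, ∃ G ∈ L (k + 1),
    A ⊆ F ∧ Treated m n r D μ L k F G (E.image (pos F))

variable (m n r) in
/-- `L'` is an end-extension of the scheme `L` on the blocks before `b` to the block `b` which keeps
the promises for `𝒟 μ`, `μ ≤ b`. -/
structure IsStageExt (𝒟 : Omega1 → Set (Finset Blocks)) (b : Omega1)
    (L L' : ℕ → Set (Finset Blocks)) : Prop where
  le : ∀ k, L k ⊆ L' k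
  scheme : IsPartialScheme m n r (blocksLE b) L'
  mem_of_blk_lt : ∀ k, ∀ F ∈ L' k, (∀ x ∈ F, blk x < b) → F ∈ L k
  promise : ∀ μ ≤ b, ¬ IsMin μ → Promise m n r (𝒟 μ) μ (blocksLE b) L'

lemma Treated.congr {D : Set (Finset Blocks)} {μ : Omega1} {L L' : ℕ → Set (Finset Blocks)} {k : ℕ}
    {F G : Finset Blocks} {ε : Finset ℕ} (h : Treated m n r D μ L k F G ε)
    (hL : ∀ k, ∀ H ∈ L' k, (∀ x ∈ H, blk x < μ) → H ∈ L k) : Treated m n r D μ L' k F G ε := by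
  obtain ⟨h1, h2, M, h3, h4, h5, h6⟩ := h
  exact ⟨h1, h2, M, h3, h4, h5, fun hM H hH hH' => h6 hM H (hL _ H hH hH') hH'⟩

/-! #### Traces -/

/-- The part below `α` of the sets of rank `k` that contain `α`. -/
def tr (L : ℕ → Set (Finset Blocks)) (k : ℕ) (α : Blocks) : Finset Blocks :=
  open Classical in if h : ∃ X ∈ L k, α ∈ X then below h.choose α else ∅

lemma IsPartialScheme.tr_eq {U : Set Blocks} {L : ℕ → Set (Finset Blocks)}
    (hL : IsPartialScheme m n r U L) {k : ℕ} {α : Blocks} {X : Finset Blocks} (hX : X ∈ L k)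
    (hα : α ∈ X) : tr L k α = below X α := by
  have h : ∃ X ∈ L k, α ∈ X := ⟨X, hX, hα⟩
  rw [tr, dif_pos h]
  exact (hL.coh k _ h.choose_spec.1 X hX).below_eq h.choose_spec.2 hα

lemma below_pc_eq_rt {k v : ℕ} {F : Finset Blocks} {x : Blocks} (hx : x ∈ pc m r k F v)
    (hp : pos (pc m r k F v) x = r (k + 1)) : below (pc m r k F v) x = rt r (k + 1) F := by
  have hxp : r (k + 1) ≤ pos F x := by
    rw [pos_eq_pieceEmb hx, hp]; simp [pieceEmb]
  ext y
  rw [mem_below, mem_rt]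
  constructor
  · rintro ⟨hy, hyx⟩
    have h1 := pos_lt_pos hy hyx
    rw [hp] at h1
    rw [pos_eq_pieceEmb hy, pieceEmb, if_pos h1]
    exact ⟨pc_subset hy, h1⟩
  · rintro ⟨hy, hyp⟩
    exact ⟨mem_pc.2 ⟨hy, Or.inl hyp⟩, lt_of_pos_lt (hyp.trans_le hxp)⟩

/-- The canonical pieces of a set that end before `x` depend only on the set below `x`. -/
lemma pc_congr_of_below {k v : ℕ} {F G : Finset Blocks} {x y : Blocks} (h : below F x = below G y)
    (hx : r (k + 1) + (v + 1) * (m k - r (k + 1)) ≤ pos F x) : pc m r k F v = pc m r k G v := by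
  have key : ∀ {F : Finset Blocks} {x : Blocks},
      r (k + 1) + (v + 1) * (m k - r (k + 1)) ≤ pos F x →
        below (pc m r k F v) x = pc m r k F v := by
    intro F x hx
    ext z
    rw [mem_below]
    refine ⟨fun h => h.1, fun hz => ⟨hz, lt_of_pos_lt (F := F) ?_⟩⟩
    have := (mem_pc.1 hz).2
    unfold InPiece at this
    omega
  rw [← key hx, below_pc_congr h, key]
  rwa [pos, ← h]

lemma pos_elt_add {X : Finset Blocks} {b : Omega1} {s t : ℕ} (h : ∀ i < t, elt b (s + i) ∈ X) :
    pos X (elt b (s + t)) = pos X (elt b s) + t := by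
  induction t with
  | zero => rfl
  | succ t ih =>
    have ih := ih fun i hi => h i (by omega)
    have : below X (elt b (s + t + 1)) = insert (elt b (s + t)) (below X (elt b (s + t))) := by
      ext x
      rw [mem_insert, mem_below, mem_below]
      constructor
      · rintro ⟨hx, hlt⟩
        rcases lt_trichotomy x (elt b (s + t)) with h' | h' | h'
        · exact Or.inr ⟨hx, h'⟩
        · exact Or.inl h'
        · rw [blocks_lt_iff] at h' hlt
          simp only [blk_elt, idx_elt] at h' hlt
          rcases h' with h' | h' <;> rcases hlt with h'' | h''
          · exact absurd (h'.trans h'') (lt_irrefl _)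
          · exact absurd h''.1 h'.ne'
          · exact absurd h'.1 h''.ne'
          · omega
      · rintro (rfl | ⟨hx, hlt⟩)
        · exact ⟨h t (Nat.lt_succ_self t), elt_lt_elt.2 (Nat.lt_succ_self _)⟩
        · exact ⟨hx, hlt.trans (elt_lt_elt.2 (Nat.lt_succ_self _))⟩
    rw [← add_assoc, pos, this, card_insert_of_notMem (by simp), ← add_assoc, ← ih, pos]

/-! #### New sets modelled on an old point -/

section NewSet

variable {b : Omega1} {L : ℕ → Set (Finset Blocks)}

variable (m b L) in
/-- The set of rank `k` in the block `b` that imitates the sets of rank `k` containing the old point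
`α`: the first element of the block plays the role of `α`. -/
def newSet (k : ℕ) (α : Blocks) : Finset Blocks := endExt m b (tr L k α) k

variable (hT : IsSchemeType m n r) (hL : IsPartialScheme m n r (blocksLT b) L)
include hL

lemma newSet_eq {k : ℕ} {α : Blocks} {X : Finset Blocks} (hX : X ∈ L k) (hα : α ∈ X) :
    newSet m b L k α = endExt m b (below X α) k := by rw [newSet, hL.tr_eq hX hα]

omit hL in
lemma newSet_congr {k : ℕ} {α α' : Blocks} (h : tr L k α' = tr L k α) :
    newSet m b L k α' = newSet m b L k α := by rw [newSet, h, newSet]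

lemma blk_lt_of_mem_below {k : ℕ} {α : Blocks} {X : Finset Blocks} (hX : X ∈ L k) :
    ∀ x ∈ below X α, blk x < b := fun x hx => hL.sub k X hX x (mem_below.1 hx).1

lemma card_below_lt {k : ℕ} {α : Blocks} {X : Finset Blocks} (hX : X ∈ L k) (hα : α ∈ X) :
    (below X α).card < m k := by
  rw [← hL.card k X hX]; exact pos_lt_card hα

lemma below_newSet {k : ℕ} {α : Blocks} {X : Finset Blocks} (hX : X ∈ L k) (hα : α ∈ X) :
    below (newSet m b L k α) (elt b 0) = below X α := by
  rw [newSet_eq hL hX hα, below_endExt_zero (blk_lt_of_mem_below hL hX)]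

lemma elt_mem_newSet {k t : ℕ} {α : Blocks} {X : Finset Blocks} (hX : X ∈ L k) (hα : α ∈ X) :
    elt b t ∈ newSet m b L k α ↔ t < m k - pos X α := by
  rw [newSet_eq hL hX hα, mem_endExt]
  constructor
  · rintro (h | h)
    · exact absurd (blk_lt_of_mem_below hL hX _ h) (lt_irrefl _)
    · exact h.2
  · intro h; exact Or.inr ⟨rfl, h⟩

lemma pos_elt_newSet {k t : ℕ} {α : Blocks} {X : Finset Blocks} (hX : X ∈ L k) (hα : α ∈ X)
    (ht : t ≤ m k - pos X α) : pos (newSet m b L k α) (elt b t) = pos X α + t := by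
  rw [newSet_eq hL hX hα, pos_endExt_elt (blk_lt_of_mem_below hL hX) ht, pos]

lemma mem_newSet_of_blk_lt {k : ℕ} {α x : Blocks} {X : Finset Blocks} (hX : X ∈ L k) (hα : α ∈ X)
    (hx : blk x < b) : x ∈ newSet m b L k α ↔ x ∈ X ∧ x < α := by
  rw [newSet_eq hL hX hα, mem_endExt, mem_below]
  simp [hx.ne]

lemma pos_newSet_of_lt {k : ℕ} {α x : Blocks} {X : Finset Blocks} (hX : X ∈ L k) (hα : α ∈ X)
    (hx : blk x < b) (hxα : x ≤ α) : pos (newSet m b L k α) x = pos X x := by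
  rw [newSet_eq hL hX hα, pos_endExt_of_blk_lt hx, pos_below hxα]

include hT

lemma card_newSet {k : ℕ} {α : Blocks} (hα : α ∈ blocksLT b) :
    (newSet m b L k α).card = m k := by
  obtain ⟨X, hX, hα⟩ := hL.exists_mem hT hα k
  rw [newSet_eq hL hX hα, card_endExt (blk_lt_of_mem_below hL hX) (card_below_lt hL hX hα).le]

lemma newSet_eq_pc {k i : ℕ} {α : Blocks} {Y : Finset Blocks} (hY : Y ∈ L (k + 1))
    (hi : i < n (k + 1)) (hα : α ∈ pc m r k Y i) (h0 : pos Y α < r (k + 1) → i = 0) :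
    newSet m b L k α = pc m r k (newSet m b L (k + 1) α) i := by
  rw [newSet_eq hL (hL.pc_mem k Y hY i hi) hα, newSet_eq hL hY (pc_subset hα)]
  exact endExt_eq_pc hT hi (hL.card _ Y hY) hα (fun x hx _ => hL.sub _ Y hY x hx) h0

lemma exists_newSet_eq_pc {k : ℕ} {α : Blocks} (hα : α ∈ blocksLT b) :
    ∃ i < n (k + 1), newSet m b L k α = pc m r k (newSet m b L (k + 1) α) i := by
  obtain ⟨Y, hY, hαY⟩ := hL.exists_mem hT hα (k + 1)
  by_cases hp : pos Y α < r (k + 1)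
  · have h0 : 0 < n (k + 1) := (Nat.zero_lt_one).trans (n_pos hT k)
    exact ⟨0, h0, newSet_eq_pc hT hL hY h0 (mem_pc.2 ⟨hαY, Or.inl hp⟩) fun _ => rfl⟩
  · obtain ⟨i, hi, h⟩ := exists_mem_pc hT (hL.card _ Y hY) hαY
    exact ⟨i, hi, newSet_eq_pc hT hL hY hi h fun h => absurd h hp⟩

omit hT in
/-- The pieces of the model before `α` are pieces of the new set. -/
lemma pc_newSet {k v : ℕ} {α : Blocks} {Y : Finset Blocks} (hY : Y ∈ L (k + 1)) (hα : α ∈ Y)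
    (hv : r (k + 1) + (v + 1) * (m k - r (k + 1)) ≤ pos Y α) :
    pc m r k (newSet m b L (k + 1) α) v = pc m r k Y v :=
  (pc_congr_of_below (below_newSet hL hY hα).symm hv).symm

/-! #### Meeting the requirements -/

/-- Every point up to the block `b` gets into the new sets after a suitable switch. For an old point
`β`, the switch is to the first point of the second piece of a set whose first piece contains `β`;
the trace at that point contains the whole first piece. -/
lemma exists_mem_newSet {α : Blocks} (hα : α ∈ blocksLT b) {β : Blocks} (hβ : β ∈ blocksLE b)
    (k₀ : ℕ) : ∃ k ≥ k₀, ∃ α' ∈ blocksLT b, tr L k α' = tr L k α ∧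
      β ∈ newSet m b L (k + 1) α' := by
  have h0 : 0 < n (k₀ + 1) := (Nat.zero_lt_one).trans (n_pos hT k₀)
  rcases (show blk β ≤ b from hβ).lt_or_eq with hb | hb
  · obtain ⟨k, hk, X, hX, hA, hαX, hp⟩ := hL.rich {β} (by simpa using! hb) α hα k₀
    have h1 := n_pos hT k
    have hm : m k < X.card := by rw [hL.card _ X hX]; exact m_lt_succ hT k
    have hr := hT.r_lt k
    obtain ⟨α', hα', hp'⟩ := exists_pos_eq hm
    have hα'1 : α' ∈ pc m r k X 1 := mem_pc.2 ⟨hα', Or.inr (by rw [hp']; omega)⟩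
    have hpos : pos (pc m r k X 1) α' = r (k + 1) := by
      have := pos_eq_pieceEmb hα'1
      rw [hp', pieceEmb] at this
      split_ifs at this <;> omega
    have hpos0 : pos (pc m r k X 0) α = r (k + 1) := by rw [pos_pc_of_lt hp.le, hp]
    refine ⟨k, hk, α', hL.sub _ X hX α' hα', ?_, ?_⟩
    · rw [hL.tr_eq (hL.pc_mem k X hX 1 h1) hα'1, hL.tr_eq (hL.pc_mem k X hX 0 (by omega)) hαX,
        below_pc_eq_rt hα'1 hpos, below_pc_eq_rt hαX hpos0]
    · have hβX := hA (mem_singleton_self β)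
      rw [mem_newSet_of_blk_lt hL hX hα' hb]
      refine ⟨pc_subset hβX, lt_of_pos_lt (F := X) ?_⟩
      have := (mem_pc.1 hβX).2
      unfold InPiece at this
      omega
  · obtain ⟨k, hk, X, hX, hA, hαX, hp⟩ := hL.rich
      ((range (idx β + 1)).image fun i => elt (blk α) (idx α + i))
      (by intro x hx; obtain ⟨i, -, rfl⟩ := mem_image.1 hx; exact hα) α hα k₀
    refine ⟨k, hk, α, hα, rfl, ?_⟩
    rw [eq_elt hb, elt_mem_newSet hL hX (pc_subset hαX)]
    have hmem : ∀ i < idx β + 1, elt (blk α) (idx α + i) ∈ X := fun i hi =>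
      pc_subset (hA (mem_image_of_mem (fun i => elt (blk α) (idx α + i)) (mem_range.2 hi)))
    have := pos_elt_add fun i hi => hmem i (Nat.lt_succ_of_lt hi)
    have h2 := pos_lt_card (hmem _ (Nat.lt_succ_self _))
    rw [hL.card _ X hX] at h2
    rw [elt_blk_idx] at this
    omega

/-- At arbitrarily large ranks, the new set is the initial piece of the next one, whose root ends
exactly below a given point. -/
lemma exists_newSet_rich {α : Blocks} (hα : α ∈ blocksLT b) {β : Blocks} (hβ : β ∈ blocksLE b)
    (k₀ : ℕ) : ∃ k ≥ k₀, β ∈ newSet m b L k α →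
      newSet m b L k α = pc m r k (newSet m b L (k + 1) α) 0 ∧
        pos (newSet m b L (k + 1) α) β = r (k + 1) := by
  rcases (show blk β ≤ b from hβ).lt_or_eq with hb | hb
  · obtain ⟨k, hk, X, hX, hA, hβX, hp⟩ := hL.rich {α} (by simpa using hα) β hb k₀
    have h0 : 0 < n (k + 1) := (Nat.zero_lt_one).trans (n_pos hT k)
    have hαX := hA (mem_singleton_self α)
    refine ⟨k, hk, fun hβ' => ⟨newSet_eq_pc hT hL hX h0 hαX fun _ => rfl, ?_⟩⟩
    rw [mem_newSet_of_blk_lt hL (hL.pc_mem k X hX 0 h0) hαX hb] at hβ'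
    rw [pos_newSet_of_lt hL hX (pc_subset hαX) hb hβ'.2.le, hp]
  · obtain ⟨k, hk, X, hX, hA, hαX, hp⟩ := hL.rich
      ((range (idx β + 1)).image fun i => elt (blk α) (idx α + i))
      (by intro x hx; obtain ⟨i, -, rfl⟩ := mem_image.1 hx; exact hα)
      (elt (blk α) (idx α + idx β)) hα k₀
    have h0 : 0 < n (k + 1) := (Nat.zero_lt_one).trans (n_pos hT k)
    have hmem : ∀ i < idx β + 1, elt (blk α) (idx α + i) ∈ pc m r k X 0 := fun i hi =>
      hA (mem_image_of_mem (fun i => elt (blk α) (idx α + i)) (mem_range.2 hi))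
    have hα0 : α ∈ pc m r k X 0 := by
      have := hmem 0 (Nat.succ_pos _); rwa [add_zero, elt_blk_idx] at this
    refine ⟨k, hk, fun _ => ⟨newSet_eq_pc hT hL hX h0 hα0 fun _ => rfl, ?_⟩⟩
    have h1 := pos_elt_add fun i hi => pc_subset (hmem i (Nat.lt_succ_of_lt hi))
    have h2 := pos_lt_card (pc_subset (hmem _ (Nat.lt_succ_self _)))
    rw [hL.card _ X hX, hp] at h2
    rw [elt_blk_idx, hp] at h1
    rw [eq_elt hb, pos_elt_newSet hL hX (pc_subset hα0) (by omega), ← h1]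

/-- The new block can be treated: among the sets of rank `k + 1` with the right root, the one with
the longest run of pieces selecting members of `D` is imitated. -/
lemma exists_treated_self (D : Set (Finset Blocks)) {α : Blocks} (hα : α ∈ blocksLT b)
    (E : Finset Blocks) (k₀ : ℕ) : ∃ k ≥ k₀, ∃ α' ∈ blocksLT b, tr L k α' = tr L k α ∧
      Treated m n r D b L k (newSet m b L k α') (newSet m b L (k + 1) α')
        (E.image (pos (newSet m b L k α'))) := by
  classical
  obtain ⟨k, hk, X, hX, -, hαX, hp⟩ := hL.rich ∅ (by simp) α hα k₀
  have h1 := n_pos hT k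
  have hX0 := hL.pc_mem k X hX 0 (by omega)
  have hpos0 : pos (pc m r k X 0) α = r (k + 1) := by rw [pos_pc_of_lt hp.le, hp]
  have htr : tr L k α = rt r (k + 1) X := by rw [hL.tr_eq hX0 hαX, below_pc_eq_rt hαX hpos0]
  set ε := E.image (pos (newSet m b L k α)) with hε
  let P : ℕ → Prop := fun M => ∃ H ∈ L (k + 1), rt r (k + 1) H = tr L k α ∧
    ∀ v < M, sel (pc m r k H v) ε ∈ D
  have hP0 : P 0 := ⟨X, hX, htr.symm, by simp⟩
  set M := Nat.findGreatest P (n (k + 1) - 1) with hM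
  have hPM : P M := Nat.findGreatest_spec (Nat.zero_le _) hP0
  have hMn : M < n (k + 1) := by
    have := Nat.findGreatest_le (P := P) (n (k + 1) - 1); omega
  obtain ⟨H, hH, hrt, hsel⟩ := hPM
  have hr := hT.r_lt k
  have hcard : r (k + 1) + M * (m k - r (k + 1)) < H.card := by
    rw [hL.card _ H hH, hT.m_succ k]
    have := Nat.mul_le_mul_right (m k - r (k + 1)) (Nat.succ_le_of_lt hMn)
    rw [Nat.succ_eq_add_one, add_one_mul] at this
    omega
  obtain ⟨α', hα', hp'⟩ := exists_pos_eq hcard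
  have hα'M : α' ∈ pc m r k H M :=
    mem_pc.2 ⟨hα', Or.inr (by rw [hp', add_one_mul]; omega)⟩
  have hpos' : pos (pc m r k H M) α' = r (k + 1) := by
    have := pos_eq_pieceEmb hα'M
    rw [hp', pieceEmb] at this
    generalize M * (m k - r (k + 1)) = a at *
    split_ifs at this <;> omega
  have hHM := hL.pc_mem k H hH M hMn
  have htr' : tr L k α' = tr L k α := by
    rw [hL.tr_eq hHM hα'M, below_pc_eq_rt hα'M hpos', hrt]
  refine ⟨k, hk, α', hL.sub _ H hH α' hα', htr', ?_, ?_, M, hMn, ?_, ?_, ?_⟩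
  · rw [elt_mem_newSet hL hHM hα'M, hpos']; omega
  · rw [pos_elt_newSet hL hHM hα'M (Nat.zero_le _), hpos', add_zero]
  · exact (newSet_eq_pc hT hL hH hMn hα'M (by rw [hp']; omega)).symm
  · intro v hv
    rw [newSet_congr htr', pc_newSet hL hH hα']
    · exact hsel v hv
    · rw [hp']
      have := Nat.mul_le_mul_right (m k - r (k + 1)) (Nat.succ_le_of_lt hv)
      rw [Nat.succ_eq_add_one] at this
      omega
  · intro hM1 H' hH' _ hrt'
    by_contra! hc
    rw [newSet_congr htr'] at hc
    rw [below_newSet hL hHM hα'M, ← hL.tr_eq hHM hα'M, htr'] at hrt'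
    have : P (M + 1) := ⟨H', hH', hrt', fun v hv => hc v (Nat.lt_succ_iff.1 hv)⟩
    have := Nat.le_findGreatest (P := P) (show M + 1 ≤ n (k + 1) - 1 by omega) this
    omega

omit hT in
/-- The positions in a new set are those in a set containing an interval of the block of the old
point. -/
lemma exists_pos_newSet_eq {k₁ k : ℕ} {α : Blocks} {A F : Finset Blocks} (hA : A ∈ L k₁)
    (hαA : α ∈ A) (h1 : ∀ x ∈ A, α ≤ x → blk x = blk α)
    (h2 : ∀ x ∈ A, ∀ y, α ≤ y → y ≤ x → y ∈ A) (hF : F ∈ L k) (hAF : A ⊆ F) {x : Blocks}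
    (hx : x ∈ newSet m b L k₁ α) (hxb : x ∈ blocksLE b) :
    ∃ y ∈ A, pos A y = pos (newSet m b L k₁ α) x ∧ pos F y = pos (newSet m b L k α) x := by
  have hαF := hAF hαA
  rcases (show blk x ≤ b from hxb).lt_or_eq with hb | hb
  · rw [mem_newSet_of_blk_lt hL hA hαA hb] at hx
    exact ⟨x, hx.1, (pos_newSet_of_lt hL hA hαA hb hx.2.le).symm,
      (pos_newSet_of_lt hL hF hαF hb hx.2.le).symm⟩
  · rw [eq_elt hb, elt_mem_newSet hL hA hαA] at hx
    have hlt : pos A α + idx x < A.card := by rw [hL.card _ A hA]; omega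
    obtain ⟨y, hy, hpy⟩ := exists_pos_eq hlt
    have hαy : α ≤ y := by
      by_contra hc
      have := pos_lt_pos hy (not_le.1 hc); omega
    have hyb := h1 y hy hαy
    have hidx : idx α ≤ idx y := by
      rcases hαy.lt_or_eq with h | rfl
      · rcases blocks_lt_iff.1 h with h | h
        · exact absurd hyb h.ne'
        · exact h.2.le
      · exact le_rfl
    obtain ⟨t, ht⟩ := Nat.exists_eq_add_of_le hidx
    have hmem : ∀ i < t, elt (blk α) (idx α + i) ∈ A := by
      intro i hi
      refine h2 y hy _ ?_ ?_
      · rcases Nat.eq_zero_or_pos i with rfl | hi0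
        · rw [add_zero, elt_blk_idx]
        · exact le_of_lt (blocks_lt_iff.2 (Or.inr ⟨rfl, show idx α < idx α + i by omega⟩))
      · exact le_of_lt (blocks_lt_iff.2 (Or.inr ⟨hyb.symm, show idx α + i < idx y by omega⟩))
    have hyt : y = elt (blk α) (idx α + t) := by rw [← ht]; exact eq_elt hyb
    have e1 := pos_elt_add hmem
    have e2 := pos_elt_add fun i hi => hAF (hmem i hi)
    rw [← hyt, elt_blk_idx] at e1 e2
    have e3 := pos_lt_card (hAF hy)
    rw [hL.card _ F hF] at e3
    refine ⟨y, hy, ?_, ?_⟩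
    · rw [hpy, eq_elt hb, pos_elt_newSet hL hA hαA (by omega), idx_elt]
    · rw [e2, eq_elt hb, pos_elt_newSet hL hF hαF (by omega)]; omega

/-- An old promise passes to the new part of the scheme. -/
lemma exists_treated_of_promise {D : Set (Finset Blocks)} {μ : Omega1} (hμ : μ < b)
    (hP : Promise m n r D μ (blocksLT b) L) {α : Blocks} (hα : α ∈ blocksLT b)
    {E : Finset Blocks} (k₀ : ℕ) : ∃ k ≥ k₀, E ⊆ newSet m b L k α → elt μ 0 ∈ newSet m b L k α →
      Treated m n r D μ L k (newSet m b L k α) (newSet m b L (k + 1) α)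
        (E.image (pos (newSet m b L k α))) := by
  obtain ⟨kα, hkα⟩ := hL.interval α hα
  obtain ⟨A, hA, hαA, h1, h2⟩ := hkα (max k₀ kα) (le_max_right _ _)
  by_cases hE : E ⊆ newSet m b L (max k₀ kα) α ∧ elt μ 0 ∈ newSet m b L (max k₀ kα) α
  swap
  · exact ⟨max k₀ kα, le_max_left _ _, fun h h' => absurd ⟨h, h'⟩ hE⟩
  obtain ⟨hE, hμA⟩ := hE
  have hμα : elt μ 0 ∈ A ∧ elt μ 0 < α := (mem_newSet_of_blk_lt hL hA hαA (by simpa using hμ)).1 hμA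
  set ε := E.image (pos (newSet m b L (max k₀ kα) α)) with hε
  obtain ⟨k, hk, F, hF, G, hG, hAF, hμF, hpF, M, hMn, hGM, hsel, hmax⟩ :=
    hP A (hL.sub _ A hA) (sel A ε) (filter_subset _ _) (max k₀ kα)
  refine ⟨k, (le_max_left _ _).trans hk, fun _ _ => ?_⟩
  have hαF := hAF hαA
  have hblk : ∀ x ∈ newSet m b L (max k₀ kα) α, x ∈ blocksLE b := by
    intro x hx
    rw [newSet_eq hL hA hαA, mem_endExt] at hx
    rcases hx with hx | hx
    · exact (blk_lt_of_mem_below hL hA x hx).le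
    · exact hx.1.le
  have hεeq : E.image (pos (newSet m b L k α)) = (sel A ε).image (pos F) := by
    ext p
    simp only [mem_image, mem_sel]
    constructor
    · rintro ⟨x, hx, rfl⟩
      obtain ⟨y, hy, e1, e2⟩ := exists_pos_newSet_eq hL hA hαA h1 h2 hF hAF (hE hx)
        (hblk x (hE hx))
      exact ⟨y, ⟨hy, e1 ▸ mem_image_of_mem _ hx⟩, e2⟩
    · rintro ⟨y, ⟨hy, hye⟩, rfl⟩
      obtain ⟨x, hx, hxy⟩ := mem_image.1 hye
      obtain ⟨y', hy', e1, e2⟩ := exists_pos_newSet_eq hL hA hαA h1 h2 hF hAF (hE hx)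
        (hblk x (hE hx))
      have : y = y' := pos_inj hy hy' (by rw [e1, hxy])
      exact ⟨x, hx, by rw [this, e2]⟩
  have hαGM : α ∈ pc m r k G M := by rw [hGM]; exact hαF
  have hαG := pc_subset hαGM
  have hpos : r (k + 1) < pos F α := by rw [← hpF]; exact pos_lt_pos hμF hμα.2
  have hposG : pos G α = pos F α + M * (m k - r (k + 1)) := by
    rw [pos_eq_pieceEmb hαGM, hGM, pieceEmb, if_neg (by omega)]
  rw [hεeq]
  have hbel : below (newSet m b L k α) (elt μ 0) = below F (elt μ 0) := by
    rw [newSet_eq hL hF hαF]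
    rw [below_endExt_of_le (lt_elt_zero.2 hμ).le, below_below hμα.2.le]
  refine ⟨?_, ?_, M, hMn, ?_, ?_, ?_⟩
  · rw [mem_newSet_of_blk_lt hL hF hαF (by simpa using hμ)]; exact ⟨hμF, hμα.2⟩
  · rw [pos, hbel, ← hpF, pos]
  · exact (newSet_eq_pc hT hL hG hMn hαGM (by omega)).symm
  · intro v hv
    rw [pc_newSet hL hG hαG]
    · exact hsel v hv
    · have := Nat.mul_le_mul_right (m k - r (k + 1)) (Nat.succ_le_of_lt hv)
      rw [Nat.succ_eq_add_one] at this
      omega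
  · rw [hbel]; exact hmax

end NewSet

/-! #### The extension -/

instance (b : Omega1) : Countable (blocksLE b) := by
  have : Set.InjOn (fun x : Blocks => (blk x, idx x)) (blocksLE b) := fun x _ y _ h => by
    simp only [Prod.mk.injEq] at h
    rw [← elt_blk_idx x, ← elt_blk_idx y, h.1, h.2]
  refine Set.MapsTo.countable_of_injOn (t := Set.Iic b ×ˢ Set.univ) (fun x hx => ⟨hx, trivial⟩) this
    ?_
  exact Set.Countable.prod (Set.to_countable _) (Set.to_countable _)

/-- A scheme on the blocks before `b` that keeps its promises extends to the block `b`, keeping also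
the promise for `b` itself. -/
theorem exists_isStageExt (hT : IsSchemeType m n r) (𝒟 : Omega1 → Set (Finset Blocks)) {b : Omega1}
    {L : ℕ → Set (Finset Blocks)} (hL : IsPartialScheme m n r (blocksLT b) L)
    (hP : ∀ μ < b, ¬ IsMin μ → Promise m n r (𝒟 μ) μ (blocksLT b) L) :
    ∃ L', IsStageExt m n r 𝒟 b L L' := by
  classical
  by_cases hb : IsMin b
  -- in the first block the chain consists of the initial segments of the block
  · have hempty : ∀ x : Blocks, ¬ blk x < b := fun x hx => hx.not_ge (hb hx.le)
    have hpos : ∀ k t, t ≤ m k → pos (endExt m b ∅ k) (elt b t) = t := fun k t ht => by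
      rw [pos_endExt_elt (by simp) (by simpa using ht)]; simp
    have hpc : ∀ k, endExt m b ∅ k = pc m r k (endExt m b ∅ (k + 1)) 0 := by
      intro k
      have h1 := m_lt_succ hT k
      have h2 := hT.r_lt k
      ext x
      rw [mem_pc, mem_endExt, mem_endExt]
      simp only [notMem_empty, card_empty, false_or, tsub_zero]
      constructor
      · rintro ⟨hx, hi⟩
        refine ⟨⟨hx, by omega⟩, ?_⟩
        rw [eq_elt hx, hpos _ _ (by omega)]; unfold InPiece; omega
      · rintro ⟨⟨hx, hi⟩, h⟩
        rw [eq_elt hx, hpos _ _ (by omega)] at h; unfold InPiece at h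
        exact ⟨hx, by omega⟩
    have hc : IsNewChain m n r b L fun k => endExt m b ∅ k :=
      { blk_le := fun k x hx => by
          rcases mem_endExt.1 hx with hx | hx
          · simp at hx
          · exact hx.1.le
        card := fun k => card_endExt (by simp) (by simp)
        eq_pc := fun k => ⟨0, (Nat.zero_lt_one).trans (n_pos hT k), hpc k⟩
        trace := fun k => Or.inr (below_endExt_zero (by simp))
        rich := by
          intro β hβ k₀
          have hβ : blk β = b := hβ.antisymm (hb hβ)
          obtain ⟨k, hk, hk'⟩ := (hT.r_infinite (idx β)).exists_gt (k₀ + 1)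
          obtain ⟨k, rfl⟩ := Nat.exists_eq_succ_of_ne_zero (show k ≠ 0 by omega)
          have hk : r (k + 1) = idx β := hk
          have h2 := hT.r_lt k
          have h1 := m_lt_succ hT k
          refine ⟨k, by omega, mem_endExt.2 (Or.inr ⟨hβ, by simp; omega⟩), hpc k, ?_⟩
          rw [eq_elt hβ, hpos _ _ (by omega), hk]
        interval := fun k t ht s hs => by
          rcases mem_endExt.1 ht with ht | ht
          · simp at ht
          · refine mem_endExt.2 (Or.inr ⟨rfl, hs.trans ht.2⟩) }
    refine ⟨_, fun k F hF => Or.inl hF, hc.isPartialScheme hT hL,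
      fun k F hF => hc.mem_of_blk_lt hT hL hF, fun μ hμ hμ' => absurd ?_ hμ'⟩
    rwa [hμ.antisymm (hb hμ)]
  · obtain ⟨a, ha⟩ := not_isMin_iff.1 hb
    have : Nonempty (blocksLT b) := ⟨⟨elt a 0, ha⟩⟩
    -- the requirements: every point is covered, is the end of a root, and the promises are kept
    obtain ⟨f, hf, hQ⟩ := exists_seq_of_tasks (A := blocksLT b)
      (ι := blocksLE b ⊕ blocksLE b ⊕ Set.Iic b × Finset (blocksLE b)) (fun k α => tr L k α)
      (fun t k α => match t with
        | .inl β => (β : Blocks) ∈ newSet m b L (k + 1) α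
        | .inr (.inl β) => (β : Blocks) ∈ newSet m b L k α →
            newSet m b L k α = pc m r k (newSet m b L (k + 1) α) 0 ∧
              pos (newSet m b L (k + 1) α) β = r (k + 1)
        | .inr (.inr (μ, E)) => ¬ IsMin (μ : Omega1) →
            E.map ⟨_, Subtype.val_injective⟩ ⊆ newSet m b L k α → elt μ 0 ∈ newSet m b L k α →
              Treated m n r (𝒟 μ) μ L k (newSet m b L k α) (newSet m b L (k + 1) α)
                ((E.map ⟨_, Subtype.val_injective⟩).image (pos (newSet m b L k α))))
      (by
        rintro (β | β | ⟨⟨μ, hμ⟩, E⟩) k₀ ⟨α, hα⟩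
        · obtain ⟨k, hk, α', h1, h2⟩ := exists_mem_newSet hT hL hα β.2 k₀
          exact ⟨k, hk, ⟨α', h1⟩, h2⟩
        · obtain ⟨k, hk, h⟩ := exists_newSet_rich hT hL hα β.2 k₀
          exact ⟨k, hk, ⟨α, hα⟩, rfl, h⟩
        · by_cases hμ' : IsMin μ
          · exact ⟨k₀, le_rfl, ⟨α, hα⟩, rfl, fun h => absurd hμ' h⟩
          rcases (show μ ≤ b from hμ).lt_or_eq with h | rfl
          · obtain ⟨k, hk, h⟩ := exists_treated_of_promise hT hL h (hP μ h hμ') hα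
              (E := E.map ⟨_, Subtype.val_injective⟩) k₀
            exact ⟨k, hk, ⟨α, hα⟩, rfl, fun _ => h⟩
          · obtain ⟨k, hk, α', h1, h2, h3⟩ := exists_treated_self hT hL (𝒟 μ) hα
              (E.map ⟨_, Subtype.val_injective⟩) k₀
            exact ⟨k, hk, ⟨α', h1⟩, h2, fun _ _ _ => h3⟩)
    have hsucc : ∀ k, newSet m b L (k + 1) (f (k + 1)) = newSet m b L (k + 1) (f k) := fun k =>
      newSet_congr (hf k)
    have hpc : ∀ k, ∃ i < n (k + 1), newSet m b L k (f k) =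
        pc m r k (newSet m b L (k + 1) (f (k + 1))) i := fun k => by
      rw [hsucc]; exact exists_newSet_eq_pc hT hL (f k).2
    have hmono : Monotone fun k => newSet m b L k (f k) := monotone_nat_of_le_succ fun k => by
      obtain ⟨i, -, h⟩ := hpc k
      rw [h]; exact pc_subset
    have hcov : ∀ β ∈ blocksLE b, ∃ k, β ∈ newSet m b L k (f k) := fun β hβ => by
      obtain ⟨k, -, h⟩ := hQ (.inl ⟨β, hβ⟩) 0
      exact ⟨k + 1, by rw [hsucc]; exact h⟩
    have hc : IsNewChain m n r b L fun k => newSet m b L k (f k) :=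
      { blk_le := fun k x hx => by
          obtain ⟨X, hX, hα⟩ := hL.exists_mem hT (f k).2 k
          rw [newSet_eq hL hX hα, mem_endExt] at hx
          rcases hx with hx | hx
          · exact (blk_lt_of_mem_below hL hX x hx).le
          · exact hx.1.le
        card := fun k => card_newSet hT hL (f k).2
        eq_pc := hpc
        trace := fun k => by
          obtain ⟨X, hX, hα⟩ := hL.exists_mem hT (f k).2 k
          exact Or.inl ⟨X, hX, f k, below_newSet hL hX hα⟩
        rich := fun β hβ k₀ => by
          obtain ⟨k₁, h1⟩ := hcov β hβ
          obtain ⟨k, hk, h⟩ := hQ (.inr (.inl ⟨β, hβ⟩)) (max k₀ k₁)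
          have hmem := hmono ((le_max_right _ _).trans hk) h1
          refine ⟨k, (le_max_left _ _).trans hk, hmem, ?_⟩
          rw [hsucc]; exact h hmem
        interval := fun k t ht s hs => by
          obtain ⟨X, hX, hα⟩ := hL.exists_mem hT (f k).2 k
          rw [elt_mem_newSet hL hX hα] at ht ⊢
          exact hs.trans ht }
    refine ⟨_, fun k F hF => Or.inl hF, hc.isPartialScheme hT hL,
      fun k F hF => hc.mem_of_blk_lt hT hL hF, fun μ hμ hμ' A hA E hE k₀ => ?_⟩
    obtain ⟨k₁, h1⟩ := hc.exists_subset (insert (elt μ 0) A) (by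
      intro x hx
      rcases mem_insert.1 hx with rfl | hx
      · exact hμ
      · exact hA x hx)
    have hEmap : (E.subtype (· ∈ blocksLE b)).map ⟨_, Subtype.val_injective⟩ = E := by
      rw [show (⟨_, Subtype.val_injective⟩ : blocksLE b ↪ Blocks) =
        Function.Embedding.subtype (· ∈ blocksLE b) from rfl, Finset.subtype_map]
      exact filter_true_of_mem fun x hx => hA x (hE hx)
    obtain ⟨k, hk, h⟩ := hQ (.inr (.inr (⟨μ, hμ⟩, E.subtype (· ∈ blocksLE b)))) (max k₀ k₁)
    have hsub := h1.trans (hmono ((le_max_right _ _).trans hk))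
    simp only [hEmap] at h
    refine ⟨k, (le_max_left _ _).trans hk, newSet m b L k (f k), Or.inr ⟨k, .refl⟩,
      newSet m b L (k + 1) (f (k + 1)), Or.inr ⟨k + 1, .refl⟩,
      (subset_insert _ _).trans hsub, ?_⟩
    rw [hsucc]
    refine (h hμ' (hE.trans ((subset_insert _ _).trans hsub)) (hsub (mem_insert_self _ _))).congr ?_
    intro k H hH hHμ
    exact hc.mem_of_blk_lt hT hL hH fun x hx => (hHμ x hx).trans_le hμ

end

section

/-! ### The recursion along the countable ordinals -/

section Recursion

variable {m n r : ℕ → ℕ}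

/-- The union of the schemes `G b`, `b ∈ I`. -/
def unionLevels (G : Omega1 → ℕ → Set (Finset Blocks)) (I : Set Omega1) (k : ℕ) :
    Set (Finset Blocks) := {F | ∃ b ∈ I, F ∈ G b k}

variable (m n r) in
/-- Recursive choice of the schemes: `G b` extends the union of the earlier ones whenever there is an
extension. -/
lemma exists_rec (𝒟 : Omega1 → Set (Finset Blocks)) :
    ∃ G : Omega1 → ℕ → Set (Finset Blocks), ∀ b,
      (∃ L', IsStageExt m n r 𝒟 b (unionLevels G (Set.Iio b)) L') →
        IsStageExt m n r 𝒟 b (unionLevels G (Set.Iio b)) (G b) := by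
  let step : ∀ b : Omega1, (∀ b' : Omega1, b' < b → ℕ → Set (Finset Blocks)) →
      ℕ → Set (Finset Blocks) := fun b ih => Classical.epsilon
    (IsStageExt m n r 𝒟 b fun k => {F | ∃ b', ∃ h : b' < b, F ∈ ih b' h k})
  refine ⟨(wellFounded_lt (α := Omega1)).fix step, fun b hb => ?_⟩
  have h : unionLevels ((wellFounded_lt (α := Omega1)).fix step) (Set.Iio b) =
      fun k => {F | ∃ b', ∃ _ : b' < b, F ∈ (wellFounded_lt (α := Omega1)).fix step b' k} := by
    funext k; ext F; simp [unionLevels]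
  rw [WellFounded.fix_eq]
  rw [h] at hb ⊢
  exact Classical.epsilon_spec hb

variable {𝒟 : Omega1 → Set (Finset Blocks)} {G : Omega1 → ℕ → Set (Finset Blocks)} {I : Set Omega1}
  (hI : ∀ b ∈ I, ∀ a < b, a ∈ I)
  (hG : ∀ b ∈ I, IsStageExt m n r 𝒟 b (unionLevels G (Set.Iio b)) (G b))
include hG

lemma stage_mono {a b : Omega1} (hb : b ∈ I) (hab : a ≤ b) (k : ℕ) : G a k ⊆ G b k := by
  rcases hab.lt_or_eq with h | rfl
  · exact fun F hF => (hG b hb).le k ⟨a, h, hF⟩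
  · exact Set.Subset.rfl

include hI

/-- Later stages are end-extensions: a set before the block `μ` belongs to a stage before `μ`. -/
lemma mem_stage_of_blk_lt {b μ : Omega1} (hb : b ∈ I) {k : ℕ} {F : Finset Blocks} (hF : F ∈ G b k)
    (h : ∀ x ∈ F, blk x < μ) : ∃ a < μ, F ∈ G a k := by
  induction b using WellFoundedLT.induction with
  | ind b ih =>
    rcases lt_or_ge b μ with hbμ | hbμ
    · exact ⟨b, hbμ, hF⟩
    · obtain ⟨a, ha, hFa⟩ := (hG b hb).mem_of_blk_lt k F hF fun x hx => (h x hx).trans_le hbμ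
      exact ih a ha (hI b hb a ha) hFa

omit hI hG in
lemma exists_forall_blk_le (A : Finset Blocks) {a : Omega1} (ha : a ∈ I)
    (hA : ∀ x ∈ A, blk x ∈ I) : ∃ b ∈ I, a ≤ b ∧ ∀ x ∈ A, blk x ≤ b := by
  induction A using Finset.induction_on with
  | empty => exact ⟨a, ha, le_rfl, by simp⟩
  | insert x A _ ih =>
    obtain ⟨b, hb, hab, h⟩ := ih fun y hy => hA y (mem_insert_of_mem hy)
    refine ⟨max b (blk x), ?_, hab.trans (le_max_left _ _), fun y hy => ?_⟩
    · rcases max_choice b (blk x) with h | h <;> rw [h]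
      exacts [hb, hA x (mem_insert_self _ _)]
    · rcases mem_insert.1 hy with rfl | hy
      · exact le_max_right _ _
      · exact (h y hy).trans (le_max_left _ _)

lemma isPartialScheme_unionLevels :
    IsPartialScheme m n r {x | blk x ∈ I} (unionLevels G I) where
  sub := by
    rintro k F ⟨b, hb, hF⟩ x hx
    rcases (show blk x ≤ b from (hG b hb).scheme.sub k F hF x hx).lt_or_eq with h | h
    · exact hI b hb _ h
    · exact (show blk x ∈ I from h ▸ hb)
  card := by
    rintro k F ⟨b, hb, hF⟩
    exact (hG b hb).scheme.card k F hF
  single := fun x hx => ⟨blk x, hx, (hG _ hx).scheme.single x (le_refl (blk x))⟩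
  coh := by
    rintro k F ⟨b, hb, hF⟩ F' ⟨b', hb', hF'⟩
    rcases le_total b b' with h | h
    · exact (hG b' hb').scheme.coh k F (stage_mono hG hb' h k hF) F' hF'
    · exact (hG b hb).scheme.coh k F hF F' (stage_mono hG hb h k hF')
  pc_mem := by
    rintro k F ⟨b, hb, hF⟩ i hi
    exact ⟨b, hb, (hG b hb).scheme.pc_mem k F hF i hi⟩
  rich := by
    intro A hA α hα k₀
    obtain ⟨b, hb, hab, h⟩ := exists_forall_blk_le A hα hA
    obtain ⟨k, hk, X, hX, h'⟩ := (hG b hb).scheme.rich A h α hab k₀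
    exact ⟨k, hk, X, ⟨b, hb, hX⟩, h'⟩
  interval := by
    intro α hα
    obtain ⟨k₀, h⟩ := (hG _ hα).scheme.interval α (le_refl (blk α))
    refine ⟨k₀, fun k hk => ?_⟩
    obtain ⟨X, hX, h'⟩ := h k hk
    exact ⟨X, ⟨_, hα, hX⟩, h'⟩

lemma promise_unionLevels {μ : Omega1} (hμ : μ ∈ I) (hμ' : ¬ IsMin μ) :
    Promise m n r (𝒟 μ) μ {x | blk x ∈ I} (unionLevels G I) := by
  intro A hA E hE k₀
  obtain ⟨b, hb, hab, h⟩ := exists_forall_blk_le A hμ hA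
  obtain ⟨k, hk, F, hF, F', hF', hAF, hTr⟩ := (hG b hb).promise μ hab hμ' A h E hE k₀
  refine ⟨k, hk, F, ⟨b, hb, hF⟩, F', ⟨b, hb, hF'⟩, hAF, hTr.congr ?_⟩
  rintro k H ⟨b', hb', hH⟩ hHμ
  obtain ⟨a, ha, hHa⟩ := mem_stage_of_blk_lt hI hG hb' hH hHμ
  exact stage_mono hG hb (ha.le.trans hab) k hHa

omit hI hG in
theorem exists_scheme_with_promises (hT : IsSchemeType m n r) (𝒟 : Omega1 → Set (Finset Blocks)) :
    ∃ L, IsPartialScheme m n r Set.univ L ∧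
      ∀ μ, ¬ IsMin μ → Promise m n r (𝒟 μ) μ Set.univ L := by
  obtain ⟨G, hG⟩ := exists_rec m n r 𝒟
  have key : ∀ b, IsStageExt m n r 𝒟 b (unionLevels G (Set.Iio b)) (G b) := by
    intro b
    induction b using WellFoundedLT.induction with
    | ind b ih =>
      refine hG b ?_
      have hI : ∀ a ∈ Set.Iio b, ∀ c < a, c ∈ Set.Iio b := fun a ha c hc => hc.trans ha
      exact exists_isStageExt hT 𝒟 (isPartialScheme_unionLevels hI ih)
        fun μ hμ hμ' => promise_unionLevels hI ih hμ hμ'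
  have hI : ∀ a ∈ Set.univ, ∀ c < a, c ∈ (Set.univ : Set Omega1) := fun _ _ _ _ => trivial
  exact ⟨_, isPartialScheme_unionLevels hI fun b _ => key b,
    fun μ hμ => promise_unionLevels hI (fun b _ => key b) trivial hμ⟩

end Recursion

/-! ### Guessing uncountable families -/

lemma isClub_closed_under (h : Omega1 → Omega1) :
    IsClub {l : Omega1 | ¬ IsMin l ∧ ∀ b < l, h b < l} := by
  refine ⟨?_, fun a => ?_⟩
  · intro t ht ht0 _ a ha
    refine ⟨?_, fun b hb => ?_⟩
    · obtain ⟨c, hc⟩ := ht0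
      obtain ⟨x, hx⟩ := not_isMin_iff.1 (ht hc).1
      exact not_isMin_iff.2 ⟨x, hx.trans_le (ha.1 hc)⟩
    · obtain ⟨c, hc, hbc⟩ := (lt_isLUB_iff ha).1 hb
      exact ((ht hc).2 b hbc).trans_le (ha.1 hc)
  · have hstep : ∀ c : Omega1, ∃ c', c < c' ∧ ∀ b ≤ c, h b < c' := fun c => by
      obtain ⟨c', hc'⟩ := exists_forall_lt_omega1
        (((countable_Iic_omega1 c).image h).insert c)
      exact ⟨c', hc' c (Set.mem_insert _ _),
        fun b hb => hc' _ (Set.mem_insert_of_mem _ ⟨b, hb, rfl⟩)⟩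
    choose g hg hg' using hstep
    obtain ⟨u, hu⟩ := exists_forall_lt_omega1 (Set.countable_range fun i : ℕ => g^[i] a)
    have hne : (upperBounds (Set.range fun i : ℕ => g^[i] a)).Nonempty :=
      ⟨u, by rintro _ ⟨i, rfl⟩; exact (hu _ ⟨i, rfl⟩).le⟩
    obtain ⟨l, hl⟩ : ∃ l, IsLUB (Set.range fun i : ℕ => g^[i] a) l :=
      ⟨_, wellFounded_lt.min_mem _ hne, fun x hx => not_lt.1 (wellFounded_lt.not_lt_min _ hx)⟩
    have hle : ∀ i, g^[i] a ≤ l := fun i => hl.1 ⟨i, rfl⟩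
    have hal : a < l := (hg a).trans_le (hle 1)
    refine ⟨l, ⟨not_isMin_iff.2 ⟨a, hal⟩, fun b hb => ?_⟩, hal.le⟩
    obtain ⟨_, ⟨i, rfl⟩, hi⟩ := (lt_isLUB_iff hl).1 hb
    have := hle (i + 1)
    rw [Function.iterate_succ_apply'] at this
    exact (hg' _ b hi.le).trans_le this

lemma countable_finset_blocksLE (b : Omega1) :
    {s : Finset Blocks | ∀ x ∈ s, blk x ≤ b}.Countable := by
  classical
  refine (Set.countable_range fun t : Finset (blocksLE b) =>
    t.map (Function.Embedding.subtype (· ∈ blocksLE b))).mono fun s hs => ?_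
  exact ⟨s.subtype (· ∈ blocksLE b), by
    beta_reduce; rw [Finset.subtype_map]; exact filter_true_of_mem hs⟩

lemma exists_blk_lt (s : Finset Blocks) : ∃ c, ∀ x ∈ s, blk x < c := by
  obtain ⟨c, hc⟩ := exists_forall_lt_omega1 (s.finite_toSet.countable.image blk)
  exact ⟨c, fun x hx => hc _ ⟨x, hx, rfl⟩⟩

lemma exists_injective_finset_blocks : ∃ j : Finset Blocks → Omega1, Function.Injective j := by
  have h1 : Cardinal.mk Blocks = Cardinal.aleph 1 := by
    rw [Cardinal.mk_congr ofLex, Cardinal.mk_prod, mk_Omega1]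
    simp
  have : Infinite Blocks := by
    rw [Cardinal.infinite_iff, h1]; exact Cardinal.aleph0_le_aleph 1
  have h2 : Cardinal.mk (Finset Blocks) ≤ Cardinal.mk Omega1 := by
    rw [Cardinal.mk_finset_of_infinite, h1, mk_Omega1]
  obtain ⟨e⟩ := Cardinal.le_def _ _ |>.1 h2
  exact ⟨e, e.injective⟩

/-- Under `◇` there is a scheme on all blocks such that every uncountable family of finite sets has
members selected by the same positions from all pieces of some set of the scheme, some of these
positions being above the root. -/
theorem exists_capturing_scheme (hD : Diamond) {m n r : ℕ → ℕ} (hT : IsSchemeType m n r) :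
    ∃ L, IsPartialScheme m n r Set.univ L ∧ ∀ D : Set (Finset Blocks), ¬ D.Countable → ∀ k₀,
      ∃ k ≥ k₀, ∃ G ∈ L (k + 1), ∃ ε ⊆ range (m k), (∃ p ∈ ε, r (k + 1) ≤ p) ∧
        ∀ v < n (k + 1), sel (pc m r k G v) ε ∈ D := by
  obtain ⟨A, -, hA⟩ := hD
  obtain ⟨j, hj⟩ := exists_injective_finset_blocks
  obtain ⟨L, hL, hP⟩ := exists_scheme_with_promises hT
    fun b => {s | (∀ x ∈ s, blk x < b) ∧ j s ∈ A b}
  refine ⟨L, hL, fun D hDc k₀ => ?_⟩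
  let P : Finset Blocks → ℕ → ℕ → Finset ℕ → Finset Blocks → Prop := fun d k M ε H =>
    H ∈ L (k + 1) ∧ rt r (k + 1) H = d ∧ ∀ v ≤ M, sel (pc m r k H v) ε ∈ D
  -- below a point closed under `h`, the codes of finite sets and the witnesses of `P` are bounded
  have hh : ∀ b : Omega1, ∃ c, (∀ s : Finset Blocks, (∀ x ∈ s, blk x ≤ b) → j s < c) ∧
      ∀ d : Finset Blocks, (∀ x ∈ d, blk x ≤ b) → ∀ k M ε, (∃ H, P d k M ε H) →
        ∃ H, P d k M ε H ∧ ∀ x ∈ H, blk x < c := by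
    intro b
    have hw : ∀ q : Finset Blocks × ℕ × ℕ × Finset ℕ, ∃ c, (∃ H, P q.1 q.2.1 q.2.2.1 q.2.2.2 H) →
        ∃ H, P q.1 q.2.1 q.2.2.1 q.2.2.2 H ∧ ∀ x ∈ H, blk x < c := by
      intro q
      by_cases hq : ∃ H, P q.1 q.2.1 q.2.2.1 q.2.2.2 H
      · obtain ⟨H, hH⟩ := hq
        obtain ⟨c, hc⟩ := exists_blk_lt H
        exact ⟨c, fun _ => ⟨H, hH, hc⟩⟩
      · exact ⟨b, fun h => absurd h hq⟩
    choose w hw using hw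
    have hcs := countable_finset_blocksLE b
    obtain ⟨c, hc⟩ := exists_forall_lt_omega1 ((hcs.image j).union
      ((hcs.prod (Set.countable_univ (α := ℕ × ℕ × Finset ℕ))).image w))
    refine ⟨c, fun s hs => hc _ (Or.inl ⟨s, hs, rfl⟩), fun d hd k M ε hH => ?_⟩
    obtain ⟨H, h1, h2⟩ := hw (d, k, M, ε) hH
    exact ⟨H, h1, fun x hx => (h2 x hx).trans
      (hc _ (Or.inr ⟨(d, k, M, ε), ⟨hd, trivial⟩, rfl⟩))⟩
  choose h hh1 hh2 using hh
  -- a point `l` at which `D` is guessed correctly and which is closed under `h`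
  obtain ⟨l, hl, hlmin, hlh⟩ := hA (j '' D) (isClub_closed_under h)
  have hfin : ∀ s : Finset Blocks, (∀ x ∈ s, blk x < l) → ∃ b < l, ∀ x ∈ s, blk x ≤ b := by
    intro s hs
    obtain ⟨a, ha⟩ := not_isMin_iff.1 hlmin
    obtain ⟨b, hb, -, h⟩ := exists_forall_blk_le s (I := Set.Iio l) ha hs
    exact ⟨b, hb, h⟩
  have hguess : ∀ s : Finset Blocks, (∀ x ∈ s, blk x < l) → (s ∈ D ↔ j s ∈ A l) := by
    intro s hs
    rw [← hl]
    obtain ⟨b, hb, hsb⟩ := hfin s hs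
    constructor
    · exact fun hsD => ⟨⟨s, hsD, rfl⟩, (hh1 b s hsb).trans (hlh b hb)⟩
    · rintro ⟨⟨s', hs', he⟩, -⟩
      rwa [← hj he]
  obtain ⟨E, hED, hEl⟩ : ∃ E ∈ D, ∃ x ∈ E, l ≤ blk x := by
    by_contra! hc
    exact hDc ((countable_finset_blocksLE l).mono fun s hs x hx => (hc s hs x hx).le)
  obtain ⟨k, hk, F, hF, G, hG, hEF, hlF, hpl, M, hMn, hGM, hsel, hmax⟩ := hP l hlmin
    (insert (elt l 0) E) (fun _ _ => trivial) E (subset_insert _ _) k₀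
  have hEF : E ⊆ F := (subset_insert _ _).trans hEF
  set ε := E.image (pos F) with hε
  have hselD : ∀ v ≤ M, sel (pc m r k G v) ε ∈ D := by
    intro v hv
    rcases hv.lt_or_eq with hv | rfl
    · have := hsel v hv
      exact (hguess _ this.1).2 this.2
    · rw [hGM, hε, sel_image_pos hEF]; exact hED
  -- otherwise a reflection of `G` below `l` contradicts the maximality of `M`
  have hMlast : M + 1 = n (k + 1) := by
    by_contra hne
    have hrt : rt r (k + 1) G = below F (elt l 0) := by
      rw [← hGM] at hlF hpl ⊢
      exact (below_pc_eq_rt hlF hpl).symm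
    have hd : ∀ x ∈ below F (elt l 0), blk x < l := fun x hx =>
      lt_elt_zero.1 (mem_below.1 hx).2
    obtain ⟨b, hb, hdb⟩ := hfin _ hd
    obtain ⟨H, ⟨hH, hHrt, hHsel⟩, hHb⟩ := hh2 b _ hdb k M ε ⟨G, hG, hrt, hselD⟩
    have hHl : ∀ x ∈ H, blk x < l := fun x hx => (hHb x hx).trans (hlh b hb)
    obtain ⟨v, hv, hbad⟩ := hmax (by omega) H hH hHl hHrt
    have hsub : ∀ x ∈ sel (pc m r k H v) ε, blk x < l := fun x hx =>
      hHl x (pc_subset (mem_sel.1 hx).1)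
    exact hbad ⟨hsub, (hguess _ hsub).1 (hHsel v hv)⟩
  refine ⟨k, hk, G, hG, ε, ?_, ?_, fun v hv => hselD v (by omega)⟩
  · intro p hp
    obtain ⟨x, hx, rfl⟩ := mem_image.1 hp
    rw [mem_range, ← hL.card k F hF]
    exact pos_lt_card (hEF hx)
  · obtain ⟨x, hx, hlx⟩ := hEl
    refine ⟨pos F x, mem_image_of_mem _ hx, ?_⟩
    rw [← hpl]
    exact pos_mono F (not_lt.1 fun hc => (lt_elt_zero.1 hc).not_ge hlx)

end

section

/-! ### The capturing construction scheme -/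

section Transport

variable {T T' : Type*} [LinearOrder T] [LinearOrder T'] (g : T ↪o T')

lemma below_map (F : Finset T) (x : T) :
    below (F.map g.toEmbedding) (g x) = (below F x).map g.toEmbedding := by
  ext y
  simp only [mem_below, mem_map, RelEmbedding.coe_toEmbedding]
  constructor
  · rintro ⟨⟨z, hz, rfl⟩, h⟩; exact ⟨z, ⟨hz, g.lt_iff_lt.1 h⟩, rfl⟩
  · rintro ⟨z, ⟨hz, h⟩, rfl⟩; exact ⟨⟨z, hz, rfl⟩, g.lt_iff_lt.2 h⟩

lemma pos_map (F : Finset T) (x : T) : pos (F.map g.toEmbedding) (g x) = pos F x := by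
  rw [pos, below_map, card_map, pos]

lemma filter_pos_map (F : Finset T) (P : ℕ → Prop) [DecidablePred P] :
    (F.map g.toEmbedding).filter (fun x => P (pos (F.map g.toEmbedding) x)) =
      (F.filter fun x => P (pos F x)).map g.toEmbedding := by
  ext y
  simp only [mem_filter, mem_map, RelEmbedding.coe_toEmbedding]
  constructor
  · rintro ⟨⟨z, hz, rfl⟩, h⟩; rw [pos_map] at h; exact ⟨z, ⟨hz, h⟩, rfl⟩
  · rintro ⟨z, ⟨hz, h⟩, rfl⟩; rw [pos_map]; exact ⟨⟨z, hz, rfl⟩, h⟩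

lemma pc_map (m r : ℕ → ℕ) (k i : ℕ) (F : Finset T) :
    pc m r k (F.map g.toEmbedding) i = (pc m r k F i).map g.toEmbedding := filter_pos_map g F _

lemma sel_map (F : Finset T) (s : Finset ℕ) :
    sel (F.map g.toEmbedding) s = (sel F s).map g.toEmbedding := filter_pos_map g F (· ∈ s)

lemma coh_map {F G : Finset T} (h : Coh F G) :
    Coh (F.map g.toEmbedding) (G.map g.toEmbedding) := by
  intro x hx hx' y hy
  obtain ⟨x, hxF, rfl⟩ := mem_map.1 hx
  have hxG : x ∈ G := by simpa using hx'
  simp only [RelEmbedding.coe_toEmbedding] at hy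
  simp only [mem_map, RelEmbedding.coe_toEmbedding]
  constructor
  · rintro ⟨z, hz, rfl⟩; exact ⟨z, (h x hxF hxG z (g.lt_iff_lt.1 hy)).1 hz, rfl⟩
  · rintro ⟨z, hz, rfl⟩; exact ⟨z, (h x hxF hxG z (g.lt_iff_lt.1 hy)).2 hz, rfl⟩

end Transport

lemma type_blocks : Ordinal.type (α := Blocks) (· < ·) = Ordinal.omega 1 := by
  have h : Ordinal.type (α := Blocks) (· < ·) = Ordinal.omega0 * Ordinal.omega 1 := by
    have := Ordinal.type_prod_lex (α := ℕ) (β := Omega1) (· < ·) (· < ·)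
    rwa [Ordinal.type_toType, Ordinal.type_nat_lt] at this
  rw [h]
  refine le_antisymm ((Ordinal.mul_le_iff_of_isSuccLimit (Cardinal.isSuccLimit_omega 1)).2
    fun b hb => ?_) (Ordinal.le_mul_right _ Ordinal.omega0_pos)
  rw [Cardinal.lt_omega_iff_card_lt, Cardinal.lt_aleph_one_iff] at hb
  refine (Cardinal.lt_omega_iff_card_lt.2 ?_).le
  rw [Cardinal.lt_aleph_one_iff, Ordinal.card_mul, Ordinal.card_omega0]
  exact (mul_le_mul' le_rfl hb).trans Cardinal.aleph0_mul_aleph0.le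

/-- The blocks, listed in increasing order, form a copy of `ω₁`. -/
def blocksIso : Blocks ≃o Omega1 := by
  have h : Ordinal.type (α := Blocks) (· < ·) = Ordinal.type (α := Omega1) (· < ·) := by
    rw [type_blocks, Ordinal.type_toType]
  exact OrderIso.ofRelIsoLT (Classical.choice (Ordinal.type_eq.1 h))

variable {m n r : ℕ → ℕ}

variable (m n r) in
/-- The combinatorial core of a capturing construction scheme: the levels of the scheme, with
canonical pieces given by positions, and the guessing property for uncountable families. -/
structure IsCapturingFamily (L : ℕ → Set (Finset Omega1)) : Prop where
  card : ∀ k, ∀ F ∈ L k, F.card = m k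
  single : ∀ x, {x} ∈ L 0
  coh : ∀ k, ∀ F ∈ L k, ∀ G ∈ L k, Coh F G
  pc_mem : ∀ k, ∀ F ∈ L (k + 1), ∀ i < n (k + 1), pc m r k F i ∈ L k
  rich : ∀ (A : Finset Omega1) (α : Omega1), ∀ k₀, ∃ k ≥ k₀, ∃ X ∈ L (k + 1),
    A ⊆ pc m r k X 0 ∧ α ∈ pc m r k X 0 ∧ pos X α = r (k + 1)
  capture : ∀ D : Set (Finset Omega1), ¬ D.Countable → ∀ k₀,
    ∃ k ≥ k₀, ∃ G ∈ L (k + 1), ∃ ε ⊆ range (m k), (∃ p ∈ ε, r (k + 1) ≤ p) ∧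
      ∀ v < n (k + 1), sel (pc m r k G v) ε ∈ D

theorem exists_isCapturingFamily (hD : Diamond) (hT : IsSchemeType m n r) :
    ∃ L, IsCapturingFamily m n r L := by
  obtain ⟨L, hL, hcap⟩ := exists_capturing_scheme hD hT
  set g : Blocks ↪o Omega1 := blocksIso.toOrderEmbedding with hg
  have hsurj : ∀ A : Finset Omega1, ∃ B : Finset Blocks, B.map g.toEmbedding = A := fun A =>
    ⟨A.map blocksIso.symm.toOrderEmbedding.toEmbedding, by
      ext x; simp [hg]⟩
  refine ⟨fun k => (fun F : Finset Blocks => F.map g.toEmbedding) '' L k, ?_, ?_, ?_, ?_, ?_, ?_⟩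
  · rintro k _ ⟨F, hF, rfl⟩
    rw [card_map, hL.card k F hF]
  · intro x
    exact ⟨{blocksIso.symm x}, hL.single _ trivial, by simp [hg]⟩
  · rintro k _ ⟨F, hF, rfl⟩ _ ⟨G, hG, rfl⟩
    exact coh_map g (hL.coh k F hF G hG)
  · rintro k _ ⟨F, hF, rfl⟩ i hi
    exact ⟨_, hL.pc_mem k F hF i hi, (pc_map g m r k i F).symm⟩
  · intro A α k₀
    obtain ⟨B, rfl⟩ := hsurj A
    obtain ⟨β, rfl⟩ : ∃ β, g β = α := blocksIso.surjective α
    obtain ⟨k, hk, X, hX, h1, h2, h3⟩ := hL.rich B (fun _ _ => trivial) β trivial k₀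
    refine ⟨k, hk, _, ⟨X, hX, rfl⟩, ?_, ?_, ?_⟩
    · simp only [pc_map]; exact map_subset_map.2 h1
    · simp only [pc_map]; exact mem_map_of_mem _ h2
    · simp only [pos_map]; exact h3
  · intro D hDc k₀
    have hD' : ¬ ((fun F : Finset Blocks => F.map g.toEmbedding) ⁻¹' D).Countable := by
      intro hc
      refine hDc ((hc.image fun F : Finset Blocks => F.map g.toEmbedding).mono fun A hA => ?_)
      obtain ⟨B, rfl⟩ := hsurj A
      exact ⟨B, hA, rfl⟩
    obtain ⟨k, hk, G, hG, ε, hε, hp, h⟩ := hcap _ hD' k₀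
    refine ⟨k, hk, _, ⟨G, hG, rfl⟩, ε, hε, hp, fun v hv => ?_⟩
    simp only [pc_map, sel_map]
    exact h v hv

/-! #### Increasing bijections -/

lemma pos_orderIsoOfFin (A : Finset Omega1) {k : ℕ} (h : A.card = k) (i : Fin k) :
    pos A (A.orderIsoOfFin h i : Omega1) = i := by
  have : below A (A.orderIsoOfFin h i) =
      (Iio i).map (A.orderEmbOfFin h).toEmbedding := by
    ext y
    simp only [mem_below, mem_map, mem_Iio, RelEmbedding.coe_toEmbedding]
    constructor
    · rintro ⟨hy, hlt⟩
      have hy' : y ∈ Set.range (A.orderEmbOfFin h) := by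
        rw [range_orderEmbOfFin]; exact hy
      obtain ⟨j, rfl⟩ := hy'
      rw [coe_orderIsoOfFin_apply] at hlt
      exact ⟨j, (A.orderEmbOfFin h).lt_iff_lt.1 hlt, rfl⟩
    · rintro ⟨j, hj, rfl⟩
      rw [coe_orderIsoOfFin_apply]
      exact ⟨orderEmbOfFin_mem A h j, (A.orderEmbOfFin h).lt_iff_lt.2 hj⟩
  rw [pos, this, card_map, Fin.card_Iio]

lemma incMap_spec {A B : Finset Omega1} (h : B.card = A.card) {x : Omega1} (hx : x ∈ A) :
    incMap A B x ∈ B ∧ pos B (incMap A B x) = pos A x := by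
  rw [incMap, dif_pos ⟨h, hx⟩]
  refine ⟨Subtype.property _, ?_⟩
  rw [pos_orderIsoOfFin]
  have := pos_orderIsoOfFin A rfl ((A.orderIsoOfFin rfl).symm ⟨x, hx⟩)
  rw [OrderIso.apply_symm_apply] at this
  exact this.symm

lemma incMap_eq {A B : Finset Omega1} (h : B.card = A.card) {x y : Omega1} (hx : x ∈ A)
    (hy : y ∈ B) (hp : pos B y = pos A x) : incMap A B x = y := by
  have := incMap_spec h hx
  exact pos_inj this.1 hy (this.2.trans hp.symm)

/-! #### The scheme -/

variable (m) in
/-- The rank of a set of the scheme, read off from its cardinality. -/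
def rankOf (F : Finset Omega1) : ℕ := sInf {k | m k = F.card}

lemma rankOf_eq (hT : IsSchemeType m n r) {F : Finset Omega1} {k : ℕ} (h : F.card = m k) :
    rankOf m F = k := by
  have : {j | m j = F.card} = {k} := by
    ext j; simp only [Set.mem_ofPred_eq, Set.mem_singleton_iff, h, (m_strictMono hT).injective.eq_iff]
  rw [rankOf, this, csInf_singleton]

namespace IsCapturingFamily

variable {L : ℕ → Set (Finset Omega1)} (hL : IsCapturingFamily m n r L)

lemma isInitialSegment_inter {F E : Finset Omega1} (h : Coh F E) : IsInitialSegment (E ∩ F) F :=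
  ⟨inter_subset_right, fun a ha b hb hba => by
    rw [mem_inter] at ha ⊢; exact ⟨(h a ha.2 ha.1 b hba).1 hb, hb⟩⟩

lemma isInitialSegment_rt (k : ℕ) (F : Finset Omega1) : IsInitialSegment (rt r k F) F :=
  ⟨filter_subset _ _, fun a ha b hb hba => by
    rw [mem_rt] at ha ⊢; exact ⟨hb, (pos_mono F hba.le).trans_lt ha.2⟩⟩

include hL

lemma biUnion_pc (hT : IsSchemeType m n r) {k : ℕ} {F : Finset Omega1} (hF : F ∈ L (k + 1)) :
    F = (range (n (k + 1))).biUnion (pc m r k F) := by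
  ext x
  simp only [mem_biUnion, mem_range]
  constructor
  · intro hx
    obtain ⟨i, hi, h⟩ := exists_mem_pc hT (hL.card _ F hF) hx
    exact ⟨i, hi, h⟩
  · rintro ⟨i, -, h⟩; exact pc_subset h

/-- The canonical decomposition is unique: a set of rank `k` included in `F` is the canonical piece
that contains its maximum, and a canonical piece is the only one to contain a given point of it
outside the root. -/
lemma eq_image_pc (hT : IsSchemeType m n r) {k : ℕ} {F : Finset Omega1} (hF : F ∈ L (k + 1))
    {P : Finset (Finset Omega1)} (hP : ∀ G ∈ P, G ∈ L k) (h : F = P.biUnion id) :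
    P = (range (n (k + 1))).image (pc m r k F) := by
  have h1 : ∀ G ∈ P, ∃ i < n (k + 1), G = pc m r k F i := by
    intro G hG
    have hne : G.Nonempty := by
      rw [← card_pos, hL.card k G (hP G hG)]; exact m_pos hT k
    have hmax := max'_mem G hne
    have hmF : G.max' hne ∈ F := by rw [h]; exact mem_biUnion.2 ⟨G, hG, hmax⟩
    obtain ⟨i, hi, hm⟩ := exists_mem_pc hT (hL.card _ F hF) hmF
    have hpc := hL.pc_mem k F hF i hi
    refine ⟨i, hi, (hL.coh k G (hP G hG) _ hpc).eq_of_max ?_ hmax hm fun y hy => le_max' G y hy⟩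
    rw [hL.card k G (hP G hG), hL.card k _ hpc]
  ext G
  rw [mem_image]
  constructor
  · intro hG
    obtain ⟨i, hi, rfl⟩ := h1 G hG
    exact ⟨i, mem_range.2 hi, rfl⟩
  · rintro ⟨i, hi, rfl⟩
    have hi := mem_range.1 hi
    have hlt : (rt r (k + 1) F).card < (pc m r k F i).card := by
      rw [card_rt hT (hL.card _ F hF), card_pc hT hi (hL.card _ F hF)]; exact hT.r_lt k
    obtain ⟨y, hy, hyr⟩ := exists_mem_notMem_of_card_lt_card hlt
    have hyF : y ∈ P.biUnion id := h ▸ pc_subset hy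
    obtain ⟨G, hG, hyG⟩ := mem_biUnion.1 hyF
    obtain ⟨i', -, rfl⟩ := h1 G hG
    by_cases hii : i = i'
    · rw [hii]; exact hG
    · exact absurd (pc_inter hii F ▸ mem_inter.2 ⟨hy, hyG⟩) hyr

/-- The construction scheme with the given levels. -/
def toScheme (hT : IsSchemeType m n r) (hr : r 0 = 0) : ConstructionScheme m n r where
  level := L
  root F := rt r (rankOf m F) F
  piece F i := pc m r (rankOf m F - 1) F i
  level_disjoint k l hkl := Set.disjoint_left.2 fun F hF hF' =>
    hkl ((m_strictMono hT).injective ((hL.card k F hF).symm.trans (hL.card l F hF')))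
  level_zero F := ⟨fun hF => card_eq_one.1 ((hL.card 0 F hF).trans hT.m_zero), by
    rintro ⟨α, rfl⟩; exact hL.single α⟩
  root_initial k F _ := isInitialSegment_rt _ F
  cofinal A := by
    obtain ⟨k, -, X, hX, h, -⟩ := hL.rich A (Classical.arbitrary _) 0
    exact ⟨k + 1, X, hX, h.trans pc_subset⟩
  card_eq := hL.card
  card_root k F hF := by
    rw [rankOf_eq hT (hL.card k F hF)]
    rcases k with _ | k
    · simp [rt, hr]
    · exact card_rt hT (hL.card _ F hF)
  inter_initial k F hF E hE := ⟨isInitialSegment_inter (hL.coh k F hF E hE), by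
    rw [inter_comm]; exact isInitialSegment_inter (hL.coh k E hE F hF)⟩
  piece_mem k F hF i hi := by
    rw [rankOf_eq hT (hL.card _ F hF)]; exact hL.pc_mem k F hF i hi
  union_piece k F hF := by
    rw [rankOf_eq hT (hL.card _ F hF)]; exact hL.biUnion_pc hT hF
  piece_unique k F hF P hP h := by
    rw [rankOf_eq hT (hL.card _ F hF)]; exact hL.eq_image_pc hT hF hP h
  piece_inter k F hF i j hij _ := by
    rw [rankOf_eq hT (hL.card _ F hF)]; exact pc_inter hij.ne F
  root_lt k F hF i _ a ha b hb := by
    rw [rankOf_eq hT (hL.card _ F hF)] at ha hb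
    rw [mem_sdiff] at hb
    exact lt_of_pos_lt ((mem_rt.1 ha).2.trans_le (le_pos_of_mem_pc_sdiff hb.1 hb.2))
  piece_lt k F hF i j hij _ a ha b hb := by
    rw [rankOf_eq hT (hL.card _ F hF)] at ha hb
    rw [mem_sdiff] at ha hb
    exact pc_lt_pc hij ha.1 hb.1 (le_pos_of_mem_pc_sdiff hb.1 hb.2)

variable (hT : IsSchemeType m n r) (hr : r 0 = 0)

lemma toScheme_root {k : ℕ} {F : Finset Omega1} (hF : F ∈ L k) :
    (hL.toScheme hT hr).root F = rt r k F := by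
  change rt r (rankOf m F) F = _
  rw [rankOf_eq hT (hL.card _ F hF)]

lemma toScheme_piece {k : ℕ} {F : Finset Omega1} (hF : F ∈ L (k + 1)) (i : ℕ) :
    (hL.toScheme hT hr).piece F i = pc m r k F i := by
  change pc m r (rankOf m F - 1) F i = _
  rw [rankOf_eq hT (hL.card _ F hF)]; rfl

theorem isCapturing_toScheme : (hL.toScheme hT hr).IsCapturing := by
  intro N D R hDR
  have hinter : ∀ a b, a ≠ b → D a ∩ D b = R := fun a b hab => by
    rcases hab.lt_or_gt with h | h
    · exact (hDR a b h).1
    · rw [inter_comm]; exact (hDR b a h).1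
  by_cases hc : {a | D a ≠ R}.Countable
  · -- all but countably many members are equal to the root
    have hinf : {a | D a = R}.Infinite := by
      intro hf
      refine not_countable (α := Omega1) (Set.countable_univ_iff.1
        ((hc.union hf.countable).mono fun a _ => ?_))
      by_cases h : D a = R
      exacts [Or.inr h, Or.inl h]
    obtain ⟨s, hs, hsN⟩ := hinf.exists_subset_card_eq N
    obtain ⟨α, hα⟩ := exists_forall_lt_omega1 R.finite_toSet.countable
    obtain ⟨k, hk, X, hX, hRX, hαX, hp⟩ := hL.rich R α N
    have hRrt : R ⊆ rt r (k + 1) X := fun x hx => mem_rt.2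
      ⟨pc_subset (hRX hx), hp ▸ pos_lt_pos (pc_subset (hRX hx)) (hα x hx)⟩
    refine ⟨k, X, hX, fun i => if h : i < N then s.orderEmbOfFin hsN ⟨i, h⟩ else α, ?_, ?_, ?_, ?_⟩
    · have := hT.lt_n (k + 1) (Nat.succ_pos k); omega
    · intro i j hij hj
      simp only [hij.trans hj, hj, dif_pos]
      exact (s.orderEmbOfFin hsN).lt_iff_lt.2 hij
    · rw [hL.toScheme_root hT hr hX]; exact hRrt
    · have hD : ∀ i, i < N →
          D (if h : i < N then s.orderEmbOfFin hsN ⟨i, h⟩ else α) = R := by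
        intro i hi
        rw [dif_pos hi]; exact hs (orderEmbOfFin_mem _ _ _)
      intro i hi
      have hkn : N < n (k + 1) := by have := hT.lt_n (k + 1) (Nat.succ_pos k); omega
      rw [hD i hi, hD 0 (by omega), hL.toScheme_piece hT hr hX, hL.toScheme_piece hT hr hX]
      refine ⟨hRrt.trans rt_subset_pc, ?_⟩
      have hid : ∀ x ∈ R, incMap (pc m r k X 0) (pc m r k X i) x = x := by
        intro x hx
        have hxr := mem_rt.1 (hRrt hx)
        refine incMap_eq ?_ (rt_subset_pc (hRrt hx)) (rt_subset_pc (hRrt hx)) ?_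
        · rw [card_pc hT (hi.trans hkn) (hL.card _ X hX),
            card_pc hT (by omega) (hL.card _ X hX)]
        · rw [pos_pc_of_lt hxr.2.le, pos_pc_of_lt hxr.2.le]
      ext x
      rw [mem_image]
      constructor
      · rintro ⟨y, hy, rfl⟩; rw [hid y hy]; exact hy
      · intro hx; exact ⟨x, hx, hid x hx⟩
  · have hinj : Set.InjOn D {a | D a ≠ R} := by
      intro a ha b _ hab
      by_contra hne
      have := hinter a b hne
      rw [← hab, inter_self] at this
      exact ha this
    have hunc : ¬ (D '' {a | D a ≠ R}).Countable := fun h => hc (Set.countable_of_injective_of_countable_image hinj h)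
    obtain ⟨k, hk, G, hG, ε, hε, ⟨p, hp, hpr⟩, hsel⟩ := hL.capture _ hunc N
    have hn := n_pos hT k
    have hkn : N < n (k + 1) := by have := hT.lt_n (k + 1) (Nat.succ_pos k); omega
    have hsel' : ∀ v, ∃ a, v < n (k + 1) → D a = sel (pc m r k G v) ε := fun v => by
      by_cases hv : v < n (k + 1)
      · obtain ⟨a, -, ha⟩ := hsel v hv; exact ⟨a, fun _ => ha⟩
      · exact ⟨Classical.arbitrary _, fun h => absurd h hv⟩
    choose a ha using hsel'
    have hcard : ∀ v < n (k + 1), (pc m r k G v).card = m k := fun v hv =>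
      card_pc hT hv (hL.card _ G hG)
    -- a point of each member above the root
    have hx : ∀ v < n (k + 1), ∃ x ∈ D (a v), x ∈ pc m r k G v ∧ x ∉ rt r (k + 1) G := by
      intro v hv
      obtain ⟨x, hx, hxp⟩ := exists_pos_eq (F := pc m r k G v) (i := p)
        (by rw [hcard v hv]; exact mem_range.1 (hε hp))
      refine ⟨x, ?_, hx, fun hxr => ?_⟩
      · rw [ha v hv, mem_sel]; exact ⟨hx, hxp ▸ hp⟩
      · have := (mem_rt.1 hxr).2
        rw [pos_pc_of_lt this.le] at hxp
        omega
    have hsub : ∀ v < n (k + 1), D (a v) ⊆ pc m r k G v := fun v hv => by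
      rw [ha v hv]; exact filter_subset _ _
    have hne : ∀ v w, v < n (k + 1) → w < n (k + 1) → v ≠ w → a v ≠ a w := by
      intro v w hv hw hvw he
      obtain ⟨x, hxD, hxp, hxr⟩ := hx v hv
      rw [he] at hxD
      exact hxr (pc_inter hvw G ▸ mem_inter.2 ⟨hxp, hsub w hw hxD⟩)
    have hR : R ⊆ rt r (k + 1) G := by
      rw [← hinter (a 0) (a 1) (hne 0 1 (by omega) hn (by omega)),
        ← pc_inter (m := m) (show (0 : ℕ) ≠ 1 by omega) G]
      exact inter_subset_inter (hsub 0 (by omega)) (hsub 1 hn)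
    refine ⟨k, G, hG, a, hkn.le, ?_, ?_, ?_⟩
    · intro v w hvw hw
      have hw := hw.trans hkn
      have hv := hvw.trans hw
      by_contra hc
      have hlt : a w < a v := (not_lt.1 hc).lt_of_ne (hne w v hw hv hvw.ne')
      obtain ⟨x, hxD, hxp, hxr⟩ := hx v hv
      obtain ⟨y, hyD, hyp, hyr⟩ := hx w hw
      have h1 := (hDR _ _ hlt).2.2 y (mem_sdiff.2 ⟨hyD, fun h => hyr (hR h)⟩) x
        (mem_sdiff.2 ⟨hxD, fun h => hxr (hR h)⟩)
      exact absurd h1 (pc_lt_pc hvw hxp hyp (le_pos_of_mem_pc_sdiff hyp hyr)).not_gt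
    · rw [hL.toScheme_root hT hr hG]; exact hR
    · intro i hi
      have hi := hi.trans hkn
      rw [hL.toScheme_piece hT hr hG, hL.toScheme_piece hT hr hG]
      refine ⟨hsub i hi, ?_⟩
      rw [ha i hi, ha 0 (by omega)]
      have hc0 : (pc m r k G i).card = (pc m r k G 0).card := by
        rw [hcard i hi, hcard 0 (by omega)]
      ext y
      simp only [mem_image, mem_sel]
      constructor
      · rintro ⟨x, ⟨hx, hxε⟩, rfl⟩
        have := incMap_spec hc0 hx
        exact ⟨this.1, this.2 ▸ hxε⟩
      · rintro ⟨hy, hyε⟩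
        obtain ⟨x, hx, hxp⟩ := exists_pos_eq (F := pc m r k G 0) (i := pos (pc m r k G i) y)
          (by rw [← hc0]; exact pos_lt_card hy)
        exact ⟨x, ⟨hx, hxp ▸ hyε⟩, incMap_eq hc0 hx hy hxp.symm⟩

end IsCapturingFamily

/-- A type with `n k = k + 2`. -/
lemma exists_isSchemeType : ∃ m n r : ℕ → ℕ, IsSchemeType m n r ∧ r 0 = 0 := by
  let r : ℕ → ℕ := fun k => (Nat.unpair (k - 1)).1
  let m : ℕ → ℕ := fun k => Nat.rec 1 (fun k mk => (k + 3) * (mk - r (k + 1)) + r (k + 1)) k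
  have hm : ∀ k, m (k + 1) = (k + 3) * (m k - r (k + 1)) + r (k + 1) := fun k => rfl
  have hr : ∀ k, r (k + 1) ≤ k := fun k => Nat.unpair_left_le k
  have hkm : ∀ k, k < m k := by
    intro k
    induction k with
    | zero => exact Nat.one_pos
    | succ k ih =>
      rw [hm]
      have := hr k
      have h2 := Nat.mul_le_mul_right (m k - r (k + 1)) (show 2 ≤ k + 3 by omega)
      omega
  refine ⟨m, fun k => k + 2, r, ⟨rfl, fun k => (hr k).trans_lt (hkm k), fun k _ => by omega,
    fun j => ?_, hm⟩, rfl⟩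
  refine Set.infinite_of_not_bddAbove fun ⟨B, hB⟩ => ?_
  have : Nat.pair j (B + 1) + 1 ≤ B := hB (show r (Nat.pair j (B + 1) + 1) = j by simp [r])
  have := Nat.right_le_pair j (B + 1)
  omega

end

section

/-! ### The norming functions as functions of positions -/

section PosFun

/-- The factor by which a norming function of the `i`-th piece is multiplied when it is copied to
the `j`-th piece. -/
def coef (ε : ℝ) (i j : ℕ) : ℝ :=
  if i = j then 1 else if j ≤ 1 ∨ 2 ≤ i then 0 else ε * (-1) ^ (i + j)

lemma coef_self (ε : ℝ) (i : ℕ) : coef ε i i = 1 := if_pos rfl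

lemma abs_coef_le {ε : ℝ} (h0 : 0 ≤ ε) {i j : ℕ} (hij : i ≠ j) : |coef ε i j| ≤ ε := by
  rw [coef, if_neg hij]
  split_ifs
  · simpa using h0
  · rw [abs_mul, abs_pow, abs_neg, abs_one, one_pow, mul_one, abs_of_nonneg h0]

lemma coef_eq_zero (ε : ℝ) {i j : ℕ} (hij : j < i) : coef ε i j = 0 := by
  rw [coef, if_neg hij.ne', if_pos (by omega)]

variable (m r : ℕ → ℕ)

/-- The position in a canonical piece corresponding to the position `a` in a set of rank `k + 1`. -/
def redPos (k a : ℕ) : ℕ :=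
  if a < r (k + 1) then a else r (k + 1) + (a - r (k + 1)) % (m k - r (k + 1))

/-- The value at the `x`-th point of the norming function of the `a`-th point of a set of
rank `k`. -/
def posFun (ε : ℝ) : ℕ → ℕ → ℕ → ℝ
  | 0, _, _ => 1
  | k + 1, a, x =>
    (if a < r (k + 1) ∨ x < r (k + 1) then 1 else
      coef ε ((a - r (k + 1)) / (m k - r (k + 1))) ((x - r (k + 1)) / (m k - r (k + 1)))) *
      posFun ε k (redPos m r k a) (redPos m r k x)

variable {m r} {n : ℕ → ℕ} (hT : IsSchemeType m n r) {ε : ℝ}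

lemma pieceEmb_lt_iff {k i q : ℕ} : pieceEmb m r k i q < r (k + 1) ↔ q < r (k + 1) := by
  unfold pieceEmb
  generalize i * (m k - r (k + 1)) = a
  split_ifs <;> omega

lemma redPos_pieceEmb {k i q : ℕ} (hq : q < m k) : redPos m r k (pieceEmb m r k i q) = q := by
  unfold redPos
  simp only [pieceEmb_lt_iff]
  unfold pieceEmb
  split_ifs with h
  · rfl
  · have : q + i * (m k - r (k + 1)) - r (k + 1) =
        (q - r (k + 1)) + i * (m k - r (k + 1)) := by omega
    rw [this, Nat.add_mul_mod_self_right, Nat.mod_eq_of_lt (by omega)]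
    omega

lemma pieceIdx_pieceEmb {k i q : ℕ} (hq : q < m k) (h : r (k + 1) ≤ q) :
    (pieceEmb m r k i q - r (k + 1)) / (m k - r (k + 1)) = i := by
  rw [pieceEmb, if_neg (not_lt.2 h)]
  have : q + i * (m k - r (k + 1)) - r (k + 1) =
      (q - r (k + 1)) + i * (m k - r (k + 1)) := by omega
  rw [this, Nat.add_mul_div_right _ _ (by omega), Nat.div_eq_of_lt (by omega), zero_add]

lemma posFun_pieceEmb {k i j q p : ℕ} (hq : q < m k) (hp : p < m k) :
    posFun m r ε (k + 1) (pieceEmb m r k i q) (pieceEmb m r k j p) =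
      (if q < r (k + 1) ∨ p < r (k + 1) then 1 else coef ε i j) * posFun m r ε k q p := by
  rw [posFun, redPos_pieceEmb hq, redPos_pieceEmb hp]
  simp only [pieceEmb_lt_iff]
  split_ifs with h
  · rfl
  · push Not at h
    rw [pieceIdx_pieceEmb hq h.1, pieceIdx_pieceEmb hp h.2]

include hT

lemma exists_eq_pieceEmb (k a : ℕ) :
    ∃ i q, q < m k ∧ a = pieceEmb m r k i q ∧ (q < r (k + 1) → i = 0) := by
  have hr := hT.r_lt k
  by_cases h : a < r (k + 1)
  · exact ⟨0, a, by omega, by rw [pieceEmb, if_pos h], fun _ => rfl⟩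
  · refine ⟨(a - r (k + 1)) / (m k - r (k + 1)),
      r (k + 1) + (a - r (k + 1)) % (m k - r (k + 1)), ?_, ?_, fun h => by omega⟩
    · have := Nat.mod_lt (a - r (k + 1)) (show 0 < m k - r (k + 1) by omega); omega
    · rw [pieceEmb, if_neg (by omega)]
      have := Nat.mod_add_div' (a - r (k + 1)) (m k - r (k + 1))
      omega

lemma posFun_self (k : ℕ) : ∀ a < m k, posFun m r ε k a a = 1 := by
  induction k with
  | zero => intro a _; rfl
  | succ k ih =>
    intro a ha
    obtain ⟨i, q, hq, rfl, -⟩ := exists_eq_pieceEmb hT k a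
    rw [posFun_pieceEmb hq hq, coef_self, ite_self, one_mul, ih q hq]

lemma posFun_eq_zero (k : ℕ) : ∀ a < m k, ∀ x < a, posFun m r ε k a x = 0 := by
  induction k with
  | zero => intro a ha x hx; rw [hT.m_zero] at ha; omega
  | succ k ih =>
    intro a ha x hx
    obtain ⟨i, q, hq, rfl, hqi⟩ := exists_eq_pieceEmb hT k a
    obtain ⟨j, p, hp, rfl, hpj⟩ := exists_eq_pieceEmb hT k x
    rw [posFun_pieceEmb hq hp]
    by_cases hpq : p < q
    · rw [ih q hq p hpq, mul_zero]
    · rw [if_neg, coef_eq_zero, zero_mul]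
      · by_contra hij
        have := Nat.mul_le_mul_right (m k - r (k + 1)) (not_lt.1 hij)
        unfold pieceEmb at hx
        split_ifs at hx <;> omega
      · unfold pieceEmb at hx
        rintro (h | h)
        · split_ifs at hx <;> omega
        · have := hqi (by omega)
          split_ifs at hx <;> omega

variable (h0 : 0 ≤ ε) (h1 : ε ≤ 1)
include h0 h1

lemma abs_posFun_le_one (k : ℕ) : ∀ a < m k, ∀ x < m k, |posFun m r ε k a x| ≤ 1 := by
  induction k with
  | zero => intro a _ x _; simp [posFun]
  | succ k ih =>
    intro a ha x hx
    obtain ⟨i, q, hq, rfl, -⟩ := exists_eq_pieceEmb hT k a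
    obtain ⟨j, p, hp, rfl, -⟩ := exists_eq_pieceEmb hT k x
    rw [posFun_pieceEmb hq hp, abs_mul]
    refine mul_le_one₀ ?_ (abs_nonneg _) (ih q hq p hp)
    split_ifs
    · simp
    · by_cases hij : i = j
      · rw [hij, coef_self]; simp
      · exact (abs_coef_le h0 hij).trans h1

lemma abs_posFun_le (k : ℕ) : ∀ a < m k, ∀ x < m k, a ≠ x → |posFun m r ε k a x| ≤ ε := by
  induction k with
  | zero => intro a ha x hx hax; rw [hT.m_zero] at ha hx; omega
  | succ k ih =>
    intro a ha x hx hax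
    obtain ⟨i, q, hq, rfl, hqi⟩ := exists_eq_pieceEmb hT k a
    obtain ⟨j, p, hp, rfl, hpj⟩ := exists_eq_pieceEmb hT k x
    rw [posFun_pieceEmb hq hp, abs_mul]
    have hle := abs_posFun_le_one hT h0 h1 k q hq p hp
    by_cases hpq : q = p
    · subst hpq
      have hij : i ≠ j := fun h => hax (by rw [h])
      rw [if_neg]
      · exact (mul_le_of_le_one_right (abs_nonneg _) hle).trans (abs_coef_le h0 hij)
      · rintro (h | h) <;> exact hij ((hqi h).trans (hpj h).symm)
    · refine (mul_le_of_le_one_left (abs_nonneg _) ?_).trans (ih q hq p hp hpq)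
      split_ifs
      · simp
      · by_cases hij : i = j
        · rw [hij, coef_self]; simp
        · exact (abs_coef_le h0 hij).trans h1

end PosFun

/-! ### Consistency of the norming functions -/

section Kernel

variable {m n r : ℕ → ℕ} {L : ℕ → Set (Finset Omega1)} (hL : IsCapturingFamily m n r L)
  (hT : IsSchemeType m n r) {ε : ℝ}

section
include hL

lemma exists_superset (F A : Finset Omega1) :
    ∃ l, ∃ G ∈ L l, F ⊆ G ∧ A ⊆ G := by
  obtain ⟨l, -, X, hX, h, -⟩ := hL.rich (F ∪ A) (Classical.arbitrary _) 0
  have h := h.trans pc_subset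
  exact ⟨l + 1, X, hX, subset_union_left.trans h, subset_union_right.trans h⟩

lemma pos_lt_of_mem {k : ℕ} {F : Finset Omega1} (hF : F ∈ L k) {x : Omega1} (hx : x ∈ F) :
    pos F x < m k := hL.card k F hF ▸ pos_lt_card hx

lemma exists_level_mem (A : Finset Omega1) : ∃ p : ℕ × Finset Omega1, p.2 ∈ L p.1 ∧ A ⊆ p.2 := by
  obtain ⟨l, -, X, hX, h, -⟩ := hL.rich A (Classical.arbitrary _) 0
  exact ⟨(l + 1, X), hX, h.trans pc_subset⟩

include hT

/-- Among the sets of the scheme, inclusion means being an iterated canonical piece. -/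
lemma pieceOf_of_subset {k l : ℕ} {F G : Finset Omega1} (hF : F ∈ L k) (hG : G ∈ L l)
    (h : F ⊆ G) : PieceOf m n r G l k F := by
  have hkl : k ≤ l := by
    have := card_le_card h
    rw [hL.card k F hF, hL.card l G hG] at this
    exact (m_strictMono hT).le_iff_le.1 this
  have hne : F.Nonempty := by rw [← card_pos, hL.card k F hF]; exact m_pos hT k
  have hmax := max'_mem F hne
  obtain ⟨E, h1, h2, h3⟩ := exists_pieceOf hT (hL.card l G hG) hkl (h hmax)
  have hE := h1.mem hL.pc_mem hG
  rwa [(hL.coh k F hF E hE).eq_of_max (by rw [hL.card k F hF, h3]) hmax h2 fun y hy =>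
    le_max' F y hy]

lemma exists_restrict_pc (h0 : 0 ≤ ε) (h1 : ε ≤ 1) {k i : ℕ} {G : Finset Omega1}
    (hG : G ∈ L (k + 1)) (hi : i < n (k + 1)) {α : Omega1} (hα : α ∈ G) :
    ∃ β ∈ pc m r k G i, ∃ c : ℝ, |c| ≤ 1 ∧ (α ∈ pc m r k G i → β = α ∧ c = 1) ∧
      ∀ ξ ∈ pc m r k G i, posFun m r ε (k + 1) (pos G α) (pos G ξ) =
        c * posFun m r ε k (pos (pc m r k G i) β) (pos (pc m r k G i) ξ) := by
  have hGi := hL.pc_mem k G hG i hi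
  by_cases hαi : α ∈ pc m r k G i
  · refine ⟨α, hαi, 1, by simp, fun _ => ⟨rfl, rfl⟩, fun ξ hξ => ?_⟩
    rw [pos_eq_pieceEmb hαi, pos_eq_pieceEmb hξ,
      posFun_pieceEmb (pos_lt_of_mem hL hGi hαi) (pos_lt_of_mem hL hGi hξ), coef_self,
      ite_self]
  · obtain ⟨j, hj, hαj⟩ := exists_mem_pc hT (hL.card _ G hG) hα
    have hij : j ≠ i := fun h => hαi (h ▸ hαj)
    have hq := pos_lt_of_mem hL (hL.pc_mem k G hG j hj) hαj
    have hqr : r (k + 1) ≤ pos (pc m r k G j) α := by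
      by_contra hc
      refine hαi (rt_subset_pc (mem_rt.2 ⟨hα, ?_⟩))
      rw [pos_eq_pieceEmb hαj, pieceEmb_lt_iff]; exact not_le.1 hc
    obtain ⟨β, hβ, hβq⟩ := exists_pos_eq (F := pc m r k G i) (i := pos (pc m r k G j) α)
      (by rw [hL.card k _ hGi]; exact hq)
    refine ⟨β, hβ, coef ε j i, (abs_coef_le h0 hij).trans h1, fun h => absurd h hαi, fun ξ hξ => ?_⟩
    have hp := pos_lt_of_mem hL hGi hξ
    rw [pos_eq_pieceEmb hαj, pos_eq_pieceEmb hξ, posFun_pieceEmb hq hp, hβq]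
    by_cases hpr : pos (pc m r k G i) ξ < r (k + 1)
    · rw [posFun_eq_zero hT k _ hq _ (hpr.trans_le hqr), mul_zero, mul_zero]
    · rw [if_neg (by omega)]

/-- The restriction of a norming function to a smaller set of the scheme is a multiple, by a factor
of modulus at most one, of a norming function of the smaller set. -/
lemma exists_restrict (h0 : 0 ≤ ε) (h1 : ε ≤ 1) {k l : ℕ} {F G : Finset Omega1} (hF : F ∈ L k)
    (hG : G ∈ L l) (hFG : F ⊆ G) {α : Omega1} (hα : α ∈ G) :
    ∃ β ∈ F, ∃ c : ℝ, |c| ≤ 1 ∧ (α ∈ F → β = α ∧ c = 1) ∧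
      ∀ ξ ∈ F, posFun m r ε l (pos G α) (pos G ξ) =
        c * posFun m r ε k (pos F β) (pos F ξ) := by
  have h := pieceOf_of_subset hL hT hF hG hFG
  clear hFG hF
  induction h with
  | refl => exact ⟨α, hα, 1, by simp, fun _ => ⟨rfl, rfl⟩, fun ξ _ => (one_mul _).symm⟩
  | step k F i hF hi ih =>
    obtain ⟨β, hβ, c, hc, hβα, heq⟩ := ih
    obtain ⟨β', hβ', c', hc', hβα', heq'⟩ := exists_restrict_pc hL hT h0 h1
      (hF.mem hL.pc_mem hG) hi hβ
    refine ⟨β', hβ', c * c', ?_, fun h => ?_, fun ξ hξ => ?_⟩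
    · rw [abs_mul]; exact mul_le_one₀ hc (abs_nonneg _) hc'
    · obtain ⟨rfl, rfl⟩ := hβα (pc_subset h)
      obtain ⟨h2, rfl⟩ := hβα' h
      exact ⟨h2, one_mul 1⟩
    · rw [heq ξ (pc_subset hξ), heq' ξ hξ, mul_assoc]

end

variable (ε) in
/-- The common value `h_α(ξ)` of the norming functions `h_α^F`. -/
def ker (α ξ : Omega1) : ℝ :=
  let p := (exists_level_mem hL {α, ξ}).choose
  posFun m r ε p.1 (pos p.2 α) (pos p.2 ξ)

variable (h0 : 0 ≤ ε) (h1 : ε ≤ 1)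
include hT h0 h1

lemma ker_eq {k : ℕ} {F : Finset Omega1} (hF : F ∈ L k) {α ξ : Omega1} (hα : α ∈ F) (hξ : ξ ∈ F) :
    ker hL ε α ξ = posFun m r ε k (pos F α) (pos F ξ) := by
  have hp := (exists_level_mem hL {α, ξ}).choose_spec
  set p := (exists_level_mem hL {α, ξ}).choose with hpdef
  have hαp : α ∈ p.2 := hp.2 (by simp)
  have hξp : ξ ∈ p.2 := hp.2 (by simp)
  have hker : ker hL ε α ξ = posFun m r ε p.1 (pos p.2 α) (pos p.2 ξ) := rfl
  obtain ⟨l, G, hG, h2, h3⟩ := exists_superset hL F p.2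
  obtain ⟨β, -, c, -, h4, h5⟩ := exists_restrict hL hT h0 h1 hF hG h2 (h2 hα)
  obtain ⟨β', -, c', -, h4', h5'⟩ := exists_restrict hL hT h0 h1 hp.1 hG h3 (h3 hαp)
  obtain ⟨rfl, rfl⟩ := h4 hα
  obtain ⟨rfl, rfl⟩ := h4' hαp
  rw [hker, ← one_mul (posFun m r ε p.1 _ _), ← h5' ξ hξp, h5 ξ hξ, one_mul]

lemma ker_self (α : Omega1) : ker hL ε α α = 1 := by
  obtain ⟨⟨k, F⟩, hF, h⟩ := exists_level_mem hL {α}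
  have hα : α ∈ F := h (by simp)
  rw [ker_eq hL hT h0 h1 hF hα hα, posFun_self hT k _ (pos_lt_of_mem hL hF hα)]

lemma ker_eq_zero {α ξ : Omega1} (h : ξ < α) : ker hL ε α ξ = 0 := by
  obtain ⟨⟨k, F⟩, hF, hA⟩ := exists_level_mem hL {α, ξ}
  have hα : α ∈ F := hA (by simp)
  have hξ : ξ ∈ F := hA (by simp)
  rw [ker_eq hL hT h0 h1 hF hα hξ, posFun_eq_zero hT k _ (pos_lt_of_mem hL hF hα) _
    (pos_lt_pos hξ h)]

lemma abs_ker_le_one (α ξ : Omega1) : |ker hL ε α ξ| ≤ 1 := by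
  obtain ⟨⟨k, F⟩, hF, hA⟩ := exists_level_mem hL {α, ξ}
  have hα : α ∈ F := hA (by simp)
  have hξ : ξ ∈ F := hA (by simp)
  rw [ker_eq hL hT h0 h1 hF hα hξ]
  exact abs_posFun_le_one hT h0 h1 k _ (pos_lt_of_mem hL hF hα) _ (pos_lt_of_mem hL hF hξ)

lemma abs_ker_le {α ξ : Omega1} (h : α ≠ ξ) : |ker hL ε α ξ| ≤ ε := by
  obtain ⟨⟨k, F⟩, hF, hA⟩ := exists_level_mem hL {α, ξ}
  have hα : α ∈ F := hA (by simp)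
  have hξ : ξ ∈ F := hA (by simp)
  rw [ker_eq hL hT h0 h1 hF hα hξ]
  exact abs_posFun_le hT h0 h1 k _ (pos_lt_of_mem hL hF hα) _ (pos_lt_of_mem hL hF hξ)
    fun he => h (pos_inj hα hξ he)

/-- On a given set of the scheme every norming function is dominated by one of that set. -/
lemma exists_ker_restrict {k : ℕ} {F : Finset Omega1} (hF : F ∈ L k) (α : Omega1) :
    ∃ β ∈ F, ∃ c : ℝ, |c| ≤ 1 ∧ ∀ ξ ∈ F, ker hL ε α ξ = c * ker hL ε β ξ := by
  obtain ⟨l, G, hG, h2, h3⟩ := exists_superset hL F {α}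
  have hα : α ∈ G := h3 (by simp)
  obtain ⟨β, hβ, c, hc, -, h5⟩ := exists_restrict hL hT h0 h1 hF hG h2 hα
  refine ⟨β, hβ, c, hc, fun ξ hξ => ?_⟩
  rw [ker_eq hL hT h0 h1 hG hα (h2 hξ), h5 ξ hξ, ker_eq hL hT h0 h1 hF hβ hξ]

end Kernel

end

section

variable {m n r : ℕ → ℕ} {L : ℕ → Set (Finset Omega1)}

/-! ### The norming functions of the scheme -/

lemma restr_pushFwd_apply (u : Omega1 → ℝ) {A B : Finset Omega1} {ξ : Omega1} :
    restr (B \ A) (pushFwd A B u) ξ = if ξ ∈ B ∧ ξ ∉ A then u (incMap B A ξ) else 0 := by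
  unfold restr pushFwd
  by_cases h1 : ξ ∈ B <;> by_cases h2 : ξ ∈ A <;> simp [h1, h2]

lemma mem_pc_iff_eq {k i j : ℕ} {F : Finset Omega1} {ξ : Omega1} (hξ : ξ ∈ pc m r k F j)
    (h : ξ ∉ rt r (k + 1) F) : ξ ∈ pc m r k F i ↔ i = j := by
  refine ⟨fun h' => ?_, fun h => h ▸ hξ⟩
  by_contra hij
  exact h (pc_inter hij F ▸ mem_inter.2 ⟨h', hξ⟩)

/-- The part of an amalgamated function that consists of scaled copies. -/
lemma sum_copies {k : ℕ} {F : Finset Omega1} (N s : ℕ) (c : ℕ → ℝ)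
    (u : Omega1 → ℝ) {j : ℕ} (hj : j < N) {ξ : Omega1} (hξ : ξ ∈ pc m r k F j) :
    ∑ i ∈ Ico s N, c i *
        restr (pc m r k F i \ pc m r k F 0) (pushFwd (pc m r k F 0) (pc m r k F i) u) ξ =
      if ξ ∈ pc m r k F 0 then 0 else
        if s ≤ j then c j * u (incMap (pc m r k F j) (pc m r k F 0) ξ) else 0 := by
  simp only [restr_pushFwd_apply]
  by_cases h0 : ξ ∈ pc m r k F 0
  · simp [h0]
  · have hi : ∀ i, ξ ∈ pc m r k F i ↔ i = j := fun i =>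
      mem_pc_iff_eq hξ fun h => h0 (rt_subset_pc h)
    simp only [h0, hi, not_false_eq_true, and_true, if_false, mul_ite, mul_zero]
    rw [Finset.sum_ite_eq']
    simp [hj]

lemma sum_copies_of_notMem {k : ℕ} {F : Finset Omega1} (N s : ℕ) (c : ℕ → ℝ)
    (u : Omega1 → ℝ) {ξ : Omega1} (hξ : ξ ∉ F) :
    ∑ i ∈ Ico s N, c i *
        restr (pc m r k F i \ pc m r k F 0) (pushFwd (pc m r k F 0) (pc m r k F i) u) ξ = 0 := by
  refine sum_eq_zero fun i _ => ?_
  rw [restr_pushFwd_apply, if_neg fun h => hξ (pc_subset h.1), mul_zero]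

variable (hL : IsCapturingFamily m n r L) (hT : IsSchemeType m n r) (hr : r 0 = 0) {ε : ℝ}

/-- The norming functions depend only on positions: the amalgamation is given by `posFun`. -/
theorem normFun_eq (k : ℕ) : ∀ F ∈ L k, ∀ α ∈ F, ∀ ξ,
    (hL.toScheme hT hr).normFun ε k F α ξ =
      if ξ ∈ F then posFun m r ε k (pos F α) (pos F ξ) else 0 := by
  induction k with
  | zero =>
    intro F hF α hα ξ
    obtain ⟨β, rfl⟩ := ((hL.toScheme hT hr).level_zero F).1 hF
    obtain rfl := mem_singleton.1 hα
    simp [ConstructionScheme.normFun, posFun, Pi.single_apply]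
  | succ k ih =>
    intro F hF α hα ξ
    have hP := hL.pc_mem k F hF
    have hn := n_pos hT k
    have hposlt : ∀ i < n (k + 1), ∀ x ∈ pc m r k F i, pos (pc m r k F i) x < m k :=
      fun i hi x hx => pos_lt_of_mem hL (hP i hi) hx
    have hrt : ∀ {i : ℕ} {x : Omega1}, x ∈ pc m r k F i →
        (x ∈ rt r (k + 1) F ↔ pos (pc m r k F i) x < r (k + 1)) := fun {i x} hx => by
      rw [mem_rt, pos_eq_pieceEmb hx, pieceEmb_lt_iff]
      exact and_iff_right (pc_subset hx)
    have hcard : ∀ i < n (k + 1), ∀ j < n (k + 1),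
        (pc m r k F i).card = (pc m r k F j).card := fun i hi j hj => by
      rw [hL.card k _ (hP i hi), hL.card k _ (hP j hj)]
    rw [ConstructionScheme.normFun, ConstructionScheme.amalgamate]
    simp only [hL.toScheme_root hT hr hF, hL.toScheme_piece hT hr hF]
    -- the value of a copy at `ξ`
    have hcopy : ∀ i < n (k + 1), ∀ j < n (k + 1), ∀ β ∈ pc m r k F i, ∀ x ∈ pc m r k F j,
        (hL.toScheme hT hr).normFun ε k (pc m r k F i) β (incMap (pc m r k F j) (pc m r k F i) x) =
          posFun m r ε k (pos (pc m r k F i) β) (pos (pc m r k F j) x) := by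
      intro i hi j hj β hβ x hx
      have := incMap_spec (hcard i hi j hj) hx
      rw [ih _ (hP i hi) β hβ, if_pos this.1, this.2]
    have h0 : 0 < n (k + 1) := by omega
    by_cases hξ : ξ ∈ F
    swap
    · have hξi : ∀ i, ξ ∉ pc m r k F i := fun i h => hξ (pc_subset h)
      have hz : ∀ i < n (k + 1), ∀ β ∈ pc m r k F i,
          (hL.toScheme hT hr).normFun ε k (pc m r k F i) β ξ = 0 := fun i hi β hβ => by
        rw [ih _ (hP i hi) β hβ, if_neg (hξi i)]
      have hs1 := fun u => sum_copies_of_notMem (m := m) (r := r) (k := k) (n (k + 1)) 1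
        (fun _ => 1) u hξ
      have hs2 := fun c u => sum_copies_of_notMem (m := m) (r := r) (k := k) (n (k + 1)) 2
        c u hξ
      simp only [one_mul] at hs1
      rw [if_neg hξ]
      split_ifs with h1 h2 h3
      · simp only [Pi.add_apply, Finset.sum_apply, hs1, hz 0 h0 α (rt_subset_pc h1), add_zero]
      · simp only [Pi.add_apply, Pi.smul_apply, smul_eq_mul, Finset.sum_apply, hs2, hz 0 h0 α h2,
          mul_zero, add_zero]
      · simp only [Pi.add_apply, Pi.smul_apply, smul_eq_mul, Finset.sum_apply, hs2, mul_zero,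
          add_zero, pushFwd, if_neg (hξi 1)]
      · rw [Finset.sum_apply]
        refine sum_eq_zero fun j hj => ?_
        split_ifs with h4
        · exact hz j (mem_Ico.1 hj).2 α h4
        · rfl
    rw [if_pos hξ]
    -- the piece of `ξ`, the initial one if possible
    obtain ⟨j, hj, hξj, hj0⟩ : ∃ j < n (k + 1), ξ ∈ pc m r k F j ∧ (ξ ∈ pc m r k F 0 → j = 0) := by
      by_cases h : ξ ∈ pc m r k F 0
      · exact ⟨0, h0, h, fun _ => rfl⟩
      · obtain ⟨j, hj, h'⟩ := exists_mem_pc hT (hL.card _ F hF) hξ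
        exact ⟨j, hj, h', fun h'' => absurd h'' h⟩
    have hs1 := fun u => sum_copies (n (k + 1)) 1 (fun _ => 1) u hj hξj
    have hs2 := fun c u => sum_copies (n (k + 1)) 2 c u hj hξj
    simp only [one_mul] at hs1
    have hp := hposlt j hj ξ hξj
    have hval : ∀ {i : ℕ} {β : Omega1}, i < n (k + 1) → β ∈ pc m r k F i →
        posFun m r ε (k + 1) (pos F β) (pos F ξ) =
          (if pos (pc m r k F i) β < r (k + 1) ∨ pos (pc m r k F j) ξ < r (k + 1) then 1
            else coef ε i j) *
            posFun m r ε k (pos (pc m r k F i) β) (pos (pc m r k F j) ξ) := fun {i β} hi hβ => by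
      rw [pos_eq_pieceEmb hβ, pos_eq_pieceEmb hξj, posFun_pieceEmb (hposlt i hi β hβ) hp]
    have hξ0 : ξ ∉ pc m r k F 0 → ¬ pos (pc m r k F j) ξ < r (k + 1) := fun h h' =>
      h (rt_subset_pc ((hrt hξj).2 h'))
    split_ifs with h1 h2 h3
    · have hα0 : α ∈ pc m r k F 0 := rt_subset_pc h1
      rw [hval h0 hα0, if_pos (Or.inl ((hrt hα0).1 h1)), one_mul, Pi.add_apply, Finset.sum_apply,
        hs1, ih _ (hP 0 h0) α hα0]
      by_cases hξ0' : ξ ∈ pc m r k F 0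
      · obtain rfl := hj0 hξ0'
        rw [if_pos hξ0', if_pos hξ0', add_zero]
      · have hj1 : 1 ≤ j := by
          by_contra hc
          have : j = 0 := by omega
          exact hξ0' (this ▸ hξj)
        rw [if_neg hξ0', if_neg hξ0', if_pos hj1, hcopy 0 h0 j hj α hα0 ξ hξj, zero_add]
    · have hq : ¬ pos (pc m r k F 0) α < r (k + 1) := fun h => h1 ((hrt h2).2 h)
      simp only [hval h0 h2, hq, false_or, Pi.add_apply, Pi.smul_apply, smul_eq_mul,
        Finset.sum_apply, hs2]
      by_cases hξ0' : ξ ∈ pc m r k F 0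
      · obtain rfl := hj0 hξ0'
        rw [ih _ (hP 0 h0) α h2]
        simp [hξ0', coef_self]
      · have hj1 : j ≠ 0 := fun h => hξ0' (h ▸ hξj)
        rw [if_neg hξ0', if_neg (hξ0 hξ0'), hcopy 0 h0 j hj α h2 ξ hξj,
          ih _ (hP 0 h0) α h2, if_neg hξ0', coef, if_neg hj1.symm]
        by_cases hj2 : 2 ≤ j
        · rw [if_pos hj2, if_neg (by omega)]; simp only [zero_add]; ring
        · rw [if_neg hj2, if_pos (by omega)]; simp
    · have hq : ¬ pos (pc m r k F 1) α < r (k + 1) := fun h => h1 ((hrt h3).2 h)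
      have hα' := incMap_spec (hcard 0 h0 1 hn) h3
      simp only [hval hn h3, hq, false_or, Pi.add_apply, Pi.smul_apply, smul_eq_mul,
        Finset.sum_apply, hs2, pushFwd]
      by_cases hξ0' : ξ ∈ pc m r k F 0
      · obtain rfl := hj0 hξ0'
        rw [if_pos hξ0', mul_zero, add_zero]
        by_cases hξ1 : ξ ∈ pc m r k F 1
        · have hξr : ξ ∈ rt r (k + 1) F := by
            rw [← pc_inter (m := m) (show (0 : ℕ) ≠ 1 by omega) F]; exact mem_inter.2 ⟨hξ0', hξ1⟩
          have hξr' := (mem_rt.1 hξr).2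
          rw [if_pos hξ1, if_pos ((hrt hξ0').1 hξr), one_mul, hcopy 0 h0 1 hn _ hα'.1 ξ hξ1, hα'.2,
            pos_pc_of_lt (i := 0) hξr'.le, pos_pc_of_lt (i := 1) hξr'.le]
        · rw [if_neg hξ1, if_neg, coef_eq_zero _ (by omega), zero_mul]
          exact fun h => hξ1 (rt_subset_pc ((hrt hξ0').2 h))
      · have hξr : ξ ∉ rt r (k + 1) F := fun h => hξ0' (rt_subset_pc h)
        have hj1 : j ≠ 0 := fun h => hξ0' (h ▸ hξj)
        rw [if_neg hξ0', if_neg (hξ0 hξ0')]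
        simp only [mem_pc_iff_eq hξj hξr]
        by_cases hj2 : 2 ≤ j
        · rw [if_neg (by omega), if_pos hj2, hcopy 0 h0 j hj _ hα'.1 ξ hξj, hα'.2, coef,
            if_neg (by omega), if_neg (by omega)]
          ring
        · obtain rfl : j = 1 := by omega
          rw [if_pos rfl, if_neg hj2, hcopy 0 h0 1 hn _ hα'.1 ξ hξj, hα'.2, coef_self]
          ring
    · obtain ⟨i, hi, hαi⟩ := exists_mem_pc hT (hL.card _ F hF) hα
      have hi2 : 2 ≤ i := by
        by_contra hc
        rcases (show i = 0 ∨ i = 1 by omega) with rfl | rfl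
        exacts [h2 hαi, h3 hαi]
      have hq : ¬ pos (pc m r k F i) α < r (k + 1) := fun h => h1 ((hrt hαi).2 h)
      simp only [mem_pc_iff_eq hαi h1]
      rw [Finset.sum_ite_eq', if_pos (mem_Ico.2 ⟨hi2, hi⟩), hval hi hαi, ih _ (hP i hi) α hαi]
      by_cases hξi : ξ ∈ pc m r k F i
      · rw [if_pos hξi]
        by_cases hξr : ξ ∈ rt r (k + 1) F
        · have hξr' := (mem_rt.1 hξr).2
          rw [if_pos (Or.inr ((hrt hξj).1 hξr)), one_mul, pos_pc_of_lt (i := j) hξr'.le,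
            pos_pc_of_lt (i := i) hξr'.le]
        · obtain rfl := (mem_pc_iff_eq hξj hξr).1 hξi
          rw [coef_self, ite_self, one_mul]
      · have hij : i ≠ j := fun h => hξi (h ▸ hξj)
        rw [if_neg hξi, if_neg, coef, if_neg hij, if_pos (Or.inr hi2), zero_mul]
        rintro (h | h)
        · exact hq h
        · exact hξi (rt_subset_pc ((hrt hξj).2 h))

/-! ### The norm and its completion -/

variable (h0 : 0 ≤ ε) (h1 : ε ≤ 1)

variable (ε) in
/-- The norming functional `x ↦ ⟨h_α, x⟩`. -/
def pair (α : Omega1) : (Omega1 →₀ ℝ) →ₗ[ℝ] ℝ := Finsupp.linearCombination ℝ (ker hL ε α)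

lemma pair_single (α ξ : Omega1) : pair hL ε α (Finsupp.single ξ 1) = ker hL ε α ξ := by
  simp [pair]

lemma pair_apply_of_subset (α : Omega1) {x : Omega1 →₀ ℝ} {F : Finset Omega1}
    (h : x.support ⊆ F) : pair hL ε α x = ∑ ξ ∈ F, x ξ * ker hL ε α ξ := by
  rw [pair, Finsupp.linearCombination_apply]
  exact Finsupp.sum_of_support_subset _ h _ (by simp)

variable (ε) in
/-- The norm of `x ∈ c₀₀(ω₁)`. -/
def schemeNorm (x : Omega1 →₀ ℝ) : ℝ := sSup (Set.range fun α => |pair hL ε α x|)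

include hT h0 h1

lemma exists_pair_le {k : ℕ} {F : Finset Omega1} (hF : F ∈ L k) {x : Omega1 →₀ ℝ}
    (hx : x.support ⊆ F) (α : Omega1) : ∃ β ∈ F, |pair hL ε α x| ≤ |pair hL ε β x| := by
  obtain ⟨β, hβ, c, hc, h⟩ := exists_ker_restrict hL hT h0 h1 hF α
  refine ⟨β, hβ, ?_⟩
  have : pair hL ε α x = c * pair hL ε β x := by
    rw [pair_apply_of_subset hL α hx, pair_apply_of_subset hL β hx, mul_sum]
    refine sum_congr rfl fun ξ hξ => ?_
    rw [h ξ hξ]; ring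
  rw [this, abs_mul]
  exact mul_le_of_le_one_left (abs_nonneg _) hc

lemma isGreatest_schemeNorm (x : Omega1 →₀ ℝ) :
    IsGreatest (Set.range fun α => |pair hL ε α x|) (schemeNorm hL ε x) := by
  obtain ⟨⟨k, F⟩, hF, hx⟩ := exists_level_mem hL x.support
  have hne : F.Nonempty := by rw [← card_pos, hL.card k F hF]; exact m_pos hT k
  obtain ⟨β, -, hβ⟩ := exists_max_image F (fun α => |pair hL ε α x|) hne
  have h : IsGreatest (Set.range fun α => |pair hL ε α x|) |pair hL ε β x| := by
    refine ⟨⟨β, rfl⟩, ?_⟩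
    rintro _ ⟨α, rfl⟩
    obtain ⟨γ, hγ, hle⟩ := exists_pair_le hL hT h0 h1 hF hx α
    exact hle.trans (hβ γ hγ)
  rw [schemeNorm, h.csSup_eq]
  exact h

lemma abs_pair_le (α : Omega1) (x : Omega1 →₀ ℝ) : |pair hL ε α x| ≤ schemeNorm hL ε x :=
  (isGreatest_schemeNorm hL hT h0 h1 x).2 ⟨α, rfl⟩

lemma schemeNorm_le {x : Omega1 →₀ ℝ} {c : ℝ} (h : ∀ α, |pair hL ε α x| ≤ c) :
    schemeNorm hL ε x ≤ c := by
  obtain ⟨α, hα⟩ := (isGreatest_schemeNorm hL hT h0 h1 x).1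
  exact hα ▸ h α

/-- The norm dominates the coefficient at the last point `α` of the support, because `h_α` vanishes
below `α`. -/
lemma eq_zero_of_schemeNorm {x : Omega1 →₀ ℝ} (h : schemeNorm hL ε x = 0) : x = 0 := by
  by_contra hx
  have hne : x.support.Nonempty := Finsupp.support_nonempty_iff.2 hx
  set α := x.support.max' hne with hα
  have hαx : α ∈ x.support := max'_mem _ _
  have : pair hL ε α x = x α := by
    rw [pair_apply_of_subset hL α Subset.rfl, sum_eq_single α]
    · rw [ker_self hL hT h0 h1, mul_one]
    · intro ξ hξ hne'
      rw [ker_eq_zero hL hT h0 h1 ((le_max' _ ξ hξ).lt_of_ne hne'), mul_zero]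
    · exact fun h => absurd hαx h
  have h2 := abs_pair_le hL hT h0 h1 α x
  rw [this, h] at h2
  exact Finsupp.mem_support_iff.1 hαx (abs_nonpos_iff.1 h2)

lemma normValues_eq (x : Omega1 →₀ ℝ) :
    (hL.toScheme hT hr).normValues ε x = Set.range fun α => |pair hL ε α x| := by
  have key : ∀ k, ∀ F ∈ L k, x.support ⊆ F → ∀ α ∈ F,
      (x.sum fun ξ c => (hL.toScheme hT hr).normFun ε k F α ξ * c) = pair hL ε α x := by
    intro k F hF hx α hα
    rw [pair_apply_of_subset hL α Subset.rfl, Finsupp.sum]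
    refine sum_congr rfl fun ξ hξ => ?_
    rw [normFun_eq hL hT hr k F hF α hα, if_pos (hx hξ), ker_eq hL hT h0 h1 hF hα (hx hξ), mul_comm]
  ext t
  constructor
  · rintro ⟨k, F, hF, hx, α, hα, rfl⟩
    exact ⟨α, by rw [key k F hF hx α hα]⟩
  · rintro ⟨α, rfl⟩
    obtain ⟨⟨k, F⟩, hF, hx⟩ := exists_level_mem hL (x.support ∪ {α})
    have hxF : x.support ⊆ F := subset_union_left.trans hx
    have hα : α ∈ F := hx (by simp)
    exact ⟨k, F, hF, hxF, α, hα, by rw [key k F hF hxF α hα]⟩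

omit hT h0 h1 in
lemma exists_completion {V : Type} [AddCommGroup V] [Module ℝ V] (N : V → ℝ) (hN : ∀ x, 0 ≤ N x)
    (hsmul : ∀ (c : ℝ) x, N (c • x) = |c| * N x) (hadd : ∀ x y, N (x + y) ≤ N x + N y)
    (hzero : ∀ x, N x = 0 → x = 0) :
    ∃ (X : Type) (_ : NormedAddCommGroup X) (_ : NormedSpace ℝ X) (ι : V →ₗ[ℝ] X),
      CompleteSpace X ∧ DenseRange ι ∧ ∀ x, ‖ι x‖ = N x := by
  let _ : Norm V := ⟨N⟩
  have core : NormedSpace.Core ℝ V :=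
    { norm_nonneg := hN
      norm_smul := hsmul
      norm_triangle := hadd
      norm_eq_zero_iff := fun x => ⟨hzero x, fun h => by
        have := hsmul 0 x
        rw [zero_smul, abs_zero, zero_mul] at this
        rw [h]; exact this⟩ }
  let _ : NormedAddCommGroup V := NormedAddCommGroup.ofCore core
  let _ : NormedSpace ℝ V := NormedSpace.ofCore core
  exact ⟨UniformSpace.Completion V, inferInstance, inferInstance,
    (UniformSpace.Completion.toComplL (𝕜 := ℝ) (E := V)).toLinearMap, inferInstance,
    UniformSpace.Completion.denseRange_coe, fun x => UniformSpace.Completion.norm_coe x⟩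

theorem exists_isNormCompletion :
    ∃ (X : Type) (_ : NormedAddCommGroup X) (_ : NormedSpace ℝ X) (ι : (Omega1 →₀ ℝ) →ₗ[ℝ] X),
      (hL.toScheme hT hr).IsNormCompletion ε X ι ∧ ∀ x, ‖ι x‖ = schemeNorm hL ε x := by
  have hle := abs_pair_le hL hT h0 h1
  obtain ⟨X, i1, i2, ι, hc, hd, hn⟩ := exists_completion (schemeNorm hL ε)
    (fun x => (abs_nonneg _).trans (hle (Classical.arbitrary _) x))
    (fun c x => by
      refine le_antisymm (schemeNorm_le hL hT h0 h1 fun α => ?_) ?_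
      · rw [map_smul, smul_eq_mul, abs_mul]
        exact mul_le_mul_of_nonneg_left (hle α x) (abs_nonneg _)
      · obtain ⟨α, hα⟩ := (isGreatest_schemeNorm hL hT h0 h1 x).1
        rw [← hα]
        have := hle α (c • x)
        rwa [map_smul, smul_eq_mul, abs_mul] at this)
    (fun x y => schemeNorm_le hL hT h0 h1 fun α => by
      rw [map_add]
      exact (abs_add_le _ _).trans (add_le_add (hle α x) (hle α y)))
    (fun x => eq_zero_of_schemeNorm hL hT h0 h1)
  refine ⟨X, i1, i2, ι, ⟨hc, ?_, hd, fun x => ?_⟩, hn⟩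
  · rw [injective_iff_map_eq_zero]
    intro x hx
    refine eq_zero_of_schemeNorm hL hT h0 h1 ?_
    rw [← hn, hx, norm_zero]
  · rw [normValues_eq hL hT hr h0 h1, hn]
    exact isGreatest_schemeNorm hL hT h0 h1 x

omit hT h0 h1 in
/-- A functional dominated by the norm extends to the completion (by Hahn–Banach). -/
lemma exists_dual_extension {V X : Type*} [AddCommGroup V] [Module ℝ V] [NormedAddCommGroup X]
    [NormedSpace ℝ X] {ι : V →ₗ[ℝ] X} (hι : Function.Injective ι) (φ : V →ₗ[ℝ] ℝ)
    (hφ : ∀ v, |φ v| ≤ ‖ι v‖) : ∃ f : StrongDual ℝ X, ∀ v, f (ι v) = φ v := by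
  let e := LinearEquiv.ofInjective ι hι
  let g : StrongDual ℝ (LinearMap.range ι) :=
    (φ ∘ₗ e.symm.toLinearMap).mkContinuous 1 fun y => by
      obtain ⟨v, rfl⟩ := e.surjective y
      simpa [e] using hφ v
  obtain ⟨f, hf, -⟩ := exists_extension_norm_eq (LinearMap.range ι) g
  refine ⟨f, fun v => ?_⟩
  have := hf (e v)
  rw [show ((e v : LinearMap.range ι) : X) = ι v from rfl] at this
  rw [this]
  simp [g]

theorem hasUncountableBiorthogonalSystem {X : Type} [NormedAddCommGroup X] [NormedSpace ℝ X]
    {ι : (Omega1 →₀ ℝ) →ₗ[ℝ] X} (hι : Function.Injective ι)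
    (hn : ∀ x, ‖ι x‖ = schemeNorm hL ε x) : HasUncountableBiorthogonalSystem X ε := by
  have := fun α => exists_dual_extension hι (pair hL ε α) fun x => by
    rw [hn]; exact abs_pair_le hL hT h0 h1 α x
  choose f hf using this
  refine ⟨fun α => ι (Finsupp.single α 1), f, fun α => ?_, fun α β hαβ => ?_⟩
  · rw [hf, pair_single, ker_self hL hT h0 h1]
  · rw [hf, pair_single]; exact abs_ker_le hL hT h0 h1 hαβ

end

section

variable {m n r : ℕ → ℕ} {L : ℕ → Set (Finset Omega1)} (hL : IsCapturingFamily m n r L)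
  (hT : IsSchemeType m n r) {ε : ℝ}

/-! ### Captured vectors -/

section Captured

variable {k : ℕ} {G : Finset Omega1} (hG : G ∈ L (k + 1)) {x : ℕ → Omega1 →₀ ℝ} {d : ℕ → ℝ}
  (hsupp : ∀ v < n (k + 1), (x v).support ⊆ pc m r k G v)
  (hd : ∀ v < n (k + 1), ∀ ξ ∈ pc m r k G v, x v ξ = d (pos (pc m r k G v) ξ))

variable (h0 : 0 < ε) (h1 : ε ≤ 1)
include hT hG hsupp hd h0 h1

/-- The norming functions act on vectors placed in the same way in all pieces of a set either
without distinguishing the pieces or through the factors `coef`. -/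
lemma exists_pair_captured {α : Omega1} (hα : α ∈ G) :
    ∃ i < n (k + 1), (∀ v < n (k + 1), pair hL ε α (x v) = pair hL ε α (x i)) ∨
      ∀ v < n (k + 1), pair hL ε α (x v) = coef ε i v * pair hL ε α (x i) := by
  obtain ⟨i, hi, hαi⟩ := exists_mem_pc hT (hL.card _ G hG) hα
  have hP := hL.pc_mem k G hG
  set q := pos (pc m r k G i) α with hq
  have hqm : q < m k := pos_lt_of_mem hL (hP i hi) hαi
  have key : ∀ v < n (k + 1), pair hL ε α (x v) = ∑ p ∈ range (m k),
      d p * ((if q < r (k + 1) ∨ p < r (k + 1) then 1 else coef ε i v) * posFun m r ε k q p) := by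
    intro v hv
    rw [pair_apply_of_subset hL α (hsupp v hv), ← hL.card k _ (hP v hv), ← image_pos,
      sum_image (injOn_pos _)]
    refine sum_congr rfl fun ξ hξ => ?_
    rw [hd v hv ξ hξ, ker_eq hL hT h0.le h1 hG hα (pc_subset hξ), pos_eq_pieceEmb hαi,
      pos_eq_pieceEmb hξ, posFun_pieceEmb hqm (pos_lt_of_mem hL (hP v hv) hξ)]
  refine ⟨i, hi, ?_⟩
  by_cases hqr : q < r (k + 1)
  · left
    intro v hv
    rw [key v hv, key i hi]
    simp only [hqr, true_or, if_true]
  · right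
    have hS : ∀ v < n (k + 1), pair hL ε α (x v) =
        coef ε i v * ∑ p ∈ range (m k), d p * posFun m r ε k q p := by
      intro v hv
      rw [key v hv, mul_sum]
      refine sum_congr rfl fun p _ => ?_
      by_cases hp : p < r (k + 1)
      · rw [posFun_eq_zero hT k q hqm p (by omega)]; ring
      · rw [if_neg (by omega)]; ring
    intro v hv
    rw [hS v hv, hS i hi, coef_self, one_mul]

omit hT hG hsupp hd h0 h1 in
lemma sum_neg_one_pow (M : ℕ) : ∑ v ∈ Ico 2 (2 * M + 2), (-1 : ℝ) ^ v = 0 := by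
  induction M with
  | zero => simp
  | succ M ih =>
    rw [show 2 * (M + 1) + 2 = 2 * M + 2 + 1 + 1 by ring, sum_Ico_succ_top (by omega),
      sum_Ico_succ_top (by omega), ih]
    ring

/-- The alternating combination of captured vectors has small norm. -/
lemma schemeNorm_captured {M : ℕ} (hM : 0 < M) (hMn : 2 * M + 2 ≤ n (k + 1)) {V : ℝ}
    (hV : ∀ v < n (k + 1), schemeNorm hL ε (x v) ≤ V) :
    schemeNorm hL ε (x 0 - x 1 - (1 / (2 * M * ε)) • ∑ v ∈ Ico 2 (2 * M + 2), (-1 : ℝ) ^ v • x v) ≤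
      1 / (2 * M * ε) * V := by
  have hM' : (0 : ℝ) < M := by exact_mod_cast hM
  set l := 1 / (2 * M * ε) with hl
  have hl0 : 0 < l := by positivity
  have hlM : l * (2 * M * ε) = 1 := by rw [hl]; field_simp
  set w := x 0 - x 1 - l • ∑ v ∈ Ico 2 (2 * M + 2), (-1 : ℝ) ^ v • x v with hw
  have hsuppw : w.support ⊆ G := by
    intro ξ hξ
    by_contra hξG
    have hz : ∀ v < n (k + 1), x v ξ = 0 := fun v hv => by
      by_contra hne
      exact hξG (pc_subset (hsupp v hv (Finsupp.mem_support_iff.2 hne)))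
    refine Finsupp.mem_support_iff.1 hξ ?_
    simp only [hw, Finsupp.sub_apply, Finsupp.smul_apply, Finsupp.finsetSum_apply, smul_eq_mul]
    rw [hz 0 (by omega), hz 1 (by omega), sum_eq_zero]
    · ring
    · intro v hv
      rw [hz v (by have := mem_Ico.1 hv; omega), mul_zero]
  have hV0 : 0 ≤ V := ((abs_nonneg _).trans
    (abs_pair_le hL hT h0.le h1 (Classical.arbitrary _) (x 0))).trans (hV 0 (by omega))
  refine schemeNorm_le hL hT h0.le h1 fun α' => ?_
  obtain ⟨α, hα, hle⟩ := exists_pair_le hL hT h0.le h1 hG hsuppw α'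
  refine hle.trans ?_
  have hpw : pair hL ε α w = pair hL ε α (x 0) - pair hL ε α (x 1) -
      l * ∑ v ∈ Ico 2 (2 * M + 2), (-1 : ℝ) ^ v * pair hL ε α (x v) := by
    simp only [hw, map_sub, map_smul, map_sum, smul_eq_mul]
  obtain ⟨i, hi, hcase⟩ := exists_pair_captured hL hT hG hsupp hd h0 h1 hα
  set S := pair hL ε α (x i) with hS
  have hSV : |S| ≤ V := (abs_pair_le hL hT h0.le h1 α (x i)).trans (hV i hi)
  rcases hcase with hc | hc
  · have hsum : ∑ v ∈ Ico 2 (2 * M + 2), (-1 : ℝ) ^ v * pair hL ε α (x v) = 0 := by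
      rw [sum_congr rfl fun v hv => by rw [hc v (by have := mem_Ico.1 hv; omega)], ← sum_mul,
        sum_neg_one_pow, zero_mul]
    rw [hpw, hsum, hc 0 (by omega), hc 1 (by omega)]
    simpa using by positivity
  · have hsum : ∑ v ∈ Ico 2 (2 * M + 2), (-1 : ℝ) ^ v * pair hL ε α (x v) =
        ∑ v ∈ Ico 2 (2 * M + 2), (-1 : ℝ) ^ v * (coef ε i v * S) :=
      sum_congr rfl fun v hv => by rw [hc v (by have := mem_Ico.1 hv; omega)]
    have hone : ∀ v : ℕ, ((-1 : ℝ) ^ v) * (-1) ^ v = 1 := fun v => by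
      rw [← mul_pow]; norm_num
    have hcardM : ((Ico 2 (2 * M + 2)).card : ℝ) = 2 * M := by
      rw [Nat.card_Ico]; push_cast [show 2 * M + 2 - 2 = 2 * M by omega]; ring
    rw [hpw, hsum, hc 0 (by omega), hc 1 (by omega)]
    rcases (show i = 0 ∨ i = 1 ∨ 2 ≤ i by omega) with rfl | rfl | hi2
    · have : ∑ v ∈ Ico 2 (2 * M + 2), (-1 : ℝ) ^ v * (coef ε 0 v * S) = 2 * M * ε * S := by
        rw [sum_congr rfl (g := fun _ => ε * S) fun v hv => ?_, sum_const, nsmul_eq_mul, hcardM]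
        · ring
        · have := mem_Ico.1 hv
          rw [coef, if_neg (by omega), if_neg (by omega), zero_add]
          linear_combination ε * S * hone v
      have hzero : coef ε 0 0 * S - coef ε 0 1 * S - l * (2 * M * ε * S) = 0 := by
        rw [coef_self, coef, if_neg (by omega), if_pos (by omega)]
        linear_combination -S * hlM
      rw [this, hzero, abs_zero]; positivity
    · have : ∑ v ∈ Ico 2 (2 * M + 2), (-1 : ℝ) ^ v * (coef ε 1 v * S) = -(2 * M * ε * S) := by
        rw [sum_congr rfl (g := fun _ => -(ε * S)) fun v hv => ?_, sum_const, nsmul_eq_mul, hcardM]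
        · ring
        · have := mem_Ico.1 hv
          rw [coef, if_neg (by omega), if_neg (by omega), pow_add]
          linear_combination -ε * S * hone v
      have hzero : coef ε 1 0 * S - coef ε 1 1 * S - l * (-(2 * M * ε * S)) = 0 := by
        rw [coef_self, coef_eq_zero _ (by omega)]
        linear_combination S * hlM
      rw [this, hzero, abs_zero]; positivity
    · rw [coef_eq_zero _ (by omega), coef_eq_zero _ (by omega), zero_mul, sub_zero, zero_sub,
        abs_neg, abs_mul, abs_of_pos hl0]
      refine mul_le_mul_of_nonneg_left ?_ hl0.le
      have hδ : ∀ v, (-1 : ℝ) ^ v * (coef ε i v * S) = if v = i then (-1) ^ i * S else 0 := by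
        intro v
        by_cases hvi : v = i
        · rw [hvi, coef_self, if_pos rfl, one_mul]
        · rw [coef, if_neg (Ne.symm hvi), if_pos (Or.inr hi2), if_neg hvi]; ring
      simp only [hδ, sum_ite_eq']
      split_ifs
      · rw [abs_mul, abs_pow, abs_neg, abs_one, one_pow, one_mul]; exact hSV
      · rw [abs_zero]; exact hV0

end Captured

/-! ### Rational approximations -/

/-- A rational vector as an element of `c₀₀(ω₁)`. -/
def castQ (q : Omega1 →₀ ℚ) : Omega1 →₀ ℝ := q.mapRange (fun t : ℚ => (t : ℝ)) (by simp)

@[simp] lemma castQ_apply (q : Omega1 →₀ ℚ) (ξ : Omega1) : castQ q ξ = (q ξ : ℝ) := rfl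

/-- The coefficients of a rational vector, indexed by the positions in the support. -/
def pattern (q : Omega1 →₀ ℚ) : ℕ →₀ ℚ := q.mapDomain (pos q.support)

lemma pattern_apply (q : Omega1 →₀ ℚ) {ξ : Omega1} (h : ξ ∈ q.support) :
    pattern q (pos q.support ξ) = q ξ :=
  Finsupp.mapDomain_apply' _ q Set.Subset.rfl (injOn_pos _) h

lemma eq_of_pattern {q q' : Omega1 →₀ ℚ} (hs : q.support = q'.support)
    (hp : pattern q = pattern q') : q = q' := by
  ext ξ
  by_cases h : ξ ∈ q.support
  · rw [← pattern_apply q h, hp, hs, pattern_apply q' (hs ▸ h)]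
  · rw [Finsupp.notMem_support_iff.1 h, Finsupp.notMem_support_iff.1 (hs ▸ h)]

/-- Rational vectors whose supports are selected by the same positions and whose patterns agree have
the same coefficients at corresponding places. -/
lemma castQ_eq_of_pattern {q : Omega1 →₀ ℚ} {F : Finset Omega1} {s : Finset ℕ}
    (hs : q.support = sel F s) {ξ : Omega1} (hξ : ξ ∈ F) :
    castQ q ξ = if pos F ξ ∈ s then
      ((pattern q ((range (pos F ξ)).filter (· ∈ s)).card : ℚ) : ℝ) else 0 := by
  rw [castQ_apply]
  by_cases h : pos F ξ ∈ s
  · have hmem : ξ ∈ q.support := by rw [hs]; exact mem_sel.2 ⟨hξ, h⟩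
    rw [if_pos h, ← pattern_apply q hmem, hs, sel, pos_filter_pos F (· ∈ s)]
  · have hmem : ξ ∉ q.support := by rw [hs]; exact fun h' => h (mem_sel.1 h').2
    rw [if_neg h, Finsupp.notMem_support_iff.1 hmem, Rat.cast_zero]

include hT in
lemma exists_castQ_near (h0 : 0 ≤ ε) (h1 : ε ≤ 1) {X : Type} [NormedAddCommGroup X]
    [NormedSpace ℝ X] {ι : (Omega1 →₀ ℝ) →ₗ[ℝ] X} (hd : DenseRange ι)
    (hn : ∀ x, ‖ι x‖ = schemeNorm hL ε x) (y : X) {η : ℝ} (hη : 0 < η) :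
    ∃ q, ‖ι (castQ q) - y‖ < η := by
  obtain ⟨v, hv⟩ := hd.exists_dist_lt y (half_pos hη)
  have hδ : 0 < η / (2 * (v.support.card + 1)) := by positivity
  have hw : ∀ ξ, ∃ t : ℚ, |(t : ℝ) - v ξ| < η / (2 * (v.support.card + 1)) := fun ξ => by
    obtain ⟨t, ht⟩ := exists_rat_near (v ξ) hδ
    exact ⟨t, by rwa [abs_sub_comm]⟩
  choose w hw using hw
  let q : Omega1 →₀ ℚ := Finsupp.onFinset v.support (fun ξ => if ξ ∈ v.support then w ξ else 0)
    fun ξ h => by by_contra hc; simp [hc] at h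
  have hsub : (castQ q - v).support ⊆ v.support := by
    intro ξ hξ
    by_contra hc
    refine Finsupp.mem_support_iff.1 hξ ?_
    have hvξ := Finsupp.notMem_support_iff.1 hc
    simp [q, hvξ]
  have hqv : ‖ι (castQ q) - ι v‖ ≤ η / 2 := by
    rw [← map_sub, hn]
    refine schemeNorm_le hL hT h0 h1 fun α => ?_
    rw [pair_apply_of_subset hL α hsub]
    refine (abs_sum_le_sum_abs _ _).trans ?_
    have hle : ∀ ξ ∈ v.support, |(castQ q - v) ξ * ker hL ε α ξ| ≤
        η / (2 * (v.support.card + 1)) := fun ξ hξ => by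
      rw [abs_mul]
      refine (mul_le_of_le_one_right (abs_nonneg _) (abs_ker_le_one hL hT h0 h1 α ξ)).trans ?_
      have : (castQ q - v) ξ = (w ξ : ℝ) - v ξ := by
        rw [Finsupp.sub_apply, castQ_apply]
        simp only [q, Finsupp.onFinset_apply, if_pos hξ]
      rw [this]; exact (hw ξ).le
    refine (sum_le_card_nsmul _ _ _ hle).trans ?_
    rw [nsmul_eq_mul, mul_div_assoc', div_le_div_iff₀ (by positivity) (by positivity)]
    nlinarith
  refine ⟨q, ?_⟩
  calc ‖ι (castQ q) - y‖ = ‖(ι (castQ q) - ι v) + (ι v - y)‖ := by congr 1; abel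
    _ ≤ ‖ι (castQ q) - ι v‖ + ‖ι v - y‖ := norm_add_le _ _
    _ < η / 2 + η / 2 := add_lt_add_of_le_of_lt hqv (by rwa [← dist_eq_norm, dist_comm])
    _ = η := add_halves η

/-! ### Absence of biorthogonal systems -/

lemma exists_fiber_not_countable {β : Type*} [Countable β] {A : Set Omega1} (hA : ¬ A.Countable)
    (g : Omega1 → β) : ∃ c, ¬ {α ∈ A | g α = c}.Countable := by
  by_contra! h
  refine hA ((Set.countable_iUnion h).mono fun α hα => ?_)
  exact Set.mem_iUnion.2 ⟨g α, hα, rfl⟩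

include hT in
/-- A `τ`-biorthogonal system with `τ < ε / (1 + ε)` is countable: the functional at the first of the
captured vectors is bounded below on their alternating combination, whose norm is small. -/
theorem not_hasUncountableBiorthogonalSystem (h0 : 0 < ε) (h1 : ε ≤ 1) {X : Type}
    [NormedAddCommGroup X] [NormedSpace ℝ X] {ι : (Omega1 →₀ ℝ) →ₗ[ℝ] X} (hd : DenseRange ι)
    (hn : ∀ x, ‖ι x‖ = schemeNorm hL ε x) {τ : ℝ} (hτ0 : 0 ≤ τ) (hτ : τ < ε / (1 + ε)) :
    ¬ HasUncountableBiorthogonalSystem X τ := by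
  rintro ⟨y, f, hf1, hf2⟩
  obtain ⟨δ, hδ⟩ : ∃ δ, δ = 1 - τ - τ / ε := ⟨_, rfl⟩
  have hδ0 : 0 < δ := by
    rw [lt_div_iff₀ (by positivity)] at hτ
    have : τ / ε < 1 - τ := by rw [div_lt_iff₀ h0]; nlinarith
    linarith
  -- bound the functionals and the vectors on an uncountable set
  obtain ⟨K, hK⟩ : ∃ K : ℕ, ¬ {α | ‖f α‖ ≤ K ∧ ‖y α‖ ≤ K}.Countable := by
    obtain ⟨K, hK⟩ := exists_fiber_not_countable (A := Set.univ)
      (fun h => not_countable (α := Omega1) (Set.countable_univ_iff.1 h))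
      fun α => ⌈max ‖f α‖ ‖y α‖⌉₊
    refine ⟨K, fun h => hK (h.mono ?_)⟩
    rintro α ⟨-, rfl⟩
    have := Nat.le_ceil (max ‖f α‖ ‖y α‖)
    exact ⟨(le_max_left _ _).trans this, (le_max_right _ _).trans this⟩
  obtain ⟨C, hC⟩ : ∃ C : ℝ, C = K + 1 := ⟨_, rfl⟩
  have hC1 : 1 ≤ C := by rw [hC]; have := Nat.cast_nonneg (α := ℝ) K; linarith
  obtain ⟨η, hη0, hη1, hηδ⟩ : ∃ η, 0 < η ∧ η ≤ 1 ∧ C * η * (2 + 1 / ε) ≤ δ / 2 := by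
    have hpos : 0 < C * (2 + 1 / ε) := by positivity
    refine ⟨min 1 (δ / 2 / (C * (2 + 1 / ε))), lt_min one_pos (by positivity), min_le_left _ _, ?_⟩
    have := min_le_right 1 (δ / 2 / (C * (2 + 1 / ε)))
    rw [le_div_iff₀ hpos] at this
    linarith
  have hCη : C * η * (1 / ε) ≥ 0 := by positivity
  choose q hq using fun α => exists_castQ_near hL hT h0.le h1 hd hn (y α) hη0
  obtain ⟨c, hc⟩ := exists_fiber_not_countable hK fun α => pattern (q α)
  set A := {α ∈ {α | ‖f α‖ ≤ K ∧ ‖y α‖ ≤ K} | pattern (q α) = c} with hA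
  have hfA : ∀ α ∈ A, ∀ v, |f α v| ≤ C * ‖v‖ := fun α hα v => by
    refine ((f α).le_opNorm v).trans (mul_le_mul_of_nonneg_right ?_ (norm_nonneg _))
    rw [hC]; linarith [hα.1.1]
  have hinj : Set.InjOn (fun α => (q α).support) A := by
    intro α hα β hβ hs
    by_contra hne
    have hqq : q α = q β := eq_of_pattern hs (hα.2.trans hβ.2.symm)
    have hy : ‖y α - y β‖ ≤ 2 * η := by
      calc ‖y α - y β‖ = ‖(ι (castQ (q β)) - y β) - (ι (castQ (q α)) - y α)‖ := by
            rw [hqq]; congr 1; abel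
        _ ≤ ‖ι (castQ (q β)) - y β‖ + ‖ι (castQ (q α)) - y α‖ := norm_sub_le _ _
        _ ≤ 2 * η := by linarith [hq α, hq β]
    have h2 := hfA α hα (y α - y β)
    rw [map_sub, hf1] at h2
    have h3 := (abs_le.1 (hf2 α β hne)).2
    have h4 : C * ‖y α - y β‖ ≤ C * (2 * η) := mul_le_mul_of_nonneg_left hy (by linarith)
    have h5 := le_abs_self (1 - f α (y β))
    have h6 : 0 ≤ τ / ε := by positivity
    nlinarith
  have hunc : ¬ ((fun α => (q α).support) '' A).Countable := fun h =>
    hc (Set.countable_of_injective_of_countable_image hinj h)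
  obtain ⟨M, hM⟩ := exists_nat_gt (C * (C + 1) / (δ * ε))
  have hM0' : (0 : ℝ) < M := lt_trans (by positivity) hM
  have hM0 : 0 < M := by exact_mod_cast hM0'
  obtain ⟨k, hk, G, hG, s, hs, ⟨p, hps, hpr⟩, hsel⟩ := hL.capture _ hunc (2 * M + 2)
  have hMn : 2 * M + 2 ≤ n (k + 1) := by
    have := hT.lt_n (k + 1) (Nat.succ_pos k); omega
  have hsel' : ∀ v, ∃ a, v < n (k + 1) → a ∈ A ∧ (q a).support = sel (pc m r k G v) s := fun v => by
    by_cases hv : v < n (k + 1)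
    · obtain ⟨a, ha⟩ := hsel v hv; exact ⟨a, fun _ => ha⟩
    · exact ⟨Classical.arbitrary _, fun h => absurd h hv⟩
  choose a ha using hsel'
  -- the position `p` above the root makes the captured members different
  have ha0 : ∀ v < n (k + 1), v ≠ 0 → a 0 ≠ a v := by
    intro v hv hv0 he
    have hlt : p < (pc m r k G 0).card := by
      rw [hL.card k _ (hL.pc_mem k G hG 0 (by omega))]; exact mem_range.1 (hs hps)
    obtain ⟨ξ, hξ, hξp⟩ := exists_pos_eq hlt
    have hξ0 : ξ ∈ (q (a 0)).support := by
      rw [(ha 0 (by omega)).2]; exact mem_sel.2 ⟨hξ, hξp ▸ hps⟩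
    rw [he, (ha v hv).2] at hξ0
    have hξr : ξ ∈ rt r (k + 1) G :=
      pc_inter (m := m) (Ne.symm hv0) G ▸ mem_inter.2 ⟨hξ, (mem_sel.1 hξ0).1⟩
    have := (mem_rt.1 hξr).2
    rw [pos_pc_of_lt this.le] at hξp
    omega
  set x : ℕ → Omega1 →₀ ℝ := fun v => castQ (q (a v)) with hx
  have hnear : ∀ v, ‖ι (x v) - y (a v)‖ < η := fun v => hq (a v)
  have hsmall := schemeNorm_captured hL hT hG (x := x)
    (d := fun p => if p ∈ s then ((c ((range p).filter (· ∈ s)).card : ℚ) : ℝ) else 0)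
    (fun v hv ξ hξ => by
      have hξ' : ξ ∈ (q (a v)).support := by
        rw [Finsupp.mem_support_iff] at hξ ⊢
        intro h; exact hξ (by simp [hx, h])
      rw [(ha v hv).2] at hξ'
      exact (mem_sel.1 hξ').1)
    (fun v hv ξ hξ => by
      simp only [hx]
      rw [castQ_eq_of_pattern (ha v hv).2 hξ, (ha v hv).1.2])
    h0 h1 hM0 hMn (V := C + 1) fun v hv => by
      rw [← hn]
      have h2 : ‖ι (x v)‖ ≤ ‖ι (x v) - y (a v)‖ + ‖y (a v)‖ := by
        simpa using norm_add_le (ι (x v) - y (a v)) (y (a v))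
      have h3 := (ha v hv).1.1.2
      have := hnear v
      rw [hC]; linarith
  set l := 1 / (2 * M * ε) with hl
  have hl0 : 0 < l := by positivity
  have hlM : l * (2 * M) = 1 / ε := by rw [hl]; field_simp
  rw [← hn] at hsmall
  have hup := hfA (a 0) (ha 0 (by omega)).1
    (ι (x 0 - x 1 - l • ∑ v ∈ Ico 2 (2 * M + 2), (-1 : ℝ) ^ v • x v))
  have hCl : C * (l * (C + 1)) < δ / 2 := by
    rw [div_lt_iff₀ (by positivity)] at hM
    rw [hl, show C * (1 / (2 * M * ε) * (C + 1)) = C * (C + 1) / (2 * M * ε) by ring,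
      div_lt_iff₀ (by positivity)]
    linarith
  have hup2 := hup.trans_lt ((mul_le_mul_of_nonneg_left hsmall (by linarith)).trans_lt hCl)
  simp only [map_sub, map_smul, map_sum, smul_eq_mul] at hup2
  have hclose : ∀ v, |f (a 0) (ι (x v)) - f (a 0) (y (a v))| ≤ C * η := fun v => by
    rw [← map_sub]
    exact (hfA (a 0) (ha 0 (by omega)).1 _).trans
      (mul_le_mul_of_nonneg_left (hnear v).le (by linarith))
  have hbd : ∀ v < n (k + 1), v ≠ 0 → |f (a 0) (ι (x v))| ≤ τ + C * η := fun v hv hv0 => by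
    have e1 := abs_le.1 (hclose v)
    have e2 := abs_le.1 (hf2 _ _ (ha0 v hv hv0))
    exact abs_le.2 ⟨by linarith, by linarith⟩
  have hsum : |∑ v ∈ Ico 2 (2 * M + 2), (-1 : ℝ) ^ v * f (a 0) (ι (x v))| ≤
      2 * M * (τ + C * η) := by
    refine (abs_sum_le_sum_abs _ _).trans ((sum_le_card_nsmul _ _ (τ + C * η) fun v hv => ?_).trans ?_)
    · have := mem_Ico.1 hv
      rw [abs_mul, abs_pow, abs_neg, abs_one, one_pow, one_mul]
      exact hbd v (by omega) (by omega)
    · rw [nsmul_eq_mul, Nat.card_Ico, show 2 * M + 2 - 2 = 2 * M by omega]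
      push_cast; exact le_rfl
  have e0 := (abs_le.1 (hclose 0)).1
  rw [hf1] at e0
  have e1 := (abs_le.1 (hbd 1 (by omega) one_ne_zero)).2
  have e2 := (abs_le.1 hsum).2
  have e3 := mul_le_mul_of_nonneg_left e2 hl0.le
  have e4 : l * (2 * M * (τ + C * η)) = τ / ε + C * η * (1 / ε) := by
    rw [← mul_assoc, hlM]; ring
  have e5 := (abs_lt.1 hup2).2
  linarith

end

end SchemeConstruction

end

theorem theorem1 (hD : Diamond) (ε : ℚ) (hε0 : 0 < ε) (hε1 : ε < 1) :
    ∃ (m n r : ℕ → ℕ) (S : ConstructionScheme m n r),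
      IsSchemeType m n r ∧ S.IsCapturing ∧
      ∃ (X : Type) (_ : NormedAddCommGroup X) (_ : NormedSpace ℝ X)
        (ι : (Omega1 →₀ ℝ) →ₗ[ℝ] X),
        S.IsNormCompletion (ε : ℝ) X ι ∧
        HasUncountableBiorthogonalSystem X (ε : ℝ) ∧
        (∀ τ : ℝ, 0 ≤ τ → τ < (ε : ℝ) / (1 + (ε : ℝ)) →
          ¬ HasUncountableBiorthogonalSystem X τ) ∧
        ¬ HasUncountableBiorthogonalSystem X 0 := by
  obtain ⟨m, n, r, hT, hr⟩ := SchemeConstruction.exists_isSchemeType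
  obtain ⟨L, hL⟩ := SchemeConstruction.exists_isCapturingFamily hD hT
  have h0 : (0 : ℝ) < ε := by exact_mod_cast hε0
  have h1 : (ε : ℝ) ≤ 1 := by exact_mod_cast hε1.le
  obtain ⟨X, i1, i2, ι, hX, hn⟩ :=
    SchemeConstruction.exists_isNormCompletion hL hT hr h0.le h1
  have hno : ∀ τ : ℝ, 0 ≤ τ → τ < (ε : ℝ) / (1 + (ε : ℝ)) →
      ¬ HasUncountableBiorthogonalSystem X τ := fun τ hτ0 hτ =>
    SchemeConstruction.not_hasUncountableBiorthogonalSystem hL hT h0 h1 hX.dense hn hτ0 hτ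
  exact ⟨m, n, r, hL.toScheme hT hr, hT, hL.isCapturing_toScheme hT hr, X, i1, i2, ι, hX,
    SchemeConstruction.hasUncountableBiorthogonalSystem hL hT h0.le h1 hX.injective hn, hno,
    hno 0 le_rfl (by positivity)⟩
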